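/- **Setting.** Let $I=[a,b]$, $T_e>0$, and let $u$ be a sufficiently smooth solution of $iu_t+u_{xx}=0$ on $I\times(0,T_e]$ that is $(b-a)$-periodic in $x$. Let $a=x_{1/2}<x_{3/2}<\dots<x_{N+1/2}=b$ be a mesh with cells $I_j=(x_{j-1/2},x_{j+1/2})$, lengths $h_j$, $h=\max_j h_j$, and $h/\min_j h_j<\sigma$ with $\sigma$ fixed; cell indices are understood modulo $N$. Let $P^k$ be the complex polynomials of degree at most $k$ and $V_h^k=\{v: v|_{I_j}\in P^k\ \forall j\}$. At an interface, $v^-$ and $v^+$ are the traces from the left and the right cell, $[v]=v^+-v^-$, $\{v\}=\tfrac12(v^++v^-)$. Fix real constants $\tilde\alpha_1,\tilde\beta_1,\tilde\beta_2$, put $\alpha_1=\tilde\alpha_1$, $\beta_1=\tilde\beta_1h^{-1}$, $\beta_2=\tilde\beta_2h$ (scale invariant flux) and $$\hat v=\{v\}-\alpha_1[v]+\beta_2[v_x],\qquad \widetilde{v_x}=\{v_x\}+\alpha_1[v_x]+\beta_1[v].$$ The ultra-weak DG solution $u_h(t)\in V_h^k$ satisfies, for $t\in(0,T_e]$, all $j$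 and all $v\in V_h^k$, $$\int_{I_j}(u_h)_t v\,dx-i\Big(\int_{I_j}u_hv_{xx}\,dx-\hat u_hv_x^-|_{j+\frac12}+\hat u_hv_x^+|_{j-\frac12}+\widetilde{(u_h)_x}v^-|_{j+\frac12}-\widetilde{(u_h)_x}v^+|_{j-\frac12}\Big)=0 .$$ Let $$\Gamma_j=\beta_1+\tfrac{\beta_2}{h_j^2}k^2(k^2-1)-\tfrac{2k^2}{h_j}\big(\alpha_1^2+\beta_1\beta_2+\tfrac14\big),\qquad \Lambda_j=-\tfrac{2k}{h_j}\big(\alpha_1^2+\beta_1\beta_2-\tfrac14\big)$$ (written $\Gamma,\Lambda$ on uniform meshes), fix $\delta>0$, and consider the assumptions * A1: $\alpha_1^2+\beta_1\beta_2=\frac14$ and $h_j|\Gamma_j|\ge\delta$ for all $j$; * A2: the mesh is uniform, $\alpha_1^2+\beta_1\beta_2\ne\frac14$ and $|\Gamma/\Lambda|>1$; * A3: the mesh is uniform, $\alpha_1^2+\beta_1\beta_2\ne\frac14$, and either (A3$_=$) $|\Gamma/\Lambda|=1$, $N$ is odd and $\big((-1)^{k+1}\Gamma/\Lambda\big)^N\neq1$,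 or (A3$_<$) $|\Gamma/\Lambda|<1$ and $\Big|\big((-1)^{k+1}\tfrac{\Gamma}{\Lambda}+\sqrt{(\Gamma/\Lambda)^2-1}\big)^N-1\Big|\ge\delta$. Let $P_h^\star u\in V_h^k$ be given by $\int_{I_j}P_h^\star u\,v\,dx=\int_{I_j}u\,v\,dx$ for all $v\in P^{k-2}$ and all $j$, and $\widehat{P_h^\star u}=u$, $\widetilde{(P_h^\star u)_x}=u_x$ at all $x_{j+\frac12}$. Put $w_0=u-P_h^\star u$, and for $1\le q\le\lfloor\frac{k-1}2\rfloor$ let $w_q\in V_h^k$ be given by $\int_{I_j}w_qv_{xx}\,dx=-i\int_{I_j}(w_{q-1})_tv\,dx$ for all $v\in P^k\setminus P^1$ and all $j$, and $\widehat{w_q}=0$, $\widetilde{(w_q)_x}=0$ at all $x_{j+\frac12}$. Let $u_I=P_h^\star u-\sum_{q=1}^{\lfloor (k-1)/2\rfloor}w_q$. Finally let $$E_f=\Big(\frac1N\sum_{j=1}^N|u-\widehat{u_h}|^2_{j+\frac12}\Big)^{\frac12},\quad E_{f_x}=\Big(\frac1N\sum_{j=1}^N|u_x-\widetilde{(u_h)_x}|^2_{j+\frac12}\Big)^{\frac12},\quad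 E_c=\Big(\frac1N\sum_{j=1}^N\Big|\frac1{h_j}\int_{I_j}(u-u_h)\,dx\Big|^2\Big)^{\frac12}.$$ The constants $C_m,C_{m,n}$ below depend only on $k,a,b,T_e,\sigma,\delta,\tilde\alpha_1,\tilde\beta_1,\tilde\beta_2$ and on an upper bound, over $t\in[0,T_e]$, for the following (semi)norm of $u(\cdot,t)$; in particular they do not depend on the mesh. $C_m$: $|u|_{W^{k+1+m,\infty}(I)}$ (under A1/A2). $C_{m,n}$: $|u|_{W^{k+1+m+2n,\infty}(I)}$ under A1/A2, $\|u\|_{W^{k+3+m+3n,\infty}(I)}$ under A3$_<$, and $\|u\|_{W^{k+4+m+4n,\infty}(I)}$ under A3$_=$. It suffices that $u$ is of class $C^s$ on $\mathbb R\times[0,T_e]$ with $s$ the highest order that occurs in the estimate in question. **Theorem.** Let $k\ge2$ and $u_h|_{t=0}=u_I|_{t=0}$. Then for all $t\in(0,T_e]$: * if $k$ is odd and one of A1, A2, A3 holds, $$E_f\le C_{2,\frac{k-1}2}h^{2k},\qquad E_{f_x}\le C_{2,\frac{k-1}2}h^{2k-1},\qquad E_c\le C_{2,\frac{k-1}2}h^{2k};$$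 * if $k$ is even and one of A1, A2 holds, with $S=\big(C_{k+2}h^{4k}+\sum_{I_j\subset I^{NU}}C_kh^{4k-1}\big)^{1/2}$, $$E_f\le S,\qquad E_{f_x}\le S\,h^{-1},\qquad E_c\le S,$$ where $I^{NU}$ is the collection of the cells whose length differs from that of at least one of their (periodic) neighbours; in particular, on uniform meshes the rates are $2k$, $2k-1$ and $2k$; * if $k$ is even and A3 holds, $$E_f\le C_{2,\frac{k-2}2}h^{2k-1},\qquad E_{f_x}\le C_{2,\frac{k-2}2}h^{2k-2},\qquad E_c\le C_{2,\frac{k-2}2}h^{2k-1}.$$ -/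

import Mathlib

open Set Polynomial

noncomputable section

namespace UWDG

/-- A mesh `a = x_{1/2} < x_{3/2} < ... < x_{N+1/2} = b` of `[a, b]` with `N` cells.  The cell
with index `j : Fin N` is the interval between `node j.castSucc` and `node j.succ`. -/
structure Mesh (a b : ℝ) (N : ℕ) where
  node : Fin (N + 1) → ℝ
  strictMono : StrictMono node
  node_zero : node 0 = a
  node_last : node (Fin.last N) = b

namespace Mesh

variable {a b : ℝ} {N : ℕ}

/-- Left end point of the cell `j`. -/
def left (𝓘 : Mesh a b N) (j : Fin N) : ℝ := 𝓘.node j.castSucc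

/-- Right end point of the cell `j`. -/
def right (𝓘 : Mesh a b N) (j : Fin N) : ℝ := 𝓘.node j.succ

/-- The cell length `h_j`. -/
def len (𝓘 : Mesh a b N) (j : Fin N) : ℝ := 𝓘.right j - 𝓘.left j

/-- The mesh size `h = max_j h_j`. -/
def size [NeZero N] (𝓘 : Mesh a b N) : ℝ :=
  Finset.univ.sup' Finset.univ_nonempty 𝓘.len

/-- Mesh regularity `h / min_j h_j < σ`. -/
def Regular [NeZero N] (𝓘 : Mesh a b N) (σ : ℝ) : Prop :=
  ∀ j, 𝓘.size / 𝓘.len j < σ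

/-- All cells have the same length. -/
def Uniform [NeZero N] (𝓘 : Mesh a b N) : Prop :=
  ∀ j, 𝓘.len j = 𝓘.size

/-- The cells whose length differs from that of at least one neighbour.  Neighbours are taken
periodically: addition and subtraction on `Fin N` are modulo `N`. -/
def nonUniformCells [NeZero N] (𝓘 : Mesh a b N) : Finset (Fin N) :=
  Finset.univ.filter fun j => 𝓘.len j ≠ 𝓘.len (j - 1) ∨ 𝓘.len j ≠ 𝓘.len (j + 1)

end Mesh

/-- The mesh independent constants of a scale invariant flux; the flux parameters on a mesh of
size `h` are `α`, `β₁ / h` and `β₂ * h`. -/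
structure Flux where
  α : ℝ
  β₁ : ℝ
  β₂ : ℝ

/-- A piecewise polynomial, given by one complex polynomial in the variable `x` for each cell. -/
abbrev PiecewisePoly (N : ℕ) := Fin N → ℂ[X]

/-- Membership in the space of piecewise polynomials of degree at most `k`. -/
def InSpace {N : ℕ} (k : ℕ) (v : PiecewisePoly N) : Prop :=
  ∀ j, (v j).natDegree ≤ k

/-- Cellwise derivative. -/
def dx {N : ℕ} (v : PiecewisePoly N) : PiecewisePoly N := fun j => derivative (v j)

section Fluxes

variable {a b : ℝ} {N : ℕ} [NeZero N]

/-- The trace `v⁻` at the interface between the cells `j` and `j + 1` (modulo `N`). -/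
def traceMinus (𝓘 : Mesh a b N) (v : PiecewisePoly N) (j : Fin N) : ℂ :=
  (v j).eval (𝓘.right j : ℂ)

/-- The trace `v⁺` at the interface between the cells `j` and `j + 1` (modulo `N`). -/
def tracePlus (𝓘 : Mesh a b N) (v : PiecewisePoly N) (j : Fin N) : ℂ :=
  (v (j + 1)).eval (𝓘.left (j + 1) : ℂ)

def jump (𝓘 : Mesh a b N) (v : PiecewisePoly N) (j : Fin N) : ℂ :=
  tracePlus 𝓘 v j - traceMinus 𝓘 v j

def average (𝓘 : Mesh a b N) (v : PiecewisePoly N) (j : Fin N) : ℂ :=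
  (tracePlus 𝓘 v j + traceMinus 𝓘 v j) / 2

/-- The numerical flux for the function, `{v} - α₁ [v] + β₂ [v_x]`, at the right end of cell `j`. -/
def hatFlux (F : Flux) (𝓘 : Mesh a b N) (v : PiecewisePoly N) (j : Fin N) : ℂ :=
  average 𝓘 v j - (F.α : ℂ) * jump 𝓘 v j + ((F.β₂ * 𝓘.size : ℝ) : ℂ) * jump 𝓘 (dx v) j

/-- The numerical flux for the derivative, `{v_x} + α₁ [v_x] + β₁ [v]`, at the right end of
cell `j`. -/
def tildeFlux (F : Flux) (𝓘 : Mesh a b N) (v : PiecewisePoly N) (j : Fin N) : ℂ :=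
  average 𝓘 (dx v) j + (F.α : ℂ) * jump 𝓘 (dx v) j + ((F.β₁ / 𝓘.size : ℝ) : ℂ) * jump 𝓘 v j

/-- The ultra-weak discretization `A_j(v, φ)` of the second derivative on the cell `j`, with a
polynomial test function `φ`. -/
def spatialForm (F : Flux) (𝓘 : Mesh a b N) (v : PiecewisePoly N) (j : Fin N) (φ : ℂ[X]) : ℂ :=
  (∫ x in (𝓘.left j)..(𝓘.right j), (v j).eval (x : ℂ) * (derivative (derivative φ)).eval (x : ℂ))
    - hatFlux F 𝓘 v j * (derivative φ).eval (𝓘.right j : ℂ)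
    + hatFlux F 𝓘 v (j - 1) * (derivative φ).eval (𝓘.left j : ℂ)
    + tildeFlux F 𝓘 v j * φ.eval (𝓘.right j : ℂ)
    - tildeFlux F 𝓘 v (j - 1) * φ.eval (𝓘.left j : ℂ)

/-- `u_h` solves the semi-discrete scheme on `(0, T]`; it is continuous in time on `[0, T]` and
differentiable in time on `(0, T]`. -/
structure IsSemiDiscreteSolution (k : ℕ) (T : ℝ) (F : Flux) (𝓘 : Mesh a b N)
    (uh : ℝ → PiecewisePoly N) : Prop where
  mem : ∀ t ∈ Icc 0 T, InSpace k (uh t)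
  continuousOn : ∀ j m, ContinuousOn (fun t => (uh t j).coeff m) (Icc 0 T)
  differentiable : ∀ t ∈ Ioc 0 T, ∀ j m,
    DifferentiableWithinAt ℝ (fun s => (uh s j).coeff m) (Icc 0 T) t
  scheme : ∀ t ∈ Ioc 0 T, ∀ j, ∀ φ : ℂ[X], φ.natDegree ≤ k →
    (∫ x in (𝓘.left j)..(𝓘.right j),
      derivWithin (fun s => (uh s j).eval (x : ℂ)) (Icc 0 T) t * φ.eval (x : ℂ))
      - Complex.I * spatialForm F 𝓘 (uh t) j φ = 0

/-- `p` is the projection `P⋆ f` of the function `f` associated with the flux. -/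
structure IsProjection (k : ℕ) (F : Flux) (𝓘 : Mesh a b N) (f : ℝ → ℂ)
    (p : PiecewisePoly N) : Prop where
  mem : InSpace k p
  moment : ∀ j, ∀ φ : ℂ[X], φ.natDegree ≤ k - 2 →
    ∫ x in (𝓘.left j)..(𝓘.right j), (p j).eval (x : ℂ) * φ.eval (x : ℂ) =
      ∫ x in (𝓘.left j)..(𝓘.right j), f x * φ.eval (x : ℂ)
  hat_eq : ∀ j, hatFlux F 𝓘 p j = f (𝓘.right j)
  tilde_eq : ∀ j, tildeFlux F 𝓘 p j = deriv f (𝓘.right j)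

/-- The functions `w_0 = u - P⋆ u` and `w_q`, `q ≥ 1`, at time `t`, on the cell `j`, at `x`. -/
def correctionValue (u : ℝ → ℝ → ℂ) (P : ℝ → PiecewisePoly N) (w : ℕ → ℝ → PiecewisePoly N) :
    ℕ → ℝ → Fin N → ℝ → ℂ
  | 0, t, j, x => u x t - (P t j).eval (x : ℂ)
  | q + 1, t, j, x => (w (q + 1) t j).eval (x : ℂ)

/-- `w 1, ..., w ⌊(k-1)/2⌋` are the correction functions, where `P t` is the projection of
`u(·, t)`. -/
structure IsCorrection (k : ℕ) (T : ℝ) (F : Flux) (𝓘 : Mesh a b N) (u : ℝ → ℝ → ℂ)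
    (P : ℝ → PiecewisePoly N) (w : ℕ → ℝ → PiecewisePoly N) : Prop where
  mem : ∀ q ∈ Finset.Icc 1 ((k - 1) / 2), ∀ t ∈ Icc 0 T, InSpace k (w q t)
  moment : ∀ q ∈ Finset.Icc 1 ((k - 1) / 2), ∀ t ∈ Icc 0 T, ∀ j, ∀ φ : ℂ[X],
    φ.natDegree ≤ k → ¬ φ.natDegree ≤ 1 →
    ∫ x in (𝓘.left j)..(𝓘.right j),
        (w q t j).eval (x : ℂ) * (derivative (derivative φ)).eval (x : ℂ) =
      -Complex.I * ∫ x in (𝓘.left j)..(𝓘.right j),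
        derivWithin (fun s => correctionValue u P w (q - 1) s j x) (Icc 0 T) t * φ.eval (x : ℂ)
  hat_eq : ∀ q ∈ Finset.Icc 1 ((k - 1) / 2), ∀ t ∈ Icc 0 T, ∀ j, hatFlux F 𝓘 (w q t) j = 0
  tilde_eq : ∀ q ∈ Finset.Icc 1 ((k - 1) / 2), ∀ t ∈ Icc 0 T, ∀ j, tildeFlux F 𝓘 (w q t) j = 0

/-- `uI` is the function `u_I = P⋆ u - ∑_{q=1}^{⌊(k-1)/2⌋} w_q` on `[0, T]`. -/
def IsInterpolant (k : ℕ) (T : ℝ) (F : Flux) (𝓘 : Mesh a b N) (u : ℝ → ℝ → ℂ)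
    (uI : ℝ → PiecewisePoly N) : Prop :=
  ∃ (P : ℝ → PiecewisePoly N) (w : ℕ → ℝ → PiecewisePoly N),
    (∀ t ∈ Icc 0 T, IsProjection k F 𝓘 (fun x => u x t) (P t)) ∧
    IsCorrection k T F 𝓘 u P w ∧
    ∀ t ∈ Icc 0 T, ∀ j, uI t j = P t j - ∑ q ∈ Finset.Icc 1 ((k - 1) / 2), w q t j

/-- `E_f`, the error of the numerical flux for the function at time `t`. -/
def errFlux (F : Flux) (𝓘 : Mesh a b N) (u : ℝ → ℝ → ℂ) (uh : ℝ → PiecewisePoly N) (t : ℝ) : ℝ :=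
  √((1 / (N : ℝ)) * ∑ j, ‖u (𝓘.right j) t - hatFlux F 𝓘 (uh t) j‖ ^ 2)

/-- `E_{f_x}`, the error of the numerical flux for the derivative at time `t`. -/
def errFluxDeriv (F : Flux) (𝓘 : Mesh a b N) (u : ℝ → ℝ → ℂ) (uh : ℝ → PiecewisePoly N)
    (t : ℝ) : ℝ :=
  √((1 / (N : ℝ)) *
    ∑ j, ‖deriv (fun x => u x t) (𝓘.right j) - tildeFlux F 𝓘 (uh t) j‖ ^ 2)

/-- `E_c`, the error of the cell averages at time `t`. -/
def errCellAvg (𝓘 : Mesh a b N) (u : ℝ → ℝ → ℂ) (uh : ℝ → PiecewisePoly N) (t : ℝ) : ℝ :=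
  √((1 / (N : ℝ)) * ∑ j, ‖((1 / 𝓘.len j : ℝ) : ℂ) *
    ∫ x in (𝓘.left j)..(𝓘.right j), (u x t - (uh t j).eval (x : ℂ))‖ ^ 2)

/-- The quantity `Γ_j`. -/
def Gam (k : ℕ) (F : Flux) (𝓘 : Mesh a b N) (j : Fin N) : ℝ :=
  F.β₁ / 𝓘.size + F.β₂ * 𝓘.size / 𝓘.len j ^ 2 * ((k : ℝ) ^ 2 * ((k : ℝ) ^ 2 - 1))
    - 2 * (k : ℝ) ^ 2 / 𝓘.len j * (F.α ^ 2 + F.β₁ / 𝓘.size * (F.β₂ * 𝓘.size) + 1 / 4)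

/-- The quantity `Λ_j`. -/
def Lam (k : ℕ) (F : Flux) (𝓘 : Mesh a b N) (j : Fin N) : ℝ :=
  -(2 * (k : ℝ) / 𝓘.len j) * (F.α ^ 2 + F.β₁ / 𝓘.size * (F.β₂ * 𝓘.size) - 1 / 4)

/-- Assumption A1 (local projection), with the condition `Γ_j ≠ 0` in its scale invariant
quantitative form `h_j |Γ_j| ≥ δ`. -/
def AssumptionA1 (k : ℕ) (F : Flux) (δ : ℝ) (𝓘 : Mesh a b N) : Prop :=
  F.α ^ 2 + F.β₁ / 𝓘.size * (F.β₂ * 𝓘.size) = 1 / 4 ∧ ∀ j, δ ≤ 𝓘.len j * |Gam k F 𝓘 j|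

/-- Assumption A2 (global projection). -/
def AssumptionA2 (k : ℕ) (F : Flux) (𝓘 : Mesh a b N) : Prop :=
  𝓘.Uniform ∧ F.α ^ 2 + F.β₁ / 𝓘.size * (F.β₂ * 𝓘.size) ≠ 1 / 4 ∧
    ∀ j, 1 < |Gam k F 𝓘 j / Lam k F 𝓘 j|

/-- Assumption A3 (global projection), case `|Γ/Λ| < 1`, with the condition `λ ^ N ≠ 1` on
`λ = (-1)^{k+1} Γ/Λ + √((Γ/Λ)² - 1)` in its quantitative form `|λ ^ N - 1| ≥ δ`. -/
def AssumptionA3lt (k : ℕ) (F : Flux) (δ : ℝ) (𝓘 : Mesh a b N) : Prop :=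
  𝓘.Uniform ∧ F.α ^ 2 + F.β₁ / 𝓘.size * (F.β₂ * 𝓘.size) ≠ 1 / 4 ∧
    ∀ j, |Gam k F 𝓘 j / Lam k F 𝓘 j| < 1 ∧
      δ ≤ ‖((((-1) ^ (k + 1) * (Gam k F 𝓘 j / Lam k F 𝓘 j) : ℝ) : ℂ)
        + Complex.I * (√(1 - (Gam k F 𝓘 j / Lam k F 𝓘 j) ^ 2) : ℝ)) ^ N - 1‖

/-- Assumption A3 (global projection), case `|Γ/Λ| = 1`. -/
def AssumptionA3eq (k : ℕ) (F : Flux) (𝓘 : Mesh a b N) : Prop :=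
  𝓘.Uniform ∧ F.α ^ 2 + F.β₁ / 𝓘.size * (F.β₂ * 𝓘.size) ≠ 1 / 4 ∧ Odd N ∧
    ∀ j, |Gam k F 𝓘 j / Lam k F 𝓘 j| = 1 ∧
      ((-1) ^ (k + 1) * (Gam k F 𝓘 j / Lam k F 𝓘 j)) ^ N ≠ 1

end Fluxes

/-- `u(x, t)` is a solution of `i u_t + u_xx = 0` on `ℝ × (0, T]`, periodic in `x` with period
`b - a`, and of class `C^s` on `ℝ × [0, T]`. -/
structure IsExactSolution (a b T : ℝ) (s : ℕ) (u : ℝ → ℝ → ℂ) : Prop where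
  smooth : ContDiffOn ℝ s (fun p : ℝ × ℝ => u p.1 p.2) (univ ×ˢ Icc 0 T)
  periodic : ∀ t ∈ Icc 0 T, Function.Periodic (fun x => u x t) (b - a)
  equation : ∀ t ∈ Ioc 0 T, ∀ x,
    Complex.I * derivWithin (fun r => u x r) (Icc 0 T) t + iteratedDeriv 2 (fun y => u y t) x = 0

/-- `|u(·, t)|_{W^{s,∞}} ≤ M` for all `t ∈ [0, T]`. -/
def SeminormBound (T : ℝ) (s : ℕ) (u : ℝ → ℝ → ℂ) (M : ℝ) : Prop :=
  ∀ t ∈ Icc 0 T, ∀ x, ‖iteratedDeriv s (fun y => u y t) x‖ ≤ M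

/-- `‖u(·, t)‖_{W^{s,∞}} ≤ M` for all `t ∈ [0, T]`. -/
def NormBound (T : ℝ) (s : ℕ) (u : ℝ → ℝ → ℂ) (M : ℝ) : Prop :=
  ∀ i ≤ s, SeminormBound T i u M

/-- The pair of an exact solution `u` of class `C^s` and the solution `u_h` of the scheme with
initial value `u_h(0) = u_I(0)`. -/
def IsSolutionPair {a b : ℝ} {N : ℕ} [NeZero N] (k : ℕ) (T : ℝ) (F : Flux) (𝓘 : Mesh a b N)
    (s : ℕ) (u : ℝ → ℝ → ℂ) (uh : ℝ → PiecewisePoly N) : Prop :=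
  IsExactSolution a b T s u ∧ IsSemiDiscreteSolution k T F 𝓘 uh ∧
    ∃ uI, IsInterpolant k T F 𝓘 u uI ∧ uh 0 = uI 0

/-- There is a constant, depending on the solution only through a bound `M` in the sense of
`bd`, with `E_f ≤ C h^p`, `E_{f_x} ≤ C h^r`, `E_c ≤ C h^p` on `(0, T]`, on all `σ`-regular meshes
in the class `adm` and for all solutions of class `C^s`. -/
def ErrorRates (k : ℕ) (a b T σ : ℝ) (F : Flux) (adm : ∀ (N : ℕ) [NeZero N], Mesh a b N → Prop)
    (s : ℕ) (bd : (ℝ → ℝ → ℂ) → ℝ → Prop) (p r : ℕ) : Prop :=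
  ∃ C : ℝ → ℝ, ∀ (N : ℕ) [NeZero N] (𝓘 : Mesh a b N), 𝓘.Regular σ → adm N 𝓘 →
    ∀ (u : ℝ → ℝ → ℂ) (uh : ℝ → PiecewisePoly N), IsSolutionPair k T F 𝓘 s u uh →
    ∀ M : ℝ, bd u M → ∀ t ∈ Ioc 0 T,
      errFlux F 𝓘 u uh t ≤ C M * 𝓘.size ^ p ∧
      errFluxDeriv F 𝓘 u uh t ≤ C M * 𝓘.size ^ r ∧
      errCellAvg 𝓘 u uh t ≤ C M * 𝓘.size ^ p

end UWDG

end

/-! Energy argument. Summed over the cells, the discrete second derivative is a Hermitian form: with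
these fluxes every interface term is real (`im_interface_eq_zero`, `im_sum_refForm`). The scheme
therefore conserves the L² norm, and the difference between `u_h` and a comparison function `Y` is
bounded by its initial value and by the defect of `Y` in the scheme, with no loss of a power of `h`
(`energy_le`, `exists_error_bound`). On the reference cell all norms of polynomials of degree at
most `k` are equivalent, so this also controls fluxes and cell averages. What is needed is a
comparison function with a very small defect.

Corrections. Since the fluxes of `P⋆u` are exact, two integrations by parts show that its defect is
the projection error of `u_xx`. Because `u_t = i u_xx`, a time derivative can be traded for two
space derivatives: each `w_q` is a fixed linear operator applied to `u(·, t)`, with `∂_t w_q[u] = i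
w_q[u_xx]`, so that `-i ∂_t w_{q-1}[u] = w_{q-1}[u_xx]`. Each correction integrates the preceding
defect twice. It gains `h²` but loses two degrees of orthogonality: `w_q` is orthogonal to
polynomials of degree at most `k - 2 - 2q`. A defect orthogonal to linear polynomials can be removed
by a correction with vanishing fluxes. After `Q = ⌊(k-1)/2⌋` corrections the remaining defect is
`w_Q[u_xx]`, of size `h^(k+1+2Q)`: order `2k` for odd `k`, order `2k - 1` for even `k`
(`exists_chain_bound`, `refForm_interpPoly`, `exists_error_rates`).

Even degree under A1 or A2. Here `w_Q` is still orthogonal to constants but in general not to linear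
functions. One further correction is allowed nonzero fluxes: its derivative flux is one constant
over the mesh and its function flux accumulates increments from cell to cell, the constant being
fixed by periodicity. It gains a single factor `h`, which gives order `2k`. It enters the comparison
function only, not `u_I`; the resulting initial discrepancy is itself of order `2k` (`refForm_star`,
`exists_star_bound`, `exists_error_rates_even`).

Stability. All sizes come from bounding a piecewise polynomial by its moments of degree at most `k -
2` and its fluxes (`exists_stability`). The moments leave two Legendre coefficients per cell, and
these are to be recovered from the fluxes. Under A1 the two trace matrices in the fluxes are
complementary projections and the problem decouples into 2×2 systems, one per cell. On uniform
meshes elimination gives a periodic second-order recurrence whose characteristic roots have product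
1. Roots off the unit circle (A2) give a uniform bound. Distinct nonreal roots on the circle cost
one difference quotient of the data, the double root -1 costs two. On a uniform mesh difference
quotients commute with all the operators, and each costs one derivative of `u`; this explains the
stronger norms under A3. -/

noncomputable section
namespace UWDG

/-! ### Polynomials and their moments on the reference cell. -/

/-- The function on the real line given by a complex polynomial. -/
def polyFun (p : ℂ[X]) : ℝ → ℂ := fun ξ => p.eval (ξ : ℂ)

/-- The moment of a function on `[0, 1]` against a polynomial. -/
def moment (G : ℝ → ℂ) (φ : ℂ[X]) : ℂ := ∫ ξ in (0 : ℝ)..1, G ξ * φ.eval (ξ : ℂ)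

theorem continuous_polyFun (p : ℂ[X]) : Continuous (polyFun p) := by
  unfold polyFun; fun_prop

theorem hasDerivAt_polyFun (p : ℂ[X]) (x : ℝ) :
    HasDerivAt (polyFun p) ((derivative p).eval (x : ℂ)) x :=
  (p.hasDerivAt (x : ℂ)).comp_ofReal

/-- The antiderivative of a polynomial that vanishes at `0`. -/
def antider : ℂ[X] →ₗ[ℂ] ℂ[X] :=
  Polynomial.lsum fun n => (monomial (n + 1)).comp (LinearMap.mulLeft ℂ ((n : ℂ) + 1)⁻¹)

theorem antider_monomial (n : ℕ) (c : ℂ) :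
    antider (monomial n c) = monomial (n + 1) (((n : ℂ) + 1)⁻¹ * c) := by
  simp [antider, Polynomial.lsum_apply, Polynomial.sum_monomial_index]

theorem coeff_antider_succ (p : ℂ[X]) (n : ℕ) :
    (antider p).coeff (n + 1) = ((n : ℂ) + 1)⁻¹ * p.coeff n := by
  induction p using Polynomial.induction_on' with
  | add p q hp hq => simp [hp, hq, mul_add]
  | monomial m c =>
    rw [antider_monomial, coeff_monomial, coeff_monomial]
    by_cases h : m = n
    · simp [h]
    · simp [h]

theorem coeff_antider_zero (p : ℂ[X]) : (antider p).coeff 0 = 0 := by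
  induction p using Polynomial.induction_on' with
  | add p q hp hq => simp [hp, hq]
  | monomial m c => rw [antider_monomial, coeff_monomial]; simp

theorem derivative_antider (p : ℂ[X]) : derivative (antider p) = p := by
  ext n
  have : (n : ℂ) + 1 ≠ 0 := by exact_mod_cast Nat.succ_ne_zero n
  rw [coeff_derivative, coeff_antider_succ]
  field_simp

theorem antider_eval_zero (p : ℂ[X]) : (antider p).eval 0 = 0 := by
  rw [← coeff_zero_eq_eval_zero, coeff_antider_zero]

theorem natDegree_antider_le {p : ℂ[X]} {n : ℕ} (h : p.natDegree ≤ n) :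
    (antider p).natDegree ≤ n + 1 := by
  rw [natDegree_le_iff_coeff_eq_zero]
  intro m hm
  obtain ⟨m, rfl⟩ : ∃ m', m = m' + 1 := ⟨m - 1, by omega⟩
  rw [coeff_antider_succ, coeff_eq_zero_of_natDegree_lt (by omega), mul_zero]

/-- The sum of the norms of the coefficients of degree at most `k`. -/
def cnorm (k : ℕ) (p : ℂ[X]) : ℝ := ∑ i ∈ Finset.range (k + 1), ‖p.coeff i‖

theorem cnorm_nonneg (k : ℕ) (p : ℂ[X]) : 0 ≤ cnorm k p :=
  Finset.sum_nonneg fun _ _ => norm_nonneg _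

theorem cnorm_add_le (k : ℕ) (p q : ℂ[X]) : cnorm k (p + q) ≤ cnorm k p + cnorm k q := by
  unfold cnorm
  rw [← Finset.sum_add_distrib]
  exact Finset.sum_le_sum fun i _ => by rw [coeff_add]; exact norm_add_le _ _

theorem cnorm_smul (k : ℕ) (c : ℂ) (p : ℂ[X]) : cnorm k (c • p) = ‖c‖ * cnorm k p := by
  unfold cnorm
  rw [Finset.mul_sum]
  exact Finset.sum_congr rfl fun i _ => by rw [coeff_smul, smul_eq_mul, norm_mul]

theorem norm_coeff_le_cnorm {k i : ℕ} (h : i ≤ k) (p : ℂ[X]) : ‖p.coeff i‖ ≤ cnorm k p :=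
  Finset.single_le_sum (f := fun i => ‖p.coeff i‖) (fun _ _ => norm_nonneg _)
    (Finset.mem_range.2 (by omega))

theorem norm_eval_le_cnorm {k : ℕ} {p : ℂ[X]} (hp : p.natDegree ≤ k) {ξ : ℝ} (hξ : ξ ∈ Icc (0:ℝ) 1) :
    ‖p.eval (ξ : ℂ)‖ ≤ cnorm k p := by
  rw [eval_eq_sum_range' (Nat.lt_succ_of_le hp)]
  refine (norm_sum_le _ _).trans (Finset.sum_le_sum fun i _ => ?_)
  rw [norm_mul, norm_pow, Complex.norm_real, Real.norm_of_nonneg hξ.1]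
  exact mul_le_of_le_one_right (norm_nonneg _) (pow_le_one₀ hξ.1 hξ.2)

theorem cnorm_derivative_le {k : ℕ} {p : ℂ[X]} (hp : p.natDegree ≤ k) :
    cnorm k (derivative p) ≤ k * cnorm k p := by
  unfold cnorm
  rw [Finset.sum_range_succ, coeff_derivative, coeff_eq_zero_of_natDegree_lt (by omega : _ < k + 1),
    zero_mul, norm_zero, add_zero, Finset.mul_sum, Finset.sum_range_succ']
  refine le_add_of_le_of_nonneg (Finset.sum_le_sum fun i hi => ?_) (by positivity)
  rw [coeff_derivative, norm_mul, mul_comm]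
  gcongr
  have : ((i : ℂ) + 1) = ((i + 1 : ℕ) : ℂ) := by push_cast; rfl
  rw [this, Complex.norm_natCast]
  exact_mod_cast Finset.mem_range.1 hi

theorem norm_derivative_eval_le {k : ℕ} {p : ℂ[X]} (hp : p.natDegree ≤ k) {ξ : ℝ}
    (hξ : ξ ∈ Icc (0:ℝ) 1) : ‖(derivative p).eval (ξ : ℂ)‖ ≤ k * cnorm k p :=
  (norm_eval_le_cnorm ((natDegree_derivative_le p).trans (by omega)) hξ).trans
    (cnorm_derivative_le hp)

theorem cnorm_antider_le (k : ℕ) (p : ℂ[X]) : cnorm (k + 1) (antider p) ≤ cnorm k p := by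
  unfold cnorm
  rw [Finset.sum_range_succ', coeff_antider_zero, norm_zero, add_zero]
  refine Finset.sum_le_sum fun i _ => ?_
  rw [coeff_antider_succ, norm_mul]
  refine mul_le_of_le_one_left (norm_nonneg _) ?_
  have : ((i : ℂ) + 1) = ((i + 1 : ℕ) : ℂ) := by push_cast; rfl
  rw [this, norm_inv, Complex.norm_natCast]
  exact inv_le_one_of_one_le₀ (by exact_mod_cast Nat.succ_le_succ (Nat.zero_le i))

/-- The double antiderivative that vanishes to second order at `0`. -/
def antider₂ : ℂ[X] →ₗ[ℂ] ℂ[X] := antider.comp antider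

theorem derivative_antider₂ (p : ℂ[X]) : derivative (derivative (antider₂ p)) = p := by
  simp [antider₂, derivative_antider]

theorem antider₂_eval_zero (p : ℂ[X]) : (antider₂ p).eval 0 = 0 := antider_eval_zero _

theorem derivative_antider₂_eval_zero (p : ℂ[X]) : (derivative (antider₂ p)).eval 0 = 0 := by
  simp [antider₂, derivative_antider, antider_eval_zero]

theorem natDegree_antider₂_le {p : ℂ[X]} {n : ℕ} (h : p.natDegree ≤ n) :
    (antider₂ p).natDegree ≤ n + 2 := natDegree_antider_le (natDegree_antider_le h)

theorem cnorm_antider₂_le (k : ℕ) (p : ℂ[X]) : cnorm (k + 2) (antider₂ p) ≤ cnorm k p :=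
  (cnorm_antider_le _ _).trans (cnorm_antider_le _ _)

theorem norm_moment_le {G : ℝ → ℂ} {B : ℝ} {k : ℕ} {φ : ℂ[X]} (hφ : φ.natDegree ≤ k)
    (hG : ∀ ξ ∈ Icc (0:ℝ) 1, ‖G ξ‖ ≤ B) : ‖moment G φ‖ ≤ B * cnorm k φ := by
  have := intervalIntegral.norm_integral_le_of_norm_le_const (a := 0) (b := 1)
    (f := fun ξ : ℝ => G ξ * φ.eval (ξ : ℂ)) (C := B * cnorm k φ) (fun ξ hξ => by
      rw [uIoc_of_le zero_le_one] at hξ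
      have h' : ξ ∈ Icc (0:ℝ) 1 := ⟨hξ.1.le, hξ.2⟩
      rw [norm_mul]
      exact mul_le_mul (hG ξ h') (norm_eval_le_cnorm hφ h') (norm_nonneg _)
        ((norm_nonneg _).trans (hG ξ h')))
  simpa [moment] using this

theorem moment_add_right {G : ℝ → ℂ} (hG : ContinuousOn G (Icc 0 1)) (φ ψ : ℂ[X]) :
    moment G (φ + ψ) = moment G φ + moment G ψ := by
  have hi : ∀ φ : ℂ[X], IntervalIntegrable (fun ξ : ℝ => G ξ * φ.eval (ξ : ℂ))
      MeasureTheory.volume 0 1 := fun φ => by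
    apply ContinuousOn.intervalIntegrable
    rw [uIcc_of_le zero_le_one]
    exact hG.mul (continuous_polyFun φ).continuousOn
  unfold moment
  rw [← intervalIntegral.integral_add (hi φ) (hi ψ)]
  simp [mul_add]

theorem moment_smul_right (G : ℝ → ℂ) (c : ℂ) (φ : ℂ[X]) :
    moment G (c • φ) = c * moment G φ := by
  unfold moment
  rw [← intervalIntegral.integral_const_mul]
  congr 1; ext ξ; simp; ring

theorem moment_add_left {G H : ℝ → ℂ} (hG : ContinuousOn G (Icc 0 1)) (hH : ContinuousOn H (Icc 0 1))
    (φ : ℂ[X]) : moment (fun ξ => G ξ + H ξ) φ = moment G φ + moment H φ := by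
  have hi : ∀ G : ℝ → ℂ, ContinuousOn G (Icc 0 1) → IntervalIntegrable
      (fun ξ : ℝ => G ξ * φ.eval (ξ : ℂ)) MeasureTheory.volume 0 1 := fun G hG => by
    apply ContinuousOn.intervalIntegrable
    rw [uIcc_of_le zero_le_one]
    exact hG.mul (continuous_polyFun φ).continuousOn
  unfold moment
  rw [← intervalIntegral.integral_add (hi G hG) (hi H hH)]
  simp [add_mul]

theorem moment_const_mul_left (G : ℝ → ℂ) (c : ℂ) (φ : ℂ[X]) :
    moment (fun ξ => c * G ξ) φ = c * moment G φ := by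
  unfold moment
  rw [← intervalIntegral.integral_const_mul]
  congr 1; ext ξ; ring

theorem moment_sub_left {G H : ℝ → ℂ} (hG : ContinuousOn G (Icc 0 1)) (hH : ContinuousOn H (Icc 0 1))
    (φ : ℂ[X]) : moment (fun ξ => G ξ - H ξ) φ = moment G φ - moment H φ := by
  have h := moment_add_left hG (hH.const_smul (-1 : ℂ)) φ
  have h2 := moment_const_mul_left H (-1) φ
  have e : (fun ξ => G ξ - H ξ) = fun ξ => G ξ + ((-1 : ℂ) • H) ξ := by
    ext ξ; simp [sub_eq_add_neg]
  have e2 : ((-1 : ℂ) • H) = fun ξ => -1 * H ξ := by ext ξ; simp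
  rw [e, h, e2, h2]; ring

theorem moment_congr {G H : ℝ → ℂ} (h : ∀ ξ ∈ Icc (0:ℝ) 1, G ξ = H ξ) (φ : ℂ[X]) :
    moment G φ = moment H φ := by
  unfold moment
  apply intervalIntegral.integral_congr
  intro ξ hξ
  rw [uIcc_of_le zero_le_one] at hξ
  simp only [h ξ hξ]

/-- Integration by parts for a function against a polynomial. -/
theorem moment_derivative {G G' : ℝ → ℂ} (hG : ∀ ξ ∈ Icc (0:ℝ) 1, HasDerivAt G (G' ξ) ξ)
    (hG' : ContinuousOn G' (Icc 0 1)) (φ : ℂ[X]) :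
    moment G (derivative φ) = G 1 * φ.eval 1 - G 0 * φ.eval 0 - moment G' φ := by
  have := intervalIntegral.integral_mul_deriv_eq_deriv_mul (a := 0) (b := 1) (u := G) (u' := G')
    (v := polyFun φ) (v' := polyFun (derivative φ))
    (fun x hx => hG x (by rwa [uIcc_of_le zero_le_one] at hx))
    (fun x _ => hasDerivAt_polyFun φ x)
    (by apply ContinuousOn.intervalIntegrable; rwa [uIcc_of_le zero_le_one])
    ((continuous_polyFun _).intervalIntegrable _ _)
  simpa [moment, polyFun] using this

/-- The polynomial with conjugated coefficients. -/
def conjPoly (p : ℂ[X]) : ℂ[X] := p.map (starRingEnd ℂ)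

theorem conjPoly_eval (p : ℂ[X]) (x : ℝ) :
    (conjPoly p).eval (x : ℂ) = (starRingEnd ℂ) (p.eval (x : ℂ)) := by
  have h := Polynomial.hom_eval₂ p (RingHom.id ℂ) (starRingEnd ℂ) (x : ℂ)
  rw [Complex.conj_ofReal] at h
  rw [conjPoly, eval_map, eval, h, RingHom.comp_id]

theorem natDegree_conjPoly (p : ℂ[X]) : (conjPoly p).natDegree = p.natDegree :=
  natDegree_map _

theorem cnorm_conjPoly (k : ℕ) (p : ℂ[X]) : cnorm k (conjPoly p) = cnorm k p := by
  simp [cnorm, conjPoly, coeff_map]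

theorem derivative_conjPoly (p : ℂ[X]) : derivative (conjPoly p) = conjPoly (derivative p) := by
  simp [conjPoly, derivative_map]

theorem moment_conjPoly (p : ℂ[X]) :
    moment (polyFun p) (conjPoly p) = ((∫ ξ in (0:ℝ)..1, ‖p.eval (ξ : ℂ)‖ ^ 2 : ℝ) : ℂ) := by
  rw [moment, ← intervalIntegral.integral_ofReal]
  congr 1; ext ξ
  rw [conjPoly_eval, polyFun, Complex.mul_conj, Complex.normSq_eq_norm_sq]

/-- On polynomials of degree at most `k` the coefficients are controlled by the `L²` norm. -/
theorem exists_cnorm_sq_le (k : ℕ) : ∃ c : ℝ, 0 < c ∧ ∀ p : ℂ[X], p.natDegree ≤ k →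
    cnorm k p ^ 2 ≤ c * ∫ ξ in (0:ℝ)..1, ‖p.eval (ξ : ℂ)‖ ^ 2 := by
  let q : (Fin (k + 1) → ℂ) → ℂ[X] := fun v => ∑ i, C (v i) * X ^ (i : ℕ)
  have hqe : ∀ v (x : ℂ), (q v).eval x = ∑ i, v i * x ^ (i : ℕ) := fun v x => by
    simp [q, eval_finsetSum]
  let E : (Fin (k + 1) → ℂ) → ℝ := fun v => ∫ ξ in (0:ℝ)..1, ‖(q v).eval (ξ : ℂ)‖ ^ 2
  have hE : Continuous E := by
    apply intervalIntegral.continuous_parametric_intervalIntegral_of_continuous'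
    simp only [Function.uncurry_def, hqe]
    fun_prop
  have hcoef : ∀ v (i : Fin (k + 1)), (q v).coeff i = v i := fun v i => by
    simp only [q, finsetSum_coeff, coeff_C_mul_X_pow]
    rw [Finset.sum_eq_single i]
    · simp
    · intro j _ hj; rw [if_neg]; intro h; exact hj (Fin.ext h.symm)
    · simp
  have hpos : ∀ v, v ≠ 0 → 0 < E v := by
    intro v hv
    have hq : q v ≠ 0 := by
      intro h
      apply hv
      ext i
      rw [← hcoef v i, h]; simp
    obtain ⟨c, hc, hc0⟩ : ∃ c ∈ Icc (0:ℝ) 1, (q v).eval (c : ℂ) ≠ 0 := by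
      by_contra hcon
      push Not at hcon
      apply hq
      apply Polynomial.eq_zero_of_infinite_isRoot
      refine Set.Infinite.mono (s := (fun x : ℝ => (x : ℂ)) '' Icc (0:ℝ) 1) ?_ ?_
      · rintro _ ⟨x, hx, rfl⟩
        exact hcon x hx
      · exact (Set.Icc_infinite zero_lt_one).image Complex.ofReal_injective.injOn
    refine intervalIntegral.integral_pos zero_lt_one ?_ (fun x _ => by positivity)
      ⟨c, hc, by positivity⟩
    exact ((continuous_polyFun (q v)).norm.pow 2).continuousOn
  have hscale : ∀ (r : ℝ) v, E (fun i => (r : ℂ) * v i) = r ^ 2 * E v := by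
    intro r v
    simp only [E]
    rw [← intervalIntegral.integral_const_mul]
    congr 1; ext ξ
    simp only [hqe]
    rw [← sq_abs r, ← mul_pow, ← Real.norm_eq_abs, ← Complex.norm_real, ← norm_mul, Finset.mul_sum]
    simp only [mul_assoc]
  -- Equivalence of norms in finite dimension: the squared L² norm is continuous, positive off zero
  -- and homogeneous of degree two, so its minimum over the unit sphere is a positive lower bound.
  obtain ⟨v₀, hv₀, hmin⟩ := (isCompact_sphere (0 : Fin (k + 1) → ℂ) 1).exists_isMinOn
    (NormedSpace.sphere_nonempty.2 zero_le_one) hE.continuousOn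
  have hm : 0 < E v₀ := hpos v₀ (by
    rintro rfl
    simp at hv₀)
  -- The sphere is that of the maximum norm; `(k + 1) ^ 2` pays for passing to the sum of the `k +
  -- 1` coefficients.
  refine ⟨(k + 1) ^ 2 / E v₀, by positivity, fun p hp => ?_⟩
  let v : Fin (k + 1) → ℂ := fun i => p.coeff i
  have hqp : q v = p := by
    ext n
    by_cases hn : n < k + 1
    · exact hcoef v ⟨n, hn⟩
    · rw [coeff_eq_zero_of_natDegree_lt (by omega : p.natDegree < n)]
      simp only [q, finsetSum_coeff, coeff_C_mul_X_pow]
      exact Finset.sum_eq_zero fun i _ => if_neg (by omega)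
  have hcn : cnorm k p ≤ (k + 1) * ‖v‖ := by
    unfold cnorm
    have := Finset.sum_le_card_nsmul (Finset.range (k + 1)) (fun i => ‖p.coeff i‖) ‖v‖
      (fun i hi => norm_le_pi_norm v ⟨i, Finset.mem_range.1 hi⟩)
    simpa using this
  have key : E v₀ * ‖v‖ ^ 2 ≤ E v := by
    by_cases hv : v = 0
    · have : 0 ≤ E v := intervalIntegral.integral_nonneg zero_le_one fun _ _ => by positivity
      simpa [hv] using this
    have hn : ‖v‖ ≠ 0 := norm_ne_zero_iff.2 hv
    have h1 := hmin (a := fun i => ((‖v‖⁻¹ : ℝ) : ℂ) * v i) (by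
      have : (fun i => ((‖v‖⁻¹ : ℝ) : ℂ) * v i) = ((‖v‖⁻¹ : ℝ) : ℂ) • v := rfl
      rw [mem_sphere_zero_iff_norm, this, norm_smul, Complex.norm_real, norm_inv, norm_norm,
        inv_mul_cancel₀ hn])
    have h2 : E v₀ ≤ ‖v‖⁻¹ ^ 2 * E v := by rw [← hscale]; exact h1
    calc E v₀ * ‖v‖ ^ 2 ≤ ‖v‖⁻¹ ^ 2 * E v * ‖v‖ ^ 2 := by gcongr
      _ = E v := by field_simp
  have hEv : E v = ∫ ξ in (0:ℝ)..1, ‖p.eval (ξ : ℂ)‖ ^ 2 := by simp only [E, hqp]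
  rw [← hEv]
  calc cnorm k p ^ 2 ≤ ((k + 1) * ‖v‖) ^ 2 := by
        gcongr; exact cnorm_nonneg _ _
    _ = (k + 1) ^ 2 / E v₀ * (E v₀ * ‖v‖ ^ 2) := by field_simp
    _ ≤ _ := by gcongr

/-! ### Shifted Legendre polynomials and the splitting off of the two top coefficients. -/

/-- The shifted Legendre polynomial with complex coefficients. -/
def leg (n : ℕ) : ℂ[X] := (shiftedLegendre n).map (Int.castRingHom ℂ)

theorem coeff_leg (n i : ℕ) : (leg n).coeff i = (-1) ^ i * n.choose i * (n + i).choose n := by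
  simp [leg, coeff_map, coeff_shiftedLegendre]

theorem natDegree_leg_le (n : ℕ) : (leg n).natDegree ≤ n :=
  natDegree_map_le.trans (natDegree_shiftedLegendre n).le

theorem coeff_leg_self_ne_zero (n : ℕ) : (leg n).coeff n ≠ 0 := by
  rw [coeff_leg]
  have := (Nat.choose_pos (show n ≤ n + n by simp)).ne'
  simpa using this

theorem leg_symm (n : ℕ) : (leg n).comp (1 - X) = C ((-1) ^ n) * leg n := by
  have h := congrArg (Polynomial.map (Int.castRingHom ℂ))
    (neg_one_pow_mul_shiftedLegendre_comp_one_sub_X_eq n)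
  simp only [Polynomial.map_mul, Polynomial.map_pow, Polynomial.map_neg, Polynomial.map_one,
    map_comp, Polynomial.map_sub, map_X] at h
  change (-1) ^ n * (leg n).comp (1 - X) = leg n at h
  conv_rhs => rw [← h]
  rw [← mul_assoc]
  simp only [map_pow, map_neg, map_one, ← mul_pow]
  simp

theorem leg_eval_zero (n : ℕ) : (leg n).eval 0 = 1 := by
  rw [← coeff_zero_eq_eval_zero, coeff_leg]; simp

theorem leg_eval_one (n : ℕ) : (leg n).eval 1 = (-1) ^ n := by
  have h := congrArg (eval 0) (leg_symm n)
  simpa [eval_comp, leg_eval_zero] using h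

theorem derivative_leg_eval_zero (n : ℕ) : (derivative (leg n)).eval 0 = -(n * (n + 1)) := by
  rw [← coeff_zero_eq_eval_zero, coeff_derivative, coeff_leg]
  simp

theorem derivative_leg_eval_one (n : ℕ) :
    (derivative (leg n)).eval 1 = (-1) ^ n * (n * (n + 1)) := by
  have h := congrArg (fun p => eval 0 (derivative p)) (leg_symm n)
  simp only [derivative_comp, derivative_C_mul, eval_mul, eval_comp, derivative_leg_eval_zero] at h
  simp at h
  rw [h]

/-- Integration by parts moves one derivative onto `φ`. The boundary terms vanish because a
derivative of order less than `n` of `X ^ n * (1 - X) ^ n` still has zeros at both end points. This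
is the orthogonality behind Rodrigues' formula. -/
theorem moment_iterate_derivative_eq_zero (n m : ℕ) (hm : m ≤ n) (φ : ℂ[X]) (hφ : φ.degree < m) :
    moment (polyFun (derivative^[m] (X ^ n * (1 - X) ^ n))) φ = 0 := by
  induction m generalizing φ with
  | zero =>
    have : φ = 0 := by
      rw [← degree_eq_bot]
      simpa using hφ
    simp [this, moment]
  | succ m ih =>
    set P : ℂ[X] := X ^ n * (1 - X) ^ n with hP
    have h0 : (derivative^[m] P).eval 0 = 0 := by
      have hd : X ^ (n - m) ∣ derivative^[m] P :=
        pow_sub_dvd_iterate_derivative_of_pow_dvd m (Dvd.intro _ rfl)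
      obtain ⟨r, hr⟩ := hd
      rw [hr]; simp [show n - m ≠ 0 by omega]
    have h1 : (derivative^[m] P).eval 1 = 0 := by
      have hd : (1 - X) ^ (n - m) ∣ derivative^[m] P :=
        pow_sub_dvd_iterate_derivative_of_pow_dvd m (Dvd.intro_left _ rfl)
      obtain ⟨r, hr⟩ := hd
      rw [hr]; simp [show n - m ≠ 0 by omega]
    have hparts := moment_derivative (G := polyFun φ) (G' := polyFun (derivative φ))
      (fun ξ _ => hasDerivAt_polyFun φ ξ) (continuous_polyFun _).continuousOn (derivative^[m] P)
    rw [h0, h1] at hparts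
    have hcomm : ∀ p q : ℂ[X], moment (polyFun p) q = moment (polyFun q) p := fun p q => by
      simp [moment, polyFun, mul_comm]
    rw [Function.iterate_succ_apply', hcomm, hparts, hcomm, ih (by omega)]
    · simp
    · by_cases h : φ = 0
      · simp [h]
      · have h1 := degree_derivative_lt h
        rw [degree_eq_natDegree h] at hφ h1
        have h2 : φ.natDegree < m + 1 := by exact_mod_cast hφ
        exact h1.trans_le (by exact_mod_cast Nat.lt_succ_iff.1 h2)

theorem moment_leg {n : ℕ} {φ : ℂ[X]} (hφ : φ.natDegree < n) : moment (polyFun (leg n)) φ = 0 := by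
  have h := congrArg (Polynomial.map (Int.castRingHom ℂ)) (factorial_mul_shiftedLegendre_eq n)
  rw [Polynomial.map_mul, ← iterate_derivative_map] at h
  simp only [Polynomial.map_natCast, Polynomial.map_mul, Polynomial.map_pow, Polynomial.map_sub,
    Polynomial.map_one, map_X] at h
  have h2 := moment_iterate_derivative_eq_zero n n le_rfl φ
    ((degree_le_natDegree).trans_lt (by exact_mod_cast hφ))
  rw [← h] at h2
  have h3 : polyFun ((n.factorial : ℂ[X]) * leg n) = fun ξ => (n.factorial : ℂ) * polyFun (leg n) ξ := by
    ext ξ; simp [polyFun]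
  change moment (polyFun ((n.factorial : ℂ[X]) * leg n)) φ = 0 at h2
  rw [h3, moment_const_mul_left] at h2
  exact (mul_eq_zero.1 h2).resolve_left (by exact_mod_cast n.factorial_ne_zero)

/-- The coefficient of `leg k` in the decomposition of a polynomial of degree at most `k`. -/
def topCoeff (k : ℕ) : ℂ[X] →ₗ[ℂ] ℂ := ((leg k).coeff k)⁻¹ • lcoeff ℂ k

/-- The coefficient of `leg (k - 1)` in the decomposition of a polynomial of degree at most `k`. -/
def subCoeff (k : ℕ) : ℂ[X] →ₗ[ℂ] ℂ :=
  (topCoeff (k - 1)).comp (LinearMap.id - (topCoeff k).smulRight (leg k))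

/-- The `L²` projection of a polynomial of degree at most `k` to degree at most `k - 2`. -/
def lowPart (k : ℕ) : ℂ[X] →ₗ[ℂ] ℂ[X] :=
  LinearMap.id - (topCoeff k).smulRight (leg k) - (subCoeff k).smulRight (leg (k - 1))

/-- A formal identity for every `p`. It is an orthogonal decomposition, with `lowPart k p` of degree
at most `k - 2`, once `p` has degree at most `k`. -/
theorem eq_lowPart_add (k : ℕ) (p : ℂ[X]) :
    p = lowPart k p + subCoeff k p • leg (k - 1) + topCoeff k p • leg k := by
  simp [lowPart]

theorem natDegree_sub_topCoeff {k : ℕ} {p : ℂ[X]} (hp : p.natDegree ≤ k + 1) :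
    (p - topCoeff (k + 1) p • leg (k + 1)).natDegree ≤ k := by
  rw [natDegree_le_iff_coeff_eq_zero]
  intro m hm
  rcases Nat.lt_or_ge (k + 1) m with h | h
  · rw [coeff_sub, coeff_smul, coeff_eq_zero_of_natDegree_lt (by omega),
      coeff_eq_zero_of_natDegree_lt ((natDegree_leg_le _).trans_lt h)]
    simp
  · obtain rfl : m = k + 1 := by omega
    have := coeff_leg_self_ne_zero (k + 1)
    simp [topCoeff]
    field_simp
    simp

theorem natDegree_lowPart {k : ℕ} (hk : 2 ≤ k) {p : ℂ[X]} (hp : p.natDegree ≤ k) :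
    (lowPart k p).natDegree ≤ k - 2 := by
  obtain ⟨k, rfl⟩ : ∃ m, k = m + 2 := ⟨k - 2, by omega⟩
  have h1 := natDegree_sub_topCoeff (k := k + 1) hp
  have h2 := natDegree_sub_topCoeff h1
  simpa [lowPart, subCoeff] using h2

theorem moment_lowPart {k : ℕ} (hk : 2 ≤ k) (p : ℂ[X]) {φ : ℂ[X]} (hφ : φ.natDegree ≤ k - 2) :
    moment (polyFun (lowPart k p)) φ = moment (polyFun p) φ := by
  have e : polyFun p = fun ξ => (polyFun (lowPart k p) ξ +
      subCoeff k p * polyFun (leg (k - 1)) ξ) + topCoeff k p * polyFun (leg k) ξ := by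
    ext ξ
    conv_lhs => rw [eq_lowPart_add k p]
    simp [polyFun]
  have c := fun p => (continuous_polyFun p).continuousOn (s := Icc (0:ℝ) 1)
  have c' : ∀ (a : ℂ) p, ContinuousOn (fun ξ => a * polyFun p ξ) (Icc (0:ℝ) 1) :=
    fun a p => continuousOn_const.mul (c p)
  have c'' : ContinuousOn (fun ξ => polyFun (lowPart k p) ξ +
      subCoeff k p * polyFun (leg (k - 1)) ξ) (Icc (0:ℝ) 1) := (c _).add (c' _ _)
  rw [e, moment_add_left c'' (c' _ _), moment_add_left (c _) (c' _ _),
    moment_const_mul_left, moment_const_mul_left, moment_leg (by omega), moment_leg (by omega)]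
  simp

/-- A bound for the moments of a polynomial bounds its projection to degree at most `k - 2`. -/
theorem exists_cnorm_lowPart_le (k : ℕ) (hk : 2 ≤ k) : ∃ c : ℝ, 0 ≤ c ∧ ∀ (p : ℂ[X]) (ε : ℝ),
    p.natDegree ≤ k → (∀ ψ : ℂ[X], ψ.natDegree ≤ k - 2 →
      ‖moment (polyFun p) ψ‖ ≤ ε * cnorm (k - 2) ψ) → cnorm (k - 2) (lowPart k p) ≤ c * ε := by
  obtain ⟨c, hc, h⟩ := exists_cnorm_sq_le (k - 2)
  refine ⟨c, hc.le, fun p ε hp hm => ?_⟩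
  have hd := natDegree_lowPart hk hp
  have h1 := h _ hd
  -- Testing with the conjugate of the low part itself yields its squared L² norm, which is then
  -- bounded by `ε` times its coefficient norm.
  have h2 := hm (conjPoly (lowPart k p)) ((natDegree_conjPoly _).le.trans hd)
  rw [← moment_lowPart hk p ((natDegree_conjPoly _).le.trans hd), moment_conjPoly,
    cnorm_conjPoly, Complex.norm_real] at h2
  have h3 := (le_abs_self _).trans h2
  set s := cnorm (k - 2) (lowPart k p)
  have h0 : 0 ≤ s := cnorm_nonneg _ _
  have h4 : s ^ 2 ≤ c * (ε * s) := h1.trans (by gcongr)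
  rcases h0.eq_or_lt with h5 | h5
  -- If the low part vanishes there is nothing to divide by. Only `0 ≤ ε` is needed, and the test
  -- polynomial 1 gives it.
  · have h6 := (norm_nonneg _).trans (hm 1 (by simp))
    have h7 : 0 < cnorm (k - 2) 1 := lt_of_lt_of_le (by simp)
      (norm_coeff_le_cnorm (Nat.zero_le (k-2)) (1 : ℂ[X]))
    have h8 : 0 ≤ ε := nonneg_of_mul_nonneg_left h6 h7
    rw [← h5]; positivity
  · exact le_of_mul_le_mul_right (by nlinarith) h5

end UWDG
end

/-! ### Periodic differences and stability of periodic recurrences. -/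

noncomputable section
namespace UWDG

section Difference

variable {N : ℕ} [NeZero N] {E E' : Type*} [AddCommGroup E] [Module ℂ E] [AddCommGroup E']
  [Module ℂ E']

/-- The periodic forward difference, scaled by the number of cells. -/
def diff (f : Fin N → E) : Fin N → E := fun j => (N : ℂ) • (f (j + 1) - f j)

theorem diff_add (f g : Fin N → E) : diff (f + g) = diff f + diff g := by
  ext j; simp only [diff, Pi.add_apply, ← smul_add]; congr 1; abel

theorem diff_sub (f g : Fin N → E) : diff (f - g) = diff f - diff g := by
  ext j; simp only [diff, Pi.sub_apply, ← smul_sub]; congr 1; abel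

theorem diff_smul (c : ℂ) (f : Fin N → E) : diff (c • f) = c • diff f := by
  ext j; simp only [diff, Pi.smul_apply]; rw [← smul_sub, smul_comm]

theorem diff_shift (f : Fin N → E) : diff (fun j => f (j + 1)) = fun j => diff f (j + 1) := rfl

theorem diff_zero : diff (0 : Fin N → E) = 0 := by
  ext j; simp [diff]

theorem diff_iterate_add (i : ℕ) (f g : Fin N → E) :
    diff^[i] (f + g) = diff^[i] f + diff^[i] g := by
  induction i generalizing f g with
  | zero => rfl
  | succ i ih => simp only [Function.iterate_succ_apply, diff_add, ih]

theorem diff_iterate_sub (i : ℕ) (f g : Fin N → E) :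
    diff^[i] (f - g) = diff^[i] f - diff^[i] g := by
  induction i generalizing f g with
  | zero => rfl
  | succ i ih => simp only [Function.iterate_succ_apply, diff_sub, ih]

theorem diff_iterate_smul (i : ℕ) (c : ℂ) (f : Fin N → E) :
    diff^[i] (c • f) = c • diff^[i] f := by
  induction i generalizing f with
  | zero => rfl
  | succ i ih => simp only [Function.iterate_succ_apply, diff_smul, ih]

theorem diff_iterate_shift (i : ℕ) (f : Fin N → E) :
    diff^[i] (fun j => f (j + 1)) = fun j => diff^[i] f (j + 1) := by
  induction i generalizing f with
  | zero => rfl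
  | succ i ih => simp only [Function.iterate_succ_apply, diff_shift, ih]

theorem diff_iterate_map (i : ℕ) (L : E →ₗ[ℂ] E') (f : Fin N → E) :
    diff^[i] (fun j => L (f j)) = fun j => L (diff^[i] f j) := by
  induction i generalizing f with
  | zero => rfl
  | succ i ih =>
    simp only [Function.iterate_succ_apply, ← ih]
    congr 1; ext j; simp [diff]

end Difference

section Recurrence

variable {N : ℕ} [NeZero N]

/-- Evaluate at an index where `‖y‖` is maximal: for `‖μ‖ < 1` compare with the predecessor, for
`‖μ‖ > 1` with the successor. The bound does not depend on `N`. -/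
theorem norm_le_of_recurrence_of_norm_ne_one {μ : ℂ} (hμ : ‖μ‖ ≠ 1) {y e : Fin N → ℂ} {ε : ℝ}
    (h : ∀ j, y (j + 1) = μ * y j + e j) (he : ∀ j, ‖e j‖ ≤ ε) (j : Fin N) :
    ‖y j‖ ≤ |‖μ‖ - 1|⁻¹ * ε := by
  obtain ⟨i, hi⟩ := Finite.exists_max fun j => ‖y j‖
  refine (hi j).trans ?_
  rw [inv_mul_eq_div, le_div_iff₀ (abs_pos.2 (sub_ne_zero.2 hμ))]
  rcases lt_or_gt_of_ne hμ with h1 | h1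
  · rw [abs_of_neg (by linarith)]
    have h2 := h (i - 1)
    rw [sub_add_cancel] at h2
    have h3 : ‖y i‖ ≤ ‖μ‖ * ‖y (i - 1)‖ + ‖e (i - 1)‖ := by
      rw [h2, ← norm_mul]; exact norm_add_le _ _
    have h4 := mul_le_mul_of_nonneg_left (hi (i - 1)) (norm_nonneg μ)
    nlinarith [he (i - 1)]
  · rw [abs_of_pos (by linarith)]
    have h3 : ‖μ‖ * ‖y i‖ ≤ ‖y (i + 1)‖ + ‖e i‖ := by
      rw [← norm_mul, show μ * y i = y (i + 1) - e i by rw [h i]; ring]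
      exact norm_sub_le _ _
    nlinarith [he i, hi (i + 1)]

/-- On the unit circle nothing decays. Going once around the period gives `(μ ^ N - 1) y j` as a sum
of `N` error terms, hence the factor `N`. -/
theorem norm_le_of_recurrence_of_pow_ne_one {μ : ℂ} (hμ : ‖μ‖ = 1) {δ : ℝ} (hδ : 0 < δ)
    (hN : δ ≤ ‖μ ^ N - 1‖) {y e : Fin N → ℂ} {ε : ℝ}
    (h : ∀ j, y (j + 1) = μ * y j + e j) (he : ∀ j, ‖e j‖ ≤ ε) (j : Fin N) :
    ‖y j‖ ≤ N * ε / δ := by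
  have key : ∀ m : ℕ, ‖y (j + m • (1 : Fin N)) - μ ^ m * y j‖ ≤ m * ε := by
    intro m
    induction m with
    | zero => simp
    | succ m ih =>
      have e1 : j + (m + 1) • (1 : Fin N) = j + m • (1 : Fin N) + 1 := by
        rw [succ_nsmul, add_assoc]
      rw [e1, h, show μ * y (j + m • (1 : Fin N)) + e (j + m • (1 : Fin N)) - μ ^ (m + 1) * y j =
        μ * (y (j + m • (1 : Fin N)) - μ ^ m * y j) + e (j + m • (1 : Fin N)) by ring]
      refine (norm_add_le _ _).trans ?_
      rw [norm_mul, hμ, one_mul]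
      push_cast
      linarith [he (j + m • (1 : Fin N))]
  have h1 := key N
  have hN1 : N • (1 : Fin N) = 0 := by
    simpa using card_nsmul_eq_zero (x := (1 : Fin N))
  rw [hN1, add_zero, show y j - μ ^ N * y j = -((μ ^ N - 1) * y j) by ring, norm_neg,
    norm_mul] at h1
  rw [le_div_iff₀ hδ, mul_comm]
  exact (mul_le_mul_of_nonneg_right hN (norm_nonneg _)).trans h1

/-- Removes the factor `N` at the price of one difference. The differences of `y` satisfy the same
recurrence and are bounded by `N ε / δ`; since `diff` carries a factor `N`, the identity `(1 - μ) y
= e - N⁻¹ diff y` returns a bound for `y` free of `N`. -/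
theorem norm_le_of_recurrence_of_diff {μ : ℂ} (hμ : ‖μ‖ = 1) (hμ1 : μ ≠ 1) {δ : ℝ} (hδ : 0 < δ)
    (hN : δ ≤ ‖μ ^ N - 1‖) {y e : Fin N → ℂ} {ε : ℝ}
    (h : ∀ j, y (j + 1) = μ * y j + e j) (he : ∀ j, ‖e j‖ ≤ ε) (he' : ∀ j, ‖diff e j‖ ≤ ε)
    (j : Fin N) : ‖y j‖ ≤ (1 + δ⁻¹) / ‖1 - μ‖ * ε := by
  have hz : ∀ j, diff y (j + 1) = μ * diff y j + diff e j := fun j => by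
    simp only [diff, smul_eq_mul]
    linear_combination (N : ℂ) * h (j + 1) - (N : ℂ) * h j
  have h1 := norm_le_of_recurrence_of_pow_ne_one hμ hδ hN hz he' j
  have hN0 : (0 : ℝ) < N := by exact_mod_cast Nat.pos_of_ne_zero (NeZero.ne N)
  have hN0' : (N : ℂ) ≠ 0 := by exact_mod_cast hN0.ne'
  have h2 : (1 - μ) * y j = e j - (N : ℂ)⁻¹ * diff y j := by
    simp only [diff, smul_eq_mul]
    field_simp
    linear_combination h j
  have h3 : ‖1 - μ‖ * ‖y j‖ ≤ ε + δ⁻¹ * ε := by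
    rw [← norm_mul, h2]
    refine (norm_sub_le _ _).trans (add_le_add (he j) ?_)
    rw [norm_mul, norm_inv, Complex.norm_natCast]
    calc (N : ℝ)⁻¹ * ‖diff y j‖ ≤ (N : ℝ)⁻¹ * (N * ε / δ) := by gcongr
      _ = δ⁻¹ * ε := by field_simp
  have h4 : 0 < ‖1 - μ‖ := norm_pos_iff.2 (sub_ne_zero.2 hμ1.symm)
  rw [div_mul_eq_mul_div, le_div_iff₀ h4]
  linarith

/-- The periodic recurrence `x (j + 2) - c x (j + 1) + x j = e j` can be solved with a bound
that involves `l` differences of the right-hand side. -/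
def RecurrenceStable (N : ℕ) [NeZero N] (c : ℂ) (l : ℕ) (K : ℝ) : Prop :=
  ∀ (x e : Fin N → ℂ) (ε : ℝ), (∀ j, x (j + 1 + 1) - c * x (j + 1) + x j = e j) →
    (∀ i ≤ l, ∀ j, ‖diff^[i] e j‖ ≤ ε) → ∀ j, ‖x j‖ ≤ K * ε

/-- The characteristic roots `g ± s` are real with product 1. If one had modulus 1, so would the
other, and their sum `2 * g` would have modulus at most 2. The recurrence factors into two
first-order ones, solved in succession. -/
theorem exists_recurrenceStable_of_one_lt {g : ℝ} (hg : 1 < |g|) :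
    ∃ K : ℝ, 0 ≤ K ∧ ∀ (N : ℕ) [NeZero N], RecurrenceStable N ((2 * g : ℝ) : ℂ) 0 K := by
  set s := √(g ^ 2 - 1)
  have hs : s ^ 2 = g ^ 2 - 1 := Real.sq_sqrt (by nlinarith [sq_abs g])
  have hprod : (g + s) * (g - s) = 1 := by nlinarith
  have hne : ∀ μ ν : ℝ, μ * ν = 1 → μ + ν = 2 * g → ‖(μ : ℂ)‖ ≠ 1 := by
    intro μ ν h1 h2 h3
    rw [Complex.norm_real, Real.norm_eq_abs] at h3
    have h4 : |ν| = 1 := by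
      have := congrArg abs h1
      rwa [abs_mul, h3, one_mul, abs_one] at this
    have h5 := abs_add_le μ ν
    rw [h2, abs_mul, abs_two] at h5
    linarith
  have hμ := hne (g + s) (g - s) hprod (by ring)
  have hν := hne (g - s) (g + s) (by linarith) (by ring)
  refine ⟨|‖((g - s : ℝ) : ℂ)‖ - 1|⁻¹ * |‖((g + s : ℝ) : ℂ)‖ - 1|⁻¹, by positivity,
    fun N _ x e ε h he j => ?_⟩
  have hp : ((g + s : ℝ) : ℂ) * ((g - s : ℝ) : ℂ) = 1 := by exact_mod_cast hprod
  have hsum : ((g + s : ℝ) : ℂ) + ((g - s : ℝ) : ℂ) = ((2 * g : ℝ) : ℂ) := by push_cast; ring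
  have h1 := norm_le_of_recurrence_of_norm_ne_one hμ (e := e)
    (y := fun j => x (j + 1) - ((g - s : ℝ) : ℂ) * x j) (ε := ε)
    (fun j => by linear_combination h j - x (j + 1) * hsum + x j * hp)
    (fun j => he 0 le_rfl j)
  have h2 := norm_le_of_recurrence_of_norm_ne_one hν (y := x)
    (e := fun j => x (j + 1) - ((g - s : ℝ) : ℂ) * x j) (fun j => by ring) h1 j
  rwa [mul_assoc]

/-- The roots `μ` and `ν` are conjugate and distinct on the unit circle. Solving the two first-order
factors in succession would cost two differences. Instead both `x (j + 1) - ν x j` and `x (j + 1) -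
μ x j` are bounded directly from `e`, and their difference is `(μ - ν) x j`, so one difference
suffices. -/
theorem exists_recurrenceStable_of_lt_one {g δ : ℝ} (hg : |g| < 1) (hδ : 0 < δ) :
    ∃ K : ℝ, 0 ≤ K ∧ ∀ (N : ℕ) [NeZero N],
      δ ≤ ‖((g : ℂ) + Complex.I * (√(1 - g ^ 2) : ℝ)) ^ N - 1‖ →
      RecurrenceStable N ((2 * g : ℝ) : ℂ) 1 K := by
  have hg2 : g ^ 2 < 1 := by nlinarith [sq_abs g, abs_nonneg g]
  set s := √(1 - g ^ 2) with hsdef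
  have hs : s ^ 2 = 1 - g ^ 2 := Real.sq_sqrt (by linarith)
  have hs0 : 0 < s := Real.sqrt_pos.2 (by linarith)
  set μ : ℂ := (g : ℂ) + Complex.I * (s : ℝ) with hμ
  set ν : ℂ := (starRingEnd ℂ) μ with hν
  have hν' : ν = (g : ℂ) - Complex.I * (s : ℝ) := by simp [hν, hμ, sub_eq_add_neg]
  have hsC : (s : ℂ) ^ 2 = 1 - (g : ℂ) ^ 2 := by exact_mod_cast hs
  have hp : μ * ν = 1 := by
    rw [hν', hμ]
    linear_combination hsC - (s : ℂ) ^ 2 * Complex.I_sq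
  have hsum : μ + ν = ((2 * g : ℝ) : ℂ) := by rw [hν', hμ]; push_cast; ring
  have hnν : ‖ν‖ = ‖μ‖ := Complex.norm_conj μ
  have hnμ : ‖μ‖ = 1 := by
    have := congrArg norm hp
    rw [norm_mul, hnν, norm_one] at this
    nlinarith [norm_nonneg μ]
  have hsub : μ - ν = 2 * Complex.I * s := by rw [hν', hμ]; ring
  have hsub0 : ‖μ - ν‖ = 2 * s := by
    rw [hsub]; simp [abs_of_pos hs0]
  have hμ1 : μ ≠ 1 := by
    intro h
    rw [hν, h] at hsub0
    simp at hsub0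
    exact hs0.ne' hsub0
  have hν1 : ν ≠ 1 := by
    intro h
    apply hμ1
    have := congrArg (starRingEnd ℂ) h
    simpa [hν] using this
  refine ⟨((1 + δ⁻¹) / ‖1 - μ‖ + (1 + δ⁻¹) / ‖1 - ν‖) / (2 * s), by positivity,
    fun N _ hN x e ε h he j => ?_⟩
  have hN' : δ ≤ ‖ν ^ N - 1‖ := by
    have : ν ^ N - 1 = (starRingEnd ℂ) (μ ^ N - 1) := by simp [hν]
    rwa [this, Complex.norm_conj]
  have h1 := norm_le_of_recurrence_of_diff hnμ hμ1 hδ hN (e := e)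
    (y := fun j => x (j + 1) - ν * x j) (ε := ε)
    (fun j => by linear_combination h j - x (j + 1) * hsum + x j * hp)
    (fun j => he 0 (by omega) j) (fun j => he 1 le_rfl j) j
  have h2 := norm_le_of_recurrence_of_diff (hnν.trans hnμ) hν1 hδ hN' (e := e)
    (y := fun j => x (j + 1) - μ * x j) (ε := ε)
    (fun j => by linear_combination h j - x (j + 1) * hsum + x j * hp)
    (fun j => he 0 (by omega) j) (fun j => he 1 le_rfl j) j
  have h3 : ‖μ - ν‖ * ‖x j‖ ≤ ((1 + δ⁻¹) / ‖1 - μ‖ + (1 + δ⁻¹) / ‖1 - ν‖) * ε := by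
    rw [← norm_mul, show (μ - ν) * x j = (x (j + 1) - ν * x j) - (x (j + 1) - μ * x j) by ring]
    refine (norm_sub_le _ _).trans ?_
    rw [add_mul (a := (1 + δ⁻¹) / ‖1 - μ‖)]
    exact add_le_add h1 h2
  rw [hsub0] at h3
  rw [div_mul_eq_mul_div, le_div_iff₀ (by positivity)]
  linarith

/-- The double root -1 leaves no two distinct factors to subtract, so the first-order estimate is
applied twice, first to `e` and `diff e` and then to `y` and `diff y`; this takes two differences of
`e`. For odd `N` one has `‖(-1) ^ N - 1‖ = 2`, and each application contributes `(1 + 1/2) / 2 =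
3/4`. -/
theorem exists_recurrenceStable_of_neg_one :
    ∃ K : ℝ, 0 ≤ K ∧ ∀ (N : ℕ) [NeZero N], Odd N → RecurrenceStable N (-2) 2 K := by
  refine ⟨(3 / 4) * (3 / 4), by norm_num, fun N _ hN x e ε h he => ?_⟩
  have step : ∀ (y e : Fin N → ℂ) (ε : ℝ), (∀ j, y (j + 1) = -1 * y j + e j) →
      (∀ j, ‖e j‖ ≤ ε) → (∀ j, ‖diff e j‖ ≤ ε) → ∀ j, ‖y j‖ ≤ 3 / 4 * ε := by
    intro y e ε h h1 h2 j
    have := norm_le_of_recurrence_of_diff (μ := -1) (by simp) (by norm_num) (δ := 2) (by norm_num)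
      (by rw [hN.neg_one_pow]; norm_num) h h1 h2 j
    norm_num at this ⊢
    exact this
  set y : Fin N → ℂ := fun j => x (j + 1) + x j with hy
  have hye : ∀ j, y (j + 1) = -1 * y j + e j := fun j => by
    simp only [hy]; linear_combination h j
  have hdy : ∀ j, diff y (j + 1) = -1 * diff y j + diff e j := fun j => by
    simp only [diff, smul_eq_mul]
    linear_combination (N : ℂ) * hye (j + 1) - (N : ℂ) * hye j
  have h0 := step y e ε hye (fun j => he 0 (by omega) j) (fun j => he 1 (by omega) j)
  have h1 := step (diff y) (diff e) ε hdy (fun j => he 1 (by omega) j) (fun j => he 2 le_rfl j)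
  intro j
  rw [mul_assoc]
  exact step x y _ (fun j => by simp only [hy]; ring) h0 h1 j

end Recurrence

end UWDG
end

/-! ### Mesh geometry and the fluxes in reference variables. -/

noncomputable section
namespace UWDG

section MeshFacts

variable {a b : ℝ} {N : ℕ} (𝓘 : Mesh a b N)

theorem Mesh.len_pos (j : Fin N) : 0 < 𝓘.len j :=
  sub_pos.2 (𝓘.strictMono Fin.castSucc_lt_succ)

theorem Mesh.sum_len : ∑ j, 𝓘.len j = b - a := by
  have h := Fin.sum_univ_succ (fun i : Fin (N + 1) => 𝓘.node i)
  have h' := Fin.sum_univ_castSucc (fun i : Fin (N + 1) => 𝓘.node i)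
  simp only [Mesh.len, Mesh.right, Mesh.left, Finset.sum_sub_distrib]
  rw [𝓘.node_zero] at h
  rw [𝓘.node_last] at h'
  linarith

theorem Mesh.right_eq (j : Fin N) : 𝓘.right j = 𝓘.left j + 𝓘.len j := by simp [Mesh.len]

variable [NeZero N]

theorem Mesh.len_le_size (j : Fin N) : 𝓘.len j ≤ 𝓘.size :=
  Finset.le_sup' 𝓘.len (Finset.mem_univ j)

theorem Mesh.size_pos : 0 < 𝓘.size := (𝓘.len_pos 0).trans_le (𝓘.len_le_size 0)

/-- The ratio `h / h_j`. -/
def ratio (j : Fin N) : ℝ := 𝓘.size / 𝓘.len j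

theorem ratio_pos (j : Fin N) : 0 < ratio 𝓘 j := div_pos 𝓘.size_pos (𝓘.len_pos j)

theorem ratio_le {σ : ℝ} (h : 𝓘.Regular σ) (j : Fin N) : ratio 𝓘 j ≤ σ := (h j).le

theorem ratio_eq_one (h : 𝓘.Uniform) (j : Fin N) : ratio 𝓘 j = 1 := by
  rw [ratio, h j, div_self 𝓘.size_pos.ne']

theorem Mesh.card_mul_size_of_uniform (h : 𝓘.Uniform) : (N : ℝ) * 𝓘.size = b - a := by
  rw [← 𝓘.sum_len, Finset.sum_congr rfl fun j _ => h j]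
  simp

theorem Mesh.sub_le_card_mul_size : b - a ≤ (N : ℝ) * 𝓘.size := by
  rw [← 𝓘.sum_len]
  have := Finset.sum_le_card_nsmul Finset.univ 𝓘.len 𝓘.size fun j _ => 𝓘.len_le_size j
  simpa using this

theorem Mesh.left_add_one (j : Fin N) :
    𝓘.left (j + 1) = 𝓘.right j ∨ 𝓘.left (j + 1) = 𝓘.right j - (b - a) := by
  obtain ⟨n, rfl⟩ : ∃ n, N = n + 1 := ⟨N - 1, by have := NeZero.ne N; omega⟩
  induction j using Fin.lastCases with
  | last =>
    right
    simp only [Fin.last_add_one, Mesh.left, Mesh.right]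
    have h0 := 𝓘.node_zero
    have h1 := 𝓘.node_last
    simp only [Fin.castSucc_zero, Fin.succ_last]
    rw [h0, h1]; ring
  | cast i =>
    left
    simp only [Mesh.left, Mesh.right]
    congr 1
    rw [Fin.coeSucc_eq_succ, Fin.succ_castSucc]

theorem Mesh.periodic_left_add_one {E : Type*} {f : ℝ → E} (hf : Function.Periodic f (b - a))
    (j : Fin N) (y : ℝ) : f (𝓘.left (j + 1) + y) = f (𝓘.right j + y) := by
  rcases 𝓘.left_add_one j with h | h
  · rw [h]
  · rw [h, show 𝓘.right j - (b - a) + y = 𝓘.right j + y - (b - a) by ring, hf.sub_eq]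

end MeshFacts

section ReferenceFlux

variable {a b : ℝ} {N : ℕ} [NeZero N]

/-- The flux `v̂` in terms of the polynomials on the reference cell. -/
def fluxHat (F : Flux) (𝓘 : Mesh a b N) : (Fin N → ℂ[X]) →ₗ[ℂ] (Fin N → ℂ) where
  toFun w j := (1 / 2 + F.α : ℝ) * (w j).eval 1 - (F.β₂ * ratio 𝓘 j : ℝ) * (derivative (w j)).eval 1
    + (1 / 2 - F.α : ℝ) * (w (j + 1)).eval 0
    + (F.β₂ * ratio 𝓘 (j + 1) : ℝ) * (derivative (w (j + 1))).eval 0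
  map_add' v w := by ext j; simp; ring
  map_smul' c w := by ext j; simp; ring

/-- The flux of the derivative, multiplied by the mesh size, in terms of the polynomials on the
reference cell. -/
def fluxTilde (F : Flux) (𝓘 : Mesh a b N) : (Fin N → ℂ[X]) →ₗ[ℂ] (Fin N → ℂ) where
  toFun w j := -(F.β₁ : ℝ) * (w j).eval 1
    + ((1 / 2 - F.α) * ratio 𝓘 j : ℝ) * (derivative (w j)).eval 1
    + (F.β₁ : ℝ) * (w (j + 1)).eval 0
    + ((1 / 2 + F.α) * ratio 𝓘 (j + 1) : ℝ) * (derivative (w (j + 1))).eval 0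
  map_add' v w := by ext j; simp; ring
  map_smul' c w := by ext j; simp; ring

theorem fluxHat_apply (F : Flux) (𝓘 : Mesh a b N) (w : Fin N → ℂ[X]) (j : Fin N) :
    fluxHat F 𝓘 w j =
    (1 / 2 + F.α : ℝ) * (w j).eval 1 - (F.β₂ * ratio 𝓘 j : ℝ) * (derivative (w j)).eval 1
    + (1 / 2 - F.α : ℝ) * (w (j + 1)).eval 0
    + (F.β₂ * ratio 𝓘 (j + 1) : ℝ) * (derivative (w (j + 1))).eval 0 := rfl

theorem fluxTilde_apply (F : Flux) (𝓘 : Mesh a b N) (w : Fin N → ℂ[X]) (j : Fin N) :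
    fluxTilde F 𝓘 w j = -(F.β₁ : ℝ) * (w j).eval 1
    + ((1 / 2 - F.α) * ratio 𝓘 j : ℝ) * (derivative (w j)).eval 1
    + (F.β₁ : ℝ) * (w (j + 1)).eval 0
    + ((1 / 2 + F.α) * ratio 𝓘 (j + 1) : ℝ) * (derivative (w (j + 1))).eval 0 := rfl

/-- On a uniform mesh the coefficients of the flux do not depend on the cell, so the flux commutes
with the cyclic shift. -/
theorem fluxHat_diff (F : Flux) {𝓘 : Mesh a b N} (h : 𝓘.Uniform) (i : ℕ) (w : Fin N → ℂ[X]) :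
    fluxHat F 𝓘 (diff^[i] w) = diff^[i] (fluxHat F 𝓘 w) := by
  refine Function.Semiconj.iterate_right (f := fluxHat F 𝓘) (fun w => ?_) i w
  ext j
  simp only [fluxHat_apply, diff, ratio_eq_one 𝓘 h]
  simp
  ring

theorem fluxTilde_diff (F : Flux) {𝓘 : Mesh a b N} (h : 𝓘.Uniform) (i : ℕ) (w : Fin N → ℂ[X]) :
    fluxTilde F 𝓘 (diff^[i] w) = diff^[i] (fluxTilde F 𝓘 w) := by
  refine Function.Semiconj.iterate_right (f := fluxTilde F 𝓘) (fun w => ?_) i w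
  ext j
  simp only [fluxTilde_apply, diff, ratio_eq_one 𝓘 h]
  simp
  ring

/-- A bound for the size of the coefficients of the flux. -/
def fluxWeight (F : Flux) : ℝ := 1 + |F.α| + |F.β₁| + |F.β₂|

theorem fluxWeight_bounds (F : Flux) : 1 ≤ fluxWeight F ∧ |1 / 2 + F.α| ≤ fluxWeight F ∧
    |1 / 2 - F.α| ≤ fluxWeight F ∧ |F.β₁| ≤ fluxWeight F ∧ |F.β₂| ≤ fluxWeight F := by
  have h1 := abs_nonneg F.α
  have h2 := abs_nonneg F.β₁
  have h3 := abs_nonneg F.β₂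
  have h4 := abs_add_le (1 / 2) F.α
  have h5 := abs_sub (1 / 2) F.α
  rw [abs_of_pos (by norm_num : (0:ℝ) < 1 / 2)] at h4 h5
  unfold fluxWeight
  refine ⟨?_, ?_, ?_, ?_, ?_⟩ <;> linarith

/-- The bound for both fluxes in terms of the traces. -/
theorem norm_fluxComb_le (F : Flux) (𝓘 : Mesh a b N) {σ : ℝ} (hσ : 𝓘.Regular σ)
    (j : Fin N) {B : ℝ} {z₁ z₂ z₃ z₄ : ℂ}
    (h1 : ‖z₁‖ ≤ B) (h2 : ‖z₂‖ ≤ B) (h3 : ‖z₃‖ ≤ B) (h4 : ‖z₄‖ ≤ B) :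
    ‖((1 / 2 + F.α : ℝ) : ℂ) * z₁ - (F.β₂ * ratio 𝓘 j : ℝ) * z₂
      + (1 / 2 - F.α : ℝ) * z₃ + (F.β₂ * ratio 𝓘 (j + 1) : ℝ) * z₄‖
      ≤ fluxWeight F * (2 + 2 * σ) * B ∧
    ‖-(F.β₁ : ℂ) * z₁ + ((1 / 2 - F.α) * ratio 𝓘 j : ℝ) * z₂
      + (F.β₁ : ℝ) * z₃ + ((1 / 2 + F.α) * ratio 𝓘 (j + 1) : ℝ) * z₄‖
      ≤ fluxWeight F * (2 + 2 * σ) * B := by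
  obtain ⟨hW, hA, hB', hb1, hb2⟩ := fluxWeight_bounds F
  have hB0 : 0 ≤ B := (norm_nonneg _).trans h1
  have hr : ∀ j, |ratio 𝓘 j| ≤ σ := fun j => by
    rw [abs_of_pos (ratio_pos 𝓘 j)]; exact ratio_le 𝓘 hσ j
  have hσ0 : 0 ≤ σ := (abs_nonneg _).trans (hr 0)
  have t1 : ∀ (x : ℝ) (z : ℂ), |x| ≤ fluxWeight F → ‖z‖ ≤ B → ‖(x : ℂ) * z‖ ≤ fluxWeight F * B :=
    fun x z hx hz => by
      rw [norm_mul, Complex.norm_real, Real.norm_eq_abs]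
      exact mul_le_mul hx hz (norm_nonneg _) (by linarith)
  have t2 : ∀ (x : ℝ) (j : Fin N) (z : ℂ), |x| ≤ fluxWeight F → ‖z‖ ≤ B →
      ‖((x * ratio 𝓘 j : ℝ) : ℂ) * z‖ ≤ fluxWeight F * σ * B := fun x j z hx hz => by
    rw [norm_mul, Complex.norm_real, Real.norm_eq_abs, abs_mul]
    exact mul_le_mul (mul_le_mul hx (hr j) (abs_nonneg _) (by linarith)) hz (norm_nonneg _)
      (by positivity)
  constructor
  · have e1 := t1 _ _ hA h1
    have e2 := t2 _ j _ hb2 h2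
    have e3 := t1 _ _ hB' h3
    have e4 := t2 _ (j + 1) _ hb2 h4
    refine (norm_add₃_le.trans (add_le_add_left (add_le_add_left (norm_sub_le _ _) _) _)).trans ?_
    linarith
  · have e1 := t1 _ _ hb1 h1
    have e2 := t2 _ j _ hB' h2
    have e3 := t1 _ _ hb1 h3
    have e4 := t2 _ (j + 1) _ hA h4
    refine (norm_add₃_le.trans (add_le_add_left (add_le_add_left (norm_add_le _ _) _) _)).trans ?_
    rw [neg_mul, norm_neg]
    linarith

theorem norm_flux_le_of_cnorm (F : Flux) (𝓘 : Mesh a b N) {σ : ℝ} (hσ : 𝓘.Regular σ) {k : ℕ}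
    {w : Fin N → ℂ[X]} (hw : ∀ j, (w j).natDegree ≤ k) (j : Fin N) {B : ℝ}
    (h1 : cnorm k (w j) ≤ B) (h2 : cnorm k (w (j + 1)) ≤ B) :
    ‖fluxHat F 𝓘 w j‖ ≤ fluxWeight F * (2 + 2 * σ) * ((1 + k) * B) ∧
      ‖fluxTilde F 𝓘 w j‖ ≤ fluxWeight F * (2 + 2 * σ) * ((1 + k) * B) := by
  have hB : 0 ≤ B := (cnorm_nonneg _ _).trans h1
  have e0 : ∀ {p : ℂ[X]} {ξ : ℝ}, p.natDegree ≤ k → ξ ∈ Icc (0:ℝ) 1 → cnorm k p ≤ B →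
      ‖p.eval (ξ : ℂ)‖ ≤ (1 + k) * B ∧ ‖(derivative p).eval (ξ : ℂ)‖ ≤ (1 + k) * B := by
    intro p ξ hp hξ hc
    have hkB : (k : ℝ) * cnorm k p ≤ k * B := by gcongr
    have hkB' : (0 : ℝ) ≤ k * B := by positivity
    exact ⟨by linarith [norm_eval_le_cnorm hp hξ], by linarith [norm_derivative_eval_le hp hξ]⟩
  have i0 : (0 : ℝ) ∈ Icc (0:ℝ) 1 := by simp
  have i1 : (1 : ℝ) ∈ Icc (0:ℝ) 1 := by simp
  have a1 := e0 (hw j) i1 h1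
  have a2 := e0 (hw (j + 1)) i0 h2
  simp only [Complex.ofReal_one, Complex.ofReal_zero] at a1 a2
  exact norm_fluxComb_le F 𝓘 hσ j a1.1 a1.2 a2.1 a2.2

/-! ### Recovering the two top Legendre coefficients from the fluxes under A1, A2, A3. -/

/-- The part of a piecewise polynomial that is orthogonal to the lower degrees is controlled by
its fluxes and `l` differences of them. -/
def FluxStable (k : ℕ) (F : Flux) (𝓘 : Mesh a b N) (l : ℕ) (K : ℝ) : Prop :=
  ∀ (x y : Fin N → ℂ) (ε : ℝ),
    (∀ i ≤ l, ∀ j, ‖diff^[i] (fluxHat F 𝓘 fun j => x j • leg (k - 1) + y j • leg k) j‖ ≤ ε ∧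
      ‖diff^[i] (fluxTilde F 𝓘 fun j => x j • leg (k - 1) + y j • leg k) j‖ ≤ ε) →
    ∀ j, ‖x j‖ ≤ K * ε ∧ ‖y j‖ ≤ K * ε

theorem fluxHat_leg (k : ℕ) (hk : 1 ≤ k) (F : Flux) (𝓘 : Mesh a b N) (x y : Fin N → ℂ) (j : Fin N) :
    fluxHat F 𝓘 (fun j => x j • leg (k - 1) + y j • leg k) j =
      (-1) ^ k * ((1 / 2 + F.α) - F.β₂ * ratio 𝓘 j * (k * (k + 1))) * y j
      - (-1) ^ k * ((1 / 2 + F.α) - F.β₂ * ratio 𝓘 j * ((k - 1) * k)) * x j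
      + ((1 / 2 - F.α) - F.β₂ * ratio 𝓘 (j + 1) * ((k - 1) * k)) * x (j + 1)
      + ((1 / 2 - F.α) - F.β₂ * ratio 𝓘 (j + 1) * (k * (k + 1))) * y (j + 1) := by
  obtain ⟨k, rfl⟩ : ∃ m, k = m + 1 := ⟨k - 1, by omega⟩
  simp only [fluxHat_apply, add_tsub_cancel_right, eval_add, eval_smul, smul_eq_mul, derivative_add,
    derivative_smul, leg_eval_one, leg_eval_zero, derivative_leg_eval_one,
    derivative_leg_eval_zero]
  push_cast
  ring

theorem fluxTilde_leg (k : ℕ) (hk : 1 ≤ k) (F : Flux) (𝓘 : Mesh a b N) (x y : Fin N → ℂ)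
    (j : Fin N) :
    fluxTilde F 𝓘 (fun j => x j • leg (k - 1) + y j • leg k) j =
      (-1) ^ k * ((1 / 2 - F.α) * ratio 𝓘 j * (k * (k + 1)) - F.β₁) * y j
      - (-1) ^ k * ((1 / 2 - F.α) * ratio 𝓘 j * ((k - 1) * k) - F.β₁) * x j
      + (F.β₁ - (1 / 2 + F.α) * ratio 𝓘 (j + 1) * ((k - 1) * k)) * x (j + 1)
      + (F.β₁ - (1 / 2 + F.α) * ratio 𝓘 (j + 1) * (k * (k + 1))) * y (j + 1) := by
  obtain ⟨k, rfl⟩ : ∃ m, k = m + 1 := ⟨k - 1, by omega⟩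
  simp only [fluxTilde_apply, add_tsub_cancel_right, eval_add, eval_smul, smul_eq_mul,
    derivative_add, derivative_smul, leg_eval_one, leg_eval_zero, derivative_leg_eval_one,
    derivative_leg_eval_zero]
  push_cast
  ring

/-- The pair of fluxes at an interface is `P m + Q p`, with `m` and `p` the scaled traces (value,
derivative) from the left and from the right, `P = [[1/2 + α, -β₂], [-β₁, 1/2 - α]]` and `Q = 1 -
P`. Since `P` has trace 1 and determinant `1/4 - α² - β₁β₂`, A1 says that `P` and `Q` are
complementary projections. Applying `P` at the right end of a cell and `Q` at its left end therefore
removes the neighbouring cells, and a 2×2 system with determinant proportional to `Γ_j` remains. -/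
theorem exists_fluxStable_of_assumptionA1 (k : ℕ) (hk : 2 ≤ k) (F : Flux) (a b σ δ : ℝ)
    (hδ : 0 < δ) : ∃ K : ℝ, 0 ≤ K ∧ ∀ (N : ℕ) [NeZero N] (𝓘 : Mesh a b N), 𝓘.Regular σ →
      AssumptionA1 k F δ 𝓘 → FluxStable k F 𝓘 0 K := by
  obtain ⟨hW, hA, hB, hb1, hb2⟩ := fluxWeight_bounds F
  set W := fluxWeight F
  refine ⟨(2 * W + 2 * W * |σ| * (k * (k + 1))) * (8 * W) / (2 * δ), by positivity,
    fun N _ 𝓘 hreg hA1 x y ε h j => ?_⟩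
  have hh := 𝓘.size_pos
  have hab : F.α ^ 2 + F.β₁ * F.β₂ = 1 / 4 := by
    rw [← hA1.1]; field_simp
  have habC : (F.α : ℂ) ^ 2 + F.β₁ * F.β₂ = 1 / 4 := by
    have := congrArg (fun x : ℝ => (x : ℂ)) hab; push_cast at this; exact this
  have hd : ∀ i, _ := fun i => h 0 le_rfl i
  simp only [Function.iterate_zero, id] at hd
  have hε : 0 ≤ ε := (norm_nonneg _).trans (hd 0).1
  have hs2 : ((-1 : ℂ) ^ k) ^ 2 = 1 := by rw [← pow_mul, mul_comm, pow_mul]; simp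
  set s : ℂ := (-1) ^ k
  have hs : ‖s‖ = 1 := by simp [s]
  set d₁ := fluxHat F 𝓘 fun j => x j • leg (k - 1) + y j • leg k with hd₁
  set d₂ := fluxTilde F 𝓘 fun j => x j • leg (k - 1) + y j • leg k with hd₂
  have E1 := fluxHat_leg k (by omega) F 𝓘 x y
  have E2 := fluxTilde_leg k (by omega) F 𝓘 x y
  rw [← hd₁] at E1
  rw [← hd₂] at E2
  have P1 := E1 j
  have P2 := E2 j
  have Q1 := E1 (j - 1)
  have Q2 := E2 (j - 1)
  rw [sub_add_cancel] at Q1 Q2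
  set r : ℝ := ratio 𝓘 j with hr
  set r' : ℝ := ratio 𝓘 (j - 1)
  set p : ℝ := (k - 1) * k with hp
  set q : ℝ := k * (k + 1) with hq
  have hpC : ((k : ℂ) - 1) * k = (p : ℂ) := by rw [hp]; push_cast; ring
  have hqC : (k : ℂ) * (k + 1) = (q : ℂ) := by rw [hq]; push_cast; ring
  rw [hpC, hqC] at P1 P2 Q1 Q2
  have hk2 : (2 : ℝ) ≤ k := by exact_mod_cast hk
  have hp0 : 0 ≤ p := by rw [hp]; nlinarith
  have hpq : p ≤ q := by rw [hp, hq]; nlinarith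
  have hr0 : 0 < r := ratio_pos 𝓘 j
  have hrσ : r ≤ |σ| := (ratio_le 𝓘 hreg j).trans (le_abs_self _)
  -- `(g₁, g₂)` is `P` applied to the fluxes at the right end of cell `j` plus `Q` applied to those
  -- at its left end. By `P Q = Q P = 0` only `x j` and `y j` survive in `G1` and `G2`.
  set g₁ := (1 / 2 + F.α) * d₁ j - F.β₂ * d₂ j + (1 / 2 - F.α) * d₁ (j - 1) + F.β₂ * d₂ (j - 1)
    with hg₁
  set g₂ := -F.β₁ * d₁ j + (1 / 2 - F.α) * d₂ j + F.β₁ * d₁ (j - 1) + (1 / 2 + F.α) * d₂ (j - 1)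
    with hg₂
  set a11 : ℂ := (1 / 2 - F.α - F.β₂ * r * p) - s * (1 / 2 + F.α - F.β₂ * r * p) with ha11
  set a12 : ℂ := (1 / 2 - F.α - F.β₂ * r * q) + s * (1 / 2 + F.α - F.β₂ * r * q) with ha12
  set a21 : ℂ := (F.β₁ - (1 / 2 + F.α) * r * p) - s * ((1 / 2 - F.α) * r * p - F.β₁) with ha21
  set a22 : ℂ := (F.β₁ - (1 / 2 + F.α) * r * q) + s * ((1 / 2 - F.α) * r * q - F.β₁) with ha22
  have G1 : a11 * x j + a12 * y j = g₁ := by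
    rw [hg₁, P1, P2, Q1, Q2, ha11, ha12]
    linear_combination (-(s * (y j - x j)) + (x (j + 1) + y (j + 1)) + s * (y (j - 1) - x (j - 1))
      - (x j + y j)) * habC
  have G2 : a21 * x j + a22 * y j = g₂ := by
    rw [hg₂, P1, P2, Q1, Q2, ha21, ha22]
    linear_combination (-(s * r * (q * y j - p * x j))
      - ratio 𝓘 (j + 1) * (p * x (j + 1) + q * y (j + 1))
      + s * r' * (q * y (j - 1) - p * x (j - 1)) + r * (p * x j + q * y j)) * habC
  have hdet : a11 * a22 - a12 * a21 = -2 * s * ((𝓘.size * Gam k F 𝓘 j : ℝ) : ℂ) := by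
    have hGam : 𝓘.size * Gam k F 𝓘 j =
        F.β₁ + F.β₂ * r ^ 2 * (p * q) - r * (p + q) * (F.α ^ 2 + F.β₁ * F.β₂ + 1 / 4) := by
      have hl := (𝓘.len_pos j).ne'
      rw [Gam, hr, ratio, hp, hq]
      field_simp
      ring
    rw [hGam, ha11, ha12, ha21, ha22]
    push_cast
    linear_combination (r * (q - p) * (1 + s ^ 2) : ℂ) * habC
  -- The determinant contains `h Γ_j`, whereas A1 bounds `h_j |Γ_j|` from below; `h_j ≤ h` closes
  -- the gap. Cramer's rule then gives the constant, with entries of size at most `Y` and right-hand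
  -- sides of size at most `4 * W * ε`.
  have hdetn : 2 * δ ≤ ‖a11 * a22 - a12 * a21‖ := by
    rw [hdet, norm_mul, norm_mul, hs, Complex.norm_real, norm_mul, Real.norm_of_nonneg hh.le,
      Real.norm_eq_abs]
    have h1 := hA1.2 j
    have h2 := mul_le_mul_of_nonneg_right (𝓘.len_le_size j) (abs_nonneg (Gam k F 𝓘 j))
    norm_num
    linarith
  have hWr : ∀ (u : ℝ) (m : ℝ), |u| ≤ W → 0 ≤ m → m ≤ q → ‖(u : ℂ) * r * m‖ ≤ W * |σ| * q := by
    intro u m hu hm hmq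
    rw [norm_mul, norm_mul, Complex.norm_real, Complex.norm_real, Complex.norm_real,
      Real.norm_eq_abs, Real.norm_of_nonneg hr0.le, Real.norm_of_nonneg hm]
    gcongr
  have hA' : ‖(1 / 2 + F.α : ℂ)‖ ≤ W := by
    rw [show (1 / 2 + F.α : ℂ) = ((1 / 2 + F.α : ℝ) : ℂ) by push_cast; rfl, Complex.norm_real]
    exact hA
  have hB' : ‖(1 / 2 - F.α : ℂ)‖ ≤ W := by
    rw [show (1 / 2 - F.α : ℂ) = ((1 / 2 - F.α : ℝ) : ℂ) by push_cast; rfl, Complex.norm_real]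
    exact hB
  have hb1' : ‖(F.β₁ : ℂ)‖ ≤ W := by rwa [Complex.norm_real]
  have hb2' : ‖(F.β₂ : ℂ)‖ ≤ W := by rwa [Complex.norm_real]
  have hq0 : 0 ≤ q := hp0.trans hpq
  have hWr2 : ∀ (m : ℝ), 0 ≤ m → m ≤ q → ‖(F.β₂ : ℂ) * r * m‖ ≤ W * |σ| * q := fun m => hWr _ m hb2
  have hWrA : ∀ (m : ℝ), 0 ≤ m → m ≤ q → ‖(1 / 2 + F.α : ℂ) * r * m‖ ≤ W * |σ| * q := fun m h1 h2 => by
    have := hWr _ m hA h1 h2; push_cast at this; exact this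
  have hWrB : ∀ (m : ℝ), 0 ≤ m → m ≤ q → ‖(1 / 2 - F.α : ℂ) * r * m‖ ≤ W * |σ| * q := fun m h1 h2 => by
    have := hWr _ m hB h1 h2; push_cast at this; exact this
  have sub4 : ∀ u v : ℂ, ∀ U V : ℝ, ‖u‖ ≤ U → ‖v‖ ≤ V → ‖u - v‖ ≤ U + V := fun u v U V h1 h2 =>
    (norm_sub_le _ _).trans (add_le_add h1 h2)
  have add4 : ∀ u v : ℂ, ∀ U V : ℝ, ‖u‖ ≤ U → ‖v‖ ≤ V → ‖u + v‖ ≤ U + V := fun u v U V h1 h2 =>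
    (norm_add_le _ _).trans (add_le_add h1 h2)
  have smul4 : ∀ u : ℂ, ∀ U : ℝ, ‖u‖ ≤ U → ‖s * u‖ ≤ U := fun u U h1 => by
    rwa [norm_mul, hs, one_mul]
  have b11 := sub4 _ _ _ _ (sub4 _ _ _ _ hB' (hWr2 p hp0 hpq))
    (smul4 _ _ (sub4 _ _ _ _ hA' (hWr2 p hp0 hpq)))
  have b12 := add4 _ _ _ _ (sub4 _ _ _ _ hB' (hWr2 q hq0 le_rfl))
    (smul4 _ _ (sub4 _ _ _ _ hA' (hWr2 q hq0 le_rfl)))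
  have b21 := sub4 _ _ _ _ (sub4 _ _ _ _ hb1' (hWrA p hp0 hpq))
    (smul4 _ _ (sub4 _ _ _ _ (hWrB p hp0 hpq) hb1'))
  have b22 := add4 _ _ _ _ (sub4 _ _ _ _ hb1' (hWrA q hq0 le_rfl))
    (smul4 _ _ (sub4 _ _ _ _ (hWrB q hq0 le_rfl) hb1'))
  rw [← ha11] at b11
  rw [← ha12] at b12
  rw [← ha21] at b21
  rw [← ha22] at b22
  have mul4 : ∀ u v : ℂ, ‖u‖ ≤ W → ‖v‖ ≤ ε → ‖u * v‖ ≤ W * ε := fun u v h1 h2 => by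
    rw [norm_mul]; exact mul_le_mul h1 h2 (norm_nonneg _) (by linarith)
  have bg1 := add4 _ _ _ _ (add4 _ _ _ _ (sub4 _ _ _ _ (mul4 _ _ hA' (hd j).1)
    (mul4 _ _ hb2' (hd j).2)) (mul4 _ _ hB' (hd (j - 1)).1)) (mul4 _ _ hb2' (hd (j - 1)).2)
  have bg2 := add4 _ _ _ _ (add4 _ _ _ _ (add4 _ _ _ _ (mul4 _ _ ((norm_neg _).le.trans hb1') (hd j).1)
    (mul4 _ _ hB' (hd j).2)) (mul4 _ _ hb1' (hd (j - 1)).1)) (mul4 _ _ hA' (hd (j - 1)).2)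
  rw [← hg₁] at bg1
  rw [← hg₂] at bg2
  set Y := 2 * W + 2 * W * |σ| * q with hY
  have fin : ∀ z u v : ℂ, ‖u‖ ≤ Y → ‖v‖ ≤ Y → ∀ c₁ c₂ : ℂ, ‖c₁‖ ≤ 4 * W * ε → ‖c₂‖ ≤ 4 * W * ε →
      (a11 * a22 - a12 * a21) * z = u * c₁ - v * c₂ → ‖z‖ ≤ Y * (8 * W) / (2 * δ) * ε := by
    intro z u v hu hv c₁ c₂ h1 h2 hz
    rw [div_mul_eq_mul_div, le_div_iff₀ (by positivity), mul_comm ‖z‖]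
    calc 2 * δ * ‖z‖ ≤ ‖a11 * a22 - a12 * a21‖ * ‖z‖ := by gcongr
      _ = ‖u * c₁ - v * c₂‖ := by rw [← norm_mul, hz]
      _ ≤ ‖u‖ * ‖c₁‖ + ‖v‖ * ‖c₂‖ := by
        rw [← norm_mul, ← norm_mul]; exact norm_sub_le _ _
      _ ≤ Y * (4 * W * ε) + Y * (4 * W * ε) := by gcongr
      _ = Y * (8 * W) * ε := by ring
  constructor
  · refine fin _ a22 a12 ?_ ?_ g₁ g₂ ?_ ?_ ?_
    · linarith
    · linarith
    · linarith
    · linarith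
    · linear_combination a22 * G1 - a12 * G2
  · refine fin _ a11 a21 ?_ ?_ g₂ g₁ ?_ ?_ ?_
    · linarith
    · linarith
    · linarith
    · linarith
    · linear_combination a11 * G2 - a21 * G1

/-- The scale invariant form of `Γ` on a uniform mesh. -/
def gamConst (k : ℕ) (F : Flux) : ℝ :=
  F.β₁ + F.β₂ * ((k : ℝ) ^ 2 * ((k : ℝ) ^ 2 - 1))
    - 2 * (k : ℝ) ^ 2 * (F.α ^ 2 + F.β₁ * F.β₂ + 1 / 4)

/-- The scale invariant form of `Λ` on a uniform mesh. -/
def lamConst (k : ℕ) (F : Flux) : ℝ := -(2 * (k : ℝ)) * (F.α ^ 2 + F.β₁ * F.β₂ - 1 / 4)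

theorem Gam_div_Lam (k : ℕ) (F : Flux) {𝓘 : Mesh a b N} (h : 𝓘.Uniform) (j : Fin N) :
    Gam k F 𝓘 j / Lam k F 𝓘 j = gamConst k F / lamConst k F := by
  have hh := 𝓘.size_pos.ne'
  have h1 : Gam k F 𝓘 j = gamConst k F / 𝓘.size := by
    rw [Gam, gamConst, h j]; field_simp
  have h2 : Lam k F 𝓘 j = lamConst k F / 𝓘.size := by
    rw [Lam, lamConst, h j]; field_simp
  rw [h1, h2, div_div_div_cancel_right₀ hh]

theorem lamConst_ne_zero {k : ℕ} (hk : 2 ≤ k) {F : Flux} {𝓘 : Mesh a b N}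
    (h : F.α ^ 2 + F.β₁ / 𝓘.size * (F.β₂ * 𝓘.size) ≠ 1 / 4) : lamConst k F ≠ 0 := by
  have hh := 𝓘.size_pos.ne'
  have h1 : F.β₁ / 𝓘.size * (F.β₂ * 𝓘.size) = F.β₁ * F.β₂ := by field_simp
  rw [h1] at h
  have : (k : ℝ) ≠ 0 := by exact_mod_cast (by omega : k ≠ 0)
  exact mul_ne_zero (by simpa using this) (sub_ne_zero.2 h)

/-- The coefficient of the second-order recurrence satisfied by the unknowns on a uniform mesh. -/
def recCoeff (k : ℕ) (F : Flux) : ℝ := (-1) ^ (k + 1) * (gamConst k F / lamConst k F)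

/-- On a uniform mesh the fluxes give a first-order system `(A + B S)(x, y) = d` with constant 2×2
matrices `A`, `B` and the cyclic shift `S`. Multiplication by the adjugate, again linear in `S`,
decouples it: each unknown satisfies the scalar recurrence with operator `det (A + B S)`. -/
theorem exists_fluxStable_of_recurrenceStable (k : ℕ) (hk : 2 ≤ k) (F : Flux) (l : ℕ) (K : ℝ)
    (hK : 0 ≤ K) : ∃ K' : ℝ, 0 ≤ K' ∧ ∀ (a b : ℝ) (N : ℕ) [NeZero N] (𝓘 : Mesh a b N),
      𝓘.Uniform → F.α ^ 2 + F.β₁ / 𝓘.size * (F.β₂ * 𝓘.size) ≠ 1 / 4 →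
      RecurrenceStable N ((2 * recCoeff k F : ℝ) : ℂ) l K → FluxStable k F 𝓘 l K' := by
  set s : ℂ := (-1) ^ k with hs
  set A : ℂ := 1 / 2 + F.α
  set B : ℂ := 1 / 2 - F.α
  set p : ℂ := (k - 1) * k with hp
  set q : ℂ := k * (k + 1) with hq
  set a11 : ℂ := -(s * (A - F.β₂ * p)) with ha11
  set a12 : ℂ := s * (A - F.β₂ * q) with ha12
  set b11 : ℂ := B - F.β₂ * p with hb11
  set b12 : ℂ := B - F.β₂ * q with hb12
  set a21 : ℂ := -(s * (B * p - F.β₁)) with ha21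
  set a22 : ℂ := s * (B * q - F.β₁) with ha22
  set b21 : ℂ := F.β₁ - A * p with hb21
  set b22 : ℂ := F.β₁ - A * q with hb22
  set L : ℂ := (lamConst k F : ℂ) with hL
  set S : ℝ := ‖a11‖ + ‖a12‖ + ‖b11‖ + ‖b12‖ + ‖a21‖ + ‖a22‖ + ‖b21‖ + ‖b22‖ with hS
  refine ⟨K * (‖L‖⁻¹ * S), by positivity, fun a b N _ 𝓘 hu hne hst x y ε h => ?_⟩
  have hL0 : L ≠ 0 := by rw [hL]; exact_mod_cast lamConst_ne_zero hk hne
  set d₁ := fluxHat F 𝓘 fun j => x j • leg (k - 1) + y j • leg k with hd₁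
  set d₂ := fluxTilde F 𝓘 fun j => x j • leg (k - 1) + y j • leg k with hd₂
  have E1 : ∀ j, a11 * x j + a12 * y j + b11 * x (j + 1) + b12 * y (j + 1) = d₁ j := fun j => by
    rw [hd₁, fluxHat_leg k (by omega), ratio_eq_one 𝓘 hu, ratio_eq_one 𝓘 hu, ha11, ha12, hb11, hb12]
    push_cast; ring
  have E2 : ∀ j, a21 * x j + a22 * y j + b21 * x (j + 1) + b22 * y (j + 1) = d₂ j := fun j => by
    rw [hd₂, fluxTilde_leg k (by omega), ratio_eq_one 𝓘 hu, ratio_eq_one 𝓘 hu, ha21, ha22, hb21, hb22]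
    push_cast; ring
  have hs2 : s ^ 2 = 1 := by rw [hs, ← pow_mul, mul_comm, pow_mul]; simp
  -- The identities `c0`, `c1`, `c2` compute the coefficients of `det (A + B S) = -L (1 - 2 g S +
  -- S²)`, where `g` is `recCoeff k F`. Division by `-L` normalizes the recurrence.
  have c0 : a11 * a22 - a12 * a21 = -L := by
    rw [ha11, ha12, ha21, ha22, hL, lamConst, hp, hq]
    push_cast
    linear_combination (2 * k * (F.α ^ 2 + F.β₁ * F.β₂ - 1 / 4) : ℂ) * hs2
  have c2 : b11 * b22 - b12 * b21 = -L := by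
    rw [hb11, hb12, hb21, hb22, hL, lamConst, hp, hq]
    push_cast
    ring
  have c1 : a11 * b22 + b11 * a22 - a12 * b21 - b12 * a21 = L * ((2 * recCoeff k F : ℝ) : ℂ) := by
    have hr : L * ((2 * recCoeff k F : ℝ) : ℂ) = -2 * s * gamConst k F := by
      rw [hL, recCoeff, hs, pow_succ]
      push_cast
      rw [← hL]
      field_simp
    rw [hr, ha11, ha12, ha21, ha22, hb11, hb12, hb21, hb22, gamConst, hp, hq]
    push_cast
    ring
  have bound : ∀ (u v w z : ℂ), ‖u‖ + ‖v‖ + ‖w‖ + ‖z‖ ≤ S → ∀ i ≤ l, ∀ j,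
      ‖diff^[i] ((-L⁻¹) • (u • d₁ + v • (fun j => d₁ (j + 1)) + w • d₂ + z • fun j => d₂ (j + 1))) j‖
        ≤ ‖L‖⁻¹ * S * ε := by
    intro u v w z hS i hi j
    simp only [diff_iterate_smul, diff_iterate_add, diff_iterate_shift, Pi.smul_apply, Pi.add_apply,
      smul_eq_mul]
    rw [norm_mul, norm_neg, norm_inv, mul_assoc]
    have h1 := h i hi j
    have h2 := h i hi (j + 1)
    have hε : 0 ≤ ε := (norm_nonneg _).trans h1.1
    gcongr
    refine (norm_add_le _ _).trans ((add_le_add_left norm_add₃_le _).trans ?_)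
    simp only [norm_mul]
    calc _ ≤ ‖u‖ * ε + ‖v‖ * ε + ‖w‖ * ε + ‖z‖ * ε := by
          gcongr
          exacts [h1.1, h2.1, h1.2, h2.2]
      _ = (‖u‖ + ‖v‖ + ‖w‖ + ‖z‖) * ε := by ring
      _ ≤ S * ε := by gcongr
  have nn : ∀ z : ℂ, 0 ≤ ‖z‖ := norm_nonneg
  intro j
  constructor
  · have := hst x _ (‖L‖⁻¹ * S * ε) (fun j => ?_) (bound a22 b22 (-a12) (-b12) ?_) j
    · rw [mul_assoc]; exact this
    · simp only [Pi.smul_apply, Pi.add_apply, smul_eq_mul]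
      field_simp
      linear_combination (-a22) * E1 j - b22 * E1 (j + 1) + a12 * E2 j + b12 * E2 (j + 1)
        + x j * c0 + x (j + 1) * c1 + x (j + 1 + 1) * c2
    · simp only [norm_neg]
      linarith [nn a11, nn b11, nn a21, nn b21]
  · have := hst y _ (‖L‖⁻¹ * S * ε) (fun j => ?_) (bound (-a21) (-b21) a11 b11 ?_) j
    · rw [mul_assoc]; exact this
    · simp only [Pi.smul_apply, Pi.add_apply, smul_eq_mul]
      field_simp
      linear_combination (-a11) * E2 j - b11 * E2 (j + 1) + a21 * E1 j + b21 * E1 (j + 1)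
        + y j * c0 + y (j + 1) * c1 + y (j + 1 + 1) * c2
    · simp only [norm_neg]
      linarith [nn a12, nn b12, nn a22, nn b22]

theorem FluxStable.mono {k : ℕ} {F : Flux} {𝓘 : Mesh a b N} {l : ℕ} {K K' : ℝ}
    (h : FluxStable k F 𝓘 l K) (hK : K ≤ K') : FluxStable k F 𝓘 l K' := by
  intro x y ε he j
  have hε : 0 ≤ ε := (norm_nonneg _).trans (he 0 (Nat.zero_le _) 0).1
  obtain ⟨h1, h2⟩ := h x y ε he j
  have := mul_le_mul_of_nonneg_right hK hε
  exact ⟨h1.trans this, h2.trans this⟩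

theorem abs_recCoeff (k : ℕ) (F : Flux) : |recCoeff k F| = |gamConst k F / lamConst k F| := by
  simp [recCoeff, abs_mul]

theorem exists_fluxStable_of_assumptionA2 (k : ℕ) (hk : 2 ≤ k) (F : Flux) (a b : ℝ) :
    ∃ K : ℝ, 0 ≤ K ∧ ∀ (N : ℕ) [NeZero N] (𝓘 : Mesh a b N), AssumptionA2 k F 𝓘 →
      FluxStable k F 𝓘 0 K := by
  by_cases hg : 1 < |recCoeff k F|
  · obtain ⟨K, hK, h⟩ := exists_recurrenceStable_of_one_lt hg
    obtain ⟨K', hK', h'⟩ := exists_fluxStable_of_recurrenceStable k hk F 0 K hK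
    exact ⟨K', hK', fun N _ 𝓘 hA => h' a b N 𝓘 hA.1 hA.2.1 (h N)⟩
  -- The ratio `Γ/Λ` depends only on `k` and the flux. If it violates the condition, no mesh is
  -- admissible and any constant will do.
  · refine ⟨0, le_rfl, fun N _ 𝓘 hA => absurd ?_ hg⟩
    rw [abs_recCoeff, ← Gam_div_Lam k F hA.1 0]
    exact hA.2.2 0

theorem exists_fluxStable_of_assumptionA3lt (k : ℕ) (hk : 2 ≤ k) (F : Flux) (a b δ : ℝ)
    (hδ : 0 < δ) : ∃ K : ℝ, 0 ≤ K ∧ ∀ (N : ℕ) [NeZero N] (𝓘 : Mesh a b N),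
      AssumptionA3lt k F δ 𝓘 → FluxStable k F 𝓘 1 K := by
  by_cases hg : |recCoeff k F| < 1
  · obtain ⟨K, hK, h⟩ := exists_recurrenceStable_of_lt_one hg hδ
    obtain ⟨K', hK', h'⟩ := exists_fluxStable_of_recurrenceStable k hk F 1 K hK
    refine ⟨K', hK', fun N _ 𝓘 hA => h' a b N 𝓘 hA.1 hA.2.1 (h N ?_)⟩
    have h1 := (hA.2.2 0).2
    rw [Gam_div_Lam k F hA.1 0] at h1
    have h2 : recCoeff k F ^ 2 = (gamConst k F / lamConst k F) ^ 2 := by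
      rw [← sq_abs, abs_recCoeff, sq_abs]
    rwa [h2]
  · refine ⟨0, le_rfl, fun N _ 𝓘 hA => absurd ?_ hg⟩
    rw [abs_recCoeff, ← Gam_div_Lam k F hA.1 0]
    exact (hA.2.2 0).1

/-- The coefficient is real of modulus 1, and the value 1 is excluded by the condition on its `N`-th
power. Hence it is -1, the case of the double root -1. -/
theorem exists_fluxStable_of_assumptionA3eq (k : ℕ) (hk : 2 ≤ k) (F : Flux) (a b : ℝ) :
    ∃ K : ℝ, 0 ≤ K ∧ ∀ (N : ℕ) [NeZero N] (𝓘 : Mesh a b N), AssumptionA3eq k F 𝓘 →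
      FluxStable k F 𝓘 2 K := by
  obtain ⟨K, hK, h⟩ := exists_recurrenceStable_of_neg_one
  obtain ⟨K', hK', h'⟩ := exists_fluxStable_of_recurrenceStable k hk F 2 K hK
  refine ⟨K', hK', fun N _ 𝓘 hA => h' a b N 𝓘 hA.1 hA.2.1 ?_⟩
  obtain ⟨h1, h2⟩ := hA.2.2.2 0
  rw [Gam_div_Lam k F hA.1 0] at h1 h2
  change recCoeff k F ^ N ≠ 1 at h2
  rw [← abs_recCoeff] at h1
  have h3 : recCoeff k F = -1 := by
    rcases eq_or_eq_neg_of_abs_eq h1 with h4 | h4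
    · rw [h4, one_pow] at h2
      exact absurd rfl h2
    · exact h4
  have h5 : ((2 * recCoeff k F : ℝ) : ℂ) = -2 := by rw [h3]; norm_num
  rw [h5]
  exact h N hA.2.2.1

end ReferenceFlux
end UWDG
end

/-! ### Stability of the moment and flux problem. -/

set_option linter.unusedSectionVars false
noncomputable section
namespace UWDG

theorem cnorm_eq_of_natDegree_le {k l : ℕ} (h : k ≤ l) {p : ℂ[X]} (hp : p.natDegree ≤ k) :
    cnorm l p = cnorm k p := by
  unfold cnorm
  symm
  refine Finset.sum_subset (Finset.range_mono (by omega)) fun i _ hi => ?_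
  rw [coeff_eq_zero_of_natDegree_lt, norm_zero]
  simp at hi
  omega

section Stability

variable {a b : ℝ} {N : ℕ} [NeZero N]

theorem natDegree_diff_iterate {k : ℕ} {w : Fin N → ℂ[X]} (hw : ∀ j, (w j).natDegree ≤ k) (i : ℕ) :
    ∀ j, (diff^[i] w j).natDegree ≤ k := by
  induction i generalizing w with
  | zero => exact hw
  | succ i ih =>
    rw [Function.iterate_succ_apply]
    exact ih fun j => (natDegree_smul_le _ _).trans
      ((natDegree_sub_le _ _).trans (max_le (hw _) (hw _)))

/-- A piecewise polynomial is controlled by its moments of degree at most `k - 2`, its fluxes,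
and `l` differences of them. -/
theorem exists_stability (k : ℕ) (hk : 2 ≤ k) (F : Flux) (a b σ : ℝ) (l : ℕ) (K : ℝ) (hK : 0 ≤ K) :
    ∃ C : ℝ, 0 ≤ C ∧ ∀ (N : ℕ) [NeZero N] (𝓘 : Mesh a b N), 𝓘.Regular σ →
      (l = 0 ∨ 𝓘.Uniform) → FluxStable k F 𝓘 l K → ∀ (w : Fin N → ℂ[X]) (ε : ℝ),
      (∀ j, (w j).natDegree ≤ k) →
      (∀ i ≤ l, ∀ j, (∀ ψ : ℂ[X], ψ.natDegree ≤ k - 2 →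
          ‖moment (polyFun (diff^[i] w j)) ψ‖ ≤ ε * cnorm (k - 2) ψ) ∧
        ‖fluxHat F 𝓘 (diff^[i] w) j‖ ≤ ε ∧ ‖fluxTilde F 𝓘 (diff^[i] w) j‖ ≤ ε) →
      ∀ j, cnorm k (w j) ≤ C * ε := by
  obtain ⟨c, hc, hlow⟩ := exists_cnorm_lowPart_le k hk
  have hW := (fluxWeight_bounds F).1
  set D := 1 + fluxWeight F * (2 + 2 * |σ|) * ((1 + k) * c) with hD
  have hD0 : 0 ≤ D := by positivity
  refine ⟨c + K * D * cnorm k (leg (k - 1)) + K * D * cnorm k (leg k), by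
    have := cnorm_nonneg k (leg (k - 1))
    have := cnorm_nonneg k (leg k)
    positivity, fun N _ 𝓘 hreg hl hst w ε hw h => ?_⟩
  have hε : 0 ≤ ε := (norm_nonneg _).trans (h 0 (Nat.zero_le _) 0).2.1
  have hreg' : 𝓘.Regular |σ| := fun j => (hreg j).trans_le (le_abs_self _)
  have hcH : ∀ i ≤ l, ∀ v, fluxHat F 𝓘 (diff^[i] v) = diff^[i] (fluxHat F 𝓘 v) := by
    intro i hi v
    rcases hl with h0 | hu
    · obtain rfl : i = 0 := by omega
      rfl
    · exact fluxHat_diff F hu i v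
  have hcT : ∀ i ≤ l, ∀ v, fluxTilde F 𝓘 (diff^[i] v) = diff^[i] (fluxTilde F 𝓘 v) := by
    intro i hi v
    rcases hl with h0 | hu
    · obtain rfl : i = 0 := by omega
      rfl
    · exact fluxTilde_diff F hu i v
  -- The moments control `w₀`, hence also its fluxes. Subtracting these from the fluxes of `w`
  -- leaves data of size `D * ε` for the two top coefficients, to which flux stability applies.
  set w₀ : Fin N → ℂ[X] := fun j => lowPart k (w j) with hw₀
  have hw₀i : ∀ i j, diff^[i] w₀ j = lowPart k (diff^[i] w j) := fun i j => by
    rw [hw₀, diff_iterate_map i (lowPart k) w]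
  have hw₀d : ∀ i j, (diff^[i] w₀ j).natDegree ≤ k - 2 := fun i j => by
    rw [hw₀i]; exact natDegree_lowPart hk (natDegree_diff_iterate hw i j)
  have hw₀c : ∀ i ≤ l, ∀ j, cnorm k (diff^[i] w₀ j) ≤ c * ε := fun i hi j => by
    rw [cnorm_eq_of_natDegree_le (by omega : k - 2 ≤ k) (hw₀d i j), hw₀i]
    exact hlow _ _ (natDegree_diff_iterate hw i j) (h i hi j).1
  set x : Fin N → ℂ := fun j => subCoeff k (w j)
  set y : Fin N → ℂ := fun j => topCoeff k (w j)
  have hdec : (fun j => x j • leg (k - 1) + y j • leg k) = w - w₀ := by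
    ext1 j
    have := eq_lowPart_add k (w j)
    simp only [Pi.sub_apply, hw₀, x, y]
    conv_rhs => rw [this]
    rw [show lowPart k (lowPart k (w j) + subCoeff k (w j) • leg (k - 1) + topCoeff k (w j) • leg k)
      = lowPart k (w j) by rw [← this]]
    ring
  have hxy := hst x y (D * ε) (fun i hi j => by
    have hf := norm_flux_le_of_cnorm F 𝓘 hreg' (k := k) (w := diff^[i] w₀)
      (fun j => (hw₀d i j).trans (by omega)) j (hw₀c i hi j) (hw₀c i hi (j + 1))
    obtain ⟨-, h1, h2⟩ := h i hi j
    rw [hdec]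
    rw [← hcH i hi, ← hcT i hi, diff_iterate_sub, map_sub, map_sub]
    constructor
    · refine (norm_sub_le _ _).trans ((add_le_add h1 hf.1).trans (le_of_eq ?_))
      rw [hD]; ring
    · refine (norm_sub_le _ _).trans ((add_le_add h2 hf.2).trans (le_of_eq ?_))
      rw [hD]; ring)
  intro j
  rw [eq_lowPart_add k (w j)]
  refine (cnorm_add_le _ _ _).trans ((add_le_add_left (cnorm_add_le _ _ _) _).trans ?_)
  rw [cnorm_smul, cnorm_smul]
  have e0 := hw₀c 0 (Nat.zero_le _) j
  have e1 := mul_le_mul_of_nonneg_right (hxy j).1 (cnorm_nonneg k (leg (k - 1)))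
  have e2 := mul_le_mul_of_nonneg_right (hxy j).2 (cnorm_nonneg k (leg k))
  simp only [Function.iterate_zero, id, hw₀, x, y] at e0 e1 e2
  nlinarith

end Stability

/-! ### Taylor polynomials. -/

section Taylor

theorem contDiff_deriv {n : ℕ} {f : ℝ → ℂ} (h : ContDiff ℝ (n + 1 : ℕ) f) : ContDiff ℝ n (deriv f) := by
  have : ContDiff ℝ ((n : WithTop ℕ∞) + 1) f := by exact_mod_cast h
  exact (contDiff_succ_iff_deriv.1 this).2.2

theorem contDiff_of_le {m n : ℕ} (hmn : m ≤ n) {f : ℝ → ℂ} (h : ContDiff ℝ n f) : ContDiff ℝ m f :=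
  h.of_le (by exact_mod_cast hmn)

theorem differentiable_of_contDiff {n : ℕ} {f : ℝ → ℂ} (h : ContDiff ℝ (n + 1 : ℕ) f) :
    Differentiable ℝ f := h.differentiable (by simp)

/-- The Taylor polynomial of degree `n` at `0`. -/
def tay : ℕ → (ℝ → ℂ) → ℂ[X]
  | 0, g => C (g 0)
  | n + 1, g => C (g 0) + antider (tay n (deriv g))

theorem natDegree_tay_le (n : ℕ) (g : ℝ → ℂ) : (tay n g).natDegree ≤ n := by
  induction n generalizing g with
  | zero => simp [tay]
  | succ n ih =>
    refine (natDegree_add_le _ _).trans (max_le (by simp) (natDegree_antider_le (ih _)))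

/-- Linearity in the form required for Taylor polynomials to commute with `diff` across cells. -/
theorem tay_const_mul_sub (n : ℕ) (c : ℂ) {g h : ℝ → ℂ} (hg : ContDiff ℝ n g) (hh : ContDiff ℝ n h) :
    tay n (fun ξ => c * (g ξ - h ξ)) = c • (tay n g - tay n h) := by
  induction n generalizing g h with
  | zero => simp [tay, smul_eq_C_mul]
  | succ n ih =>
    have h1 : deriv (fun ξ => c * (g ξ - h ξ)) = fun ξ => c * (deriv g ξ - deriv h ξ) := by
      ext ξ
      have dg := differentiable_of_contDiff hg ξ
      have dh := differentiable_of_contDiff hh ξ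
      exact ((dg.hasDerivAt.sub dh.hasDerivAt).const_mul c).deriv
    simp only [tay]
    rw [h1, ih (contDiff_deriv hg) (contDiff_deriv hh), map_smul, map_sub]
    simp only [smul_eq_C_mul, map_mul, map_sub]
    ring

/-- By the recursive definition, the derivative of the Taylor polynomial of `g` is the Taylor
polynomial of `g'` of one degree less. The estimate for `g'` thus bounds the derivative of the
remainder, and the mean value inequality on an interval of length 1 bounds the remainder by the same
constant. -/
theorem tay_remainder (n : ℕ) {g : ℝ → ℂ} (hg : ContDiff ℝ (n + 1 : ℕ) g) {B : ℝ}
    (hB : ∀ ξ ∈ Icc (0:ℝ) 1, ‖iteratedDeriv (n + 1) g ξ‖ ≤ B) :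
    ∀ ξ ∈ Icc (0:ℝ) 1, ‖g ξ - (tay n g).eval (ξ : ℂ)‖ ≤ B ∧
      ‖deriv g ξ - (derivative (tay n g)).eval (ξ : ℂ)‖ ≤ B := by
  have main : ∀ (p : ℂ[X]) {g : ℝ → ℂ}, Differentiable ℝ g → g 0 = p.eval 0 →
      (∀ ξ ∈ Icc (0:ℝ) 1, ‖deriv g ξ - (derivative p).eval (ξ : ℂ)‖ ≤ B) →
      ∀ ξ ∈ Icc (0:ℝ) 1, ‖g ξ - p.eval (ξ : ℂ)‖ ≤ B := by
    intro p g hd h0 h1 ξ hξ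
    have := (convex_Icc (0:ℝ) 1).norm_image_sub_le_of_norm_hasDerivWithin_le
      (f := fun ξ => g ξ - polyFun p ξ) (f' := fun ξ => deriv g ξ - (derivative p).eval (ξ : ℂ))
      (fun x _ => ((hd x).hasDerivAt.sub (hasDerivAt_polyFun p x)).hasDerivWithinAt)
      h1 (x := 0) (y := ξ) (by simp) hξ
    simp only [polyFun, Complex.ofReal_zero, h0, sub_self, sub_zero] at this
    refine this.trans ?_
    rw [Real.norm_of_nonneg hξ.1]
    exact mul_le_of_le_one_right ((norm_nonneg _).trans (h1 ξ hξ)) hξ.2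
  induction n generalizing g with
  | zero =>
    have h1 : ∀ ξ ∈ Icc (0:ℝ) 1, ‖deriv g ξ - (derivative (tay 0 g)).eval (ξ : ℂ)‖ ≤ B := by
      intro ξ hξ
      have := hB ξ hξ
      simpa [tay, iteratedDeriv_one] using this
    exact fun ξ hξ => ⟨main _ (differentiable_of_contDiff hg) (by simp [tay]) h1 ξ hξ, h1 ξ hξ⟩
  | succ n ih =>
    have h1 : ∀ ξ ∈ Icc (0:ℝ) 1, ‖deriv g ξ - (derivative (tay (n + 1) g)).eval (ξ : ℂ)‖ ≤ B := by
      intro ξ hξ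
      have := (ih (contDiff_deriv hg) (fun ξ hξ => by
        rw [← iteratedDeriv_succ']; exact hB ξ hξ) ξ hξ).1
      simpa [tay, derivative_antider] using this
    exact fun ξ hξ => ⟨main _ (differentiable_of_contDiff hg)
      (by simp [tay, antider_eval_zero]) h1 ξ hξ, h1 ξ hξ⟩

end Taylor

/-! ### Periodic functions, pull-backs to the cells and difference quotients. -/

section Periodic

theorem periodic_deriv {f : ℝ → ℂ} {c : ℝ} (h : Function.Periodic f c) :
    Function.Periodic (deriv f) c := fun x => by
  rw [← deriv_comp_add_const]
  congr 1
  exact funext h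

theorem periodic_iteratedDeriv {f : ℝ → ℂ} {c : ℝ} (h : Function.Periodic f c) (n : ℕ) :
    Function.Periodic (iteratedDeriv n f) c := fun x => by
  have := congrFun (iteratedDeriv_comp_add_const n f c) x
  rw [← this]
  congr 1
  exact funext h

variable {a b : ℝ} {N : ℕ} [NeZero N]

/-- The pull-back of a function to the reference cell. -/
def refFun (𝓘 : Mesh a b N) (f : ℝ → ℂ) : Fin N → ℝ → ℂ := fun j ξ => f (𝓘.left j + 𝓘.len j * ξ)

/-- The forward difference of a function with the mesh size as step, scaled by the number of
cells. -/
def shiftDiff (𝓘 : Mesh a b N) (f : ℝ → ℂ) : ℝ → ℂ := fun x => (N : ℂ) * (f (x + 𝓘.size) - f x)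

theorem contDiff_refFun (𝓘 : Mesh a b N) {n : ℕ} {f : ℝ → ℂ} (hf : ContDiff ℝ n f) (j : Fin N) :
    ContDiff ℝ n (refFun 𝓘 f j) := by
  unfold refFun; fun_prop

theorem contDiff_shiftDiff (𝓘 : Mesh a b N) {n : ℕ} {f : ℝ → ℂ} (hf : ContDiff ℝ n f) :
    ContDiff ℝ n (shiftDiff 𝓘 f) := by
  unfold shiftDiff; fun_prop

theorem periodic_shiftDiff (𝓘 : Mesh a b N) {c : ℝ} {f : ℝ → ℂ} (hf : Function.Periodic f c) :
    Function.Periodic (shiftDiff 𝓘 f) c := fun x => by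
  simp only [shiftDiff]
  rw [hf x, show x + c + 𝓘.size = x + 𝓘.size + c by ring, hf]

theorem deriv_shiftDiff (𝓘 : Mesh a b N) {f : ℝ → ℂ} (hf : Differentiable ℝ f) :
    deriv (shiftDiff 𝓘 f) = shiftDiff 𝓘 (deriv f) := by
  ext x
  have h1 : HasDerivAt (fun x => f (x + 𝓘.size)) (deriv f (x + 𝓘.size)) x :=
    (hf (x + 𝓘.size)).hasDerivAt.comp_add_const x 𝓘.size
  exact ((h1.sub (hf x).hasDerivAt).const_mul (N : ℂ)).deriv

theorem iteratedDeriv_shiftDiff (𝓘 : Mesh a b N) {n : ℕ} {f : ℝ → ℂ} (hf : ContDiff ℝ n f) :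
    iteratedDeriv n (shiftDiff 𝓘 f) = shiftDiff 𝓘 (iteratedDeriv n f) := by
  induction n generalizing f with
  | zero => simp
  | succ n ih =>
    rw [iteratedDeriv_succ', deriv_shiftDiff 𝓘 (differentiable_of_contDiff hf),
      ih (contDiff_deriv hf), iteratedDeriv_succ']

theorem refFun_shiftDiff {𝓘 : Mesh a b N} (hu : 𝓘.Uniform) {f : ℝ → ℂ}
    (hf : Function.Periodic f (b - a)) : refFun 𝓘 (shiftDiff 𝓘 f) = diff (refFun 𝓘 f) := by
  ext j ξ
  simp only [refFun, shiftDiff, diff, Pi.smul_apply, Pi.sub_apply, smul_eq_mul]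
  rw [𝓘.periodic_left_add_one hf, 𝓘.right_eq, hu j, hu (j + 1)]
  ring_nf

theorem hasDerivAt_refFun (𝓘 : Mesh a b N) {f : ℝ → ℂ} (hf : Differentiable ℝ f) (j : Fin N) (ξ : ℝ) :
    HasDerivAt (refFun 𝓘 f j) (𝓘.len j * refFun 𝓘 (deriv f) j ξ) ξ := by
  have h1 : HasDerivAt (fun ξ : ℝ => 𝓘.left j + 𝓘.len j * ξ) (𝓘.len j) ξ := by
    simpa using ((hasDerivAt_id ξ).const_mul (𝓘.len j)).const_add (𝓘.left j)
  have := (hf (𝓘.left j + 𝓘.len j * ξ)).hasDerivAt.scomp ξ h1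
  change HasDerivAt (fun ξ => f (𝓘.left j + 𝓘.len j * ξ))
    (𝓘.len j * deriv f (𝓘.left j + 𝓘.len j * ξ)) ξ
  simpa [Function.comp_def] using this

theorem iteratedDeriv_refFun (𝓘 : Mesh a b N) {n : ℕ} {f : ℝ → ℂ} (hf : ContDiff ℝ n f) (j : Fin N)
    (ξ : ℝ) : iteratedDeriv n (refFun 𝓘 f j) ξ
      = (𝓘.len j : ℂ) ^ n * iteratedDeriv n f (𝓘.left j + 𝓘.len j * ξ) := by
  have h := iteratedDeriv_comp_const_smul (n := n) (f := fun x => f (𝓘.left j + x))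
    (by fun_prop) (𝓘.len j)
  have h2 := congrFun h ξ
  rw [show refFun 𝓘 f j = fun x => f (𝓘.left j + 𝓘.len j * x) from rfl, h2,
    iteratedDeriv_comp_const_add]
  simp

/-- The scaling of the difference by `N` is harmless because `N * h = b - a` on a uniform mesh: a
difference costs exactly one derivative. -/
theorem norm_shiftDiff_le {𝓘 : Mesh a b N} (hu : 𝓘.Uniform) {f : ℝ → ℂ} (hf : Differentiable ℝ f)
    {M : ℝ} (hM : ∀ x, ‖deriv f x‖ ≤ M) (x : ℝ) : ‖shiftDiff 𝓘 f x‖ ≤ (b - a) * M := by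
  have h := convex_univ.norm_image_sub_le_of_norm_deriv_le (f := f) (s := univ) (x := x)
    (y := x + 𝓘.size) (fun x _ => hf x) (fun x _ => hM x) (mem_univ _) (mem_univ _)
  rw [add_sub_cancel_left, Real.norm_of_nonneg 𝓘.size_pos.le] at h
  rw [shiftDiff, norm_mul, Complex.norm_natCast, ← 𝓘.card_mul_size_of_uniform hu]
  calc (N : ℝ) * ‖f (x + 𝓘.size) - f x‖ ≤ N * (M * 𝓘.size) := by gcongr
    _ = _ := by ring

/-- Iterated differences of a smooth periodic function keep its regularity and are bounded by
derivatives of higher order. -/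
theorem shiftDiff_iterate_spec {𝓘 : Mesh a b N} (hu : 𝓘.Uniform) {f : ℝ → ℂ} {n i : ℕ}
    (hf : ContDiff ℝ (n + i : ℕ) f) (hp : Function.Periodic f (b - a)) {M : ℝ}
    {m : ℕ} (hm : m + i ≤ n + i) (hM : ∀ x, ‖iteratedDeriv (m + i) f x‖ ≤ M) :
    ContDiff ℝ (n + i : ℕ) ((shiftDiff 𝓘)^[i] f) ∧
      Function.Periodic ((shiftDiff 𝓘)^[i] f) (b - a) ∧
      ∀ x, ‖iteratedDeriv m ((shiftDiff 𝓘)^[i] f) x‖ ≤ (b - a) ^ i * M := by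
  induction i generalizing f M n m with
  | zero => simpa using ⟨hf, hp, hM⟩
  | succ i ih =>
    rw [Function.iterate_succ_apply]
    have hd : ∀ x, ‖iteratedDeriv (m + i) (shiftDiff 𝓘 f) x‖ ≤ (b - a) * M := by
      intro x
      rw [iteratedDeriv_shiftDiff 𝓘 (contDiff_of_le (by omega) hf)]
      refine norm_shiftDiff_le hu (hf.differentiable_iteratedDeriv _ ?_) (fun x => ?_) x
      · exact_mod_cast (by omega : m + i < n + (i + 1))
      · rw [← iteratedDeriv_succ]; exact hM x
    obtain ⟨h1, h2, h3⟩ := ih (n := n + 1) (m := m) (f := shiftDiff 𝓘 f)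
      (contDiff_of_le (by omega) (contDiff_shiftDiff 𝓘 hf))
      (periodic_shiftDiff 𝓘 hp) (by omega) hd
    refine ⟨contDiff_of_le (by omega) h1, h2, fun x => (h3 x).trans (le_of_eq ?_)⟩
    ring

end Periodic

end UWDG
end

/-! ### The projection and the chain of corrections: size estimates. -/

noncomputable section
namespace UWDG

variable {a b : ℝ} {N : ℕ} [NeZero N]

/-- The projection associated with the flux, on the reference cell. -/
structure RefProj (k : ℕ) (F : Flux) (𝓘 : Mesh a b N) (f : ℝ → ℂ) (p : Fin N → ℂ[X]) : Prop where
  natDegree_le : ∀ j, (p j).natDegree ≤ k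
  moment_eq : ∀ j, ∀ ψ : ℂ[X], ψ.natDegree ≤ k - 2 →
    moment (polyFun (p j)) ψ = moment (refFun 𝓘 f j) ψ
  hat_eq : ∀ j, fluxHat F 𝓘 p j = f (𝓘.right j)
  tilde_eq : ∀ j, fluxTilde F 𝓘 p j = 𝓘.size * deriv f (𝓘.right j)

/-- The correction with vanishing fluxes associated with a right-hand side, on the reference
cell. -/
structure RefCorr (k : ℕ) (F : Flux) (𝓘 : Mesh a b N) (G : Fin N → ℝ → ℂ) (w : Fin N → ℂ[X]) :
    Prop where
  natDegree_le : ∀ j, (w j).natDegree ≤ k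
  moment_eq : ∀ j, ∀ ψ : ℂ[X], ψ.natDegree ≤ k - 2 →
    moment (polyFun (w j)) ψ = (𝓘.len j : ℂ) ^ 2 * moment (G j) (antider₂ ψ)
  hat_eq : ∀ j, fluxHat F 𝓘 w j = 0
  tilde_eq : ∀ j, fluxTilde F 𝓘 w j = 0

/-- `W` is the `q`-th correction function of `f` on the reference cell. -/
def IsChain (k : ℕ) (F : Flux) (𝓘 : Mesh a b N) : ℕ → (ℝ → ℂ) → (Fin N → ℝ → ℂ) → Prop
  | 0, f, W => ∃ p, RefProj k F 𝓘 f p ∧ W = fun j ξ => refFun 𝓘 f j ξ - polyFun (p j) ξ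
  | q + 1, f, W => ∃ G w, IsChain k F 𝓘 q (deriv (deriv f)) G ∧ RefCorr k F 𝓘 G w ∧
      W = fun j => polyFun (w j)

theorem polyFun_diff (p : Fin N → ℂ[X]) (j : Fin N) :
    polyFun (diff p j) = fun ξ => (N : ℂ) * (polyFun (p (j + 1)) ξ - polyFun (p j) ξ) := by
  ext ξ; simp [polyFun, diff]

theorem moment_mul_sub {G H : ℝ → ℂ} (hG : Continuous G) (hH : Continuous H) (c : ℂ) (φ : ℂ[X]) :
    moment (fun ξ => c * (G ξ - H ξ)) φ = c * (moment G φ - moment H φ) := by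
  rw [moment_const_mul_left, moment_sub_left hG.continuousOn hH.continuousOn]

theorem continuous_refFun (𝓘 : Mesh a b N) {f : ℝ → ℂ} (hf : Continuous f) (j : Fin N) :
    Continuous (refFun 𝓘 f j) := by
  unfold refFun; fun_prop

theorem Mesh.periodic_right_add_one (𝓘 : Mesh a b N) (hu : 𝓘.Uniform) {f : ℝ → ℂ}
    (hf : Function.Periodic f (b - a)) (j : Fin N) : f (𝓘.right (j + 1)) = f (𝓘.right j + 𝓘.size) := by
  rw [𝓘.right_eq (j + 1), 𝓘.periodic_left_add_one hf, hu]

theorem RefProj.shiftDiff {k : ℕ} {F : Flux} {𝓘 : Mesh a b N} (hu : 𝓘.Uniform) {f : ℝ → ℂ}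
    {p : Fin N → ℂ[X]} (hp : Function.Periodic f (b - a)) (hf : Differentiable ℝ f)
    (h : RefProj k F 𝓘 f p) : RefProj k F 𝓘 (shiftDiff 𝓘 f) (diff p) where
  natDegree_le := natDegree_diff_iterate h.natDegree_le 1
  moment_eq j ψ hψ := by
    rw [polyFun_diff, moment_mul_sub (continuous_polyFun _) (continuous_polyFun _),
      h.moment_eq _ ψ hψ, h.moment_eq _ ψ hψ, refFun_shiftDiff hu hp]
    exact (moment_mul_sub (continuous_refFun 𝓘 hf.continuous _)
      (continuous_refFun 𝓘 hf.continuous _) _ _).symm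
  hat_eq j := by
    have := congrFun (fluxHat_diff F hu 1 p) j
    simp only [Function.iterate_one] at this
    rw [this, diff, h.hat_eq, h.hat_eq, UWDG.shiftDiff, 𝓘.periodic_right_add_one hu hp, smul_eq_mul]
  tilde_eq j := by
    have := congrFun (fluxTilde_diff F hu 1 p) j
    simp only [Function.iterate_one] at this
    rw [this, diff, h.tilde_eq, h.tilde_eq, deriv_shiftDiff 𝓘 hf, UWDG.shiftDiff,
      𝓘.periodic_right_add_one hu (periodic_deriv hp), smul_eq_mul]
    ring

theorem RefCorr.diff {k : ℕ} {F : Flux} {𝓘 : Mesh a b N} (hu : 𝓘.Uniform) {G : Fin N → ℝ → ℂ}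
    {w : Fin N → ℂ[X]} (hG : ∀ j, Continuous (G j)) (h : RefCorr k F 𝓘 G w) :
    RefCorr k F 𝓘 (diff G) (diff w) where
  natDegree_le := natDegree_diff_iterate h.natDegree_le 1
  moment_eq j ψ hψ := by
    rw [polyFun_diff, moment_mul_sub (continuous_polyFun _) (continuous_polyFun _),
      h.moment_eq _ ψ hψ, h.moment_eq _ ψ hψ,
      show UWDG.diff G j = fun ξ => (N : ℂ) * (G (j + 1) ξ - G j ξ) from rfl,
      moment_mul_sub (hG _) (hG _), hu j, hu (j + 1)]
    ring
  hat_eq j := by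
    have := congrFun (fluxHat_diff F hu 1 w) j
    simp only [Function.iterate_one] at this
    rw [this, UWDG.diff, h.hat_eq, h.hat_eq]; simp
  tilde_eq j := by
    have := congrFun (fluxTilde_diff F hu 1 w) j
    simp only [Function.iterate_one] at this
    rw [this, UWDG.diff, h.tilde_eq, h.tilde_eq]; simp

theorem IsChain.continuous {k : ℕ} {F : Flux} {𝓘 : Mesh a b N} {q : ℕ} {f : ℝ → ℂ}
    {W : Fin N → ℝ → ℂ} (hf : Continuous f) (h : IsChain k F 𝓘 q f W) (j : Fin N) :
    Continuous (W j) := by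
  cases q with
  | zero =>
    obtain ⟨p, -, rfl⟩ := h
    exact (continuous_refFun 𝓘 hf j).sub (continuous_polyFun _)
  | succ q =>
    obtain ⟨G, w, -, -, rfl⟩ := h
    exact continuous_polyFun _

/-- Differences of the corrections of `f` are the corrections of the difference quotient of `f`.
Bounds for differences of a correction are therefore bounds for a correction of another smooth
function. -/
theorem IsChain.shiftDiff {k : ℕ} {F : Flux} {𝓘 : Mesh a b N} (hu : 𝓘.Uniform) {q : ℕ} {f : ℝ → ℂ}
    {W : Fin N → ℝ → ℂ} (hp : Function.Periodic f (b - a)) (hf : ContDiff ℝ (2 * q + 1 : ℕ) f)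
    (h : IsChain k F 𝓘 q f W) : IsChain k F 𝓘 q (shiftDiff 𝓘 f) (diff W) := by
  induction q generalizing f W with
  | zero =>
    obtain ⟨p, hpr, rfl⟩ := h
    refine ⟨diff p, hpr.shiftDiff hu hp (differentiable_of_contDiff hf), ?_⟩
    ext j ξ
    rw [refFun_shiftDiff hu hp, polyFun_diff]
    simp only [diff, Pi.smul_apply, Pi.sub_apply, smul_eq_mul]
    ring
  | succ q ih =>
    obtain ⟨G, w, hG, hw, rfl⟩ := h
    have hf1 : ContDiff ℝ (2 * q + 1 + 1 : ℕ) (deriv f) := contDiff_deriv (by exact_mod_cast hf)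
    have hf2 := contDiff_deriv hf1
    refine ⟨diff G, diff w, ?_, hw.diff hu (hG.continuous hf2.continuous), ?_⟩
    · rw [deriv_shiftDiff 𝓘 (differentiable_of_contDiff hf),
        deriv_shiftDiff 𝓘 (differentiable_of_contDiff hf1)]
      exact ih (periodic_deriv (periodic_deriv hp)) hf2 hG
    · ext j ξ
      rw [polyFun_diff]
      simp [diff]

theorem periodic_shiftDiff_iterate (𝓘 : Mesh a b N) {f : ℝ → ℂ} (hp : Function.Periodic f (b - a))
    (i : ℕ) : Function.Periodic ((shiftDiff 𝓘)^[i] f) (b - a) := by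
  induction i generalizing f with
  | zero => exact hp
  | succ i ih => exact ih (periodic_shiftDiff 𝓘 hp)

theorem contDiff_shiftDiff_iterate (𝓘 : Mesh a b N) {f : ℝ → ℂ} {n : ℕ} (hf : ContDiff ℝ n f)
    (i : ℕ) : ContDiff ℝ n ((shiftDiff 𝓘)^[i] f) := by
  induction i generalizing f with
  | zero => exact hf
  | succ i ih => exact ih (contDiff_shiftDiff 𝓘 hf)

theorem IsChain.shiftDiff_iterate {k : ℕ} {F : Flux} {𝓘 : Mesh a b N} {l : ℕ}
    (hl : l = 0 ∨ 𝓘.Uniform) {q : ℕ} {f : ℝ → ℂ} {W : Fin N → ℝ → ℂ}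
    (hp : Function.Periodic f (b - a)) (hf : ContDiff ℝ (2 * q + 1 : ℕ) f)
    (h : IsChain k F 𝓘 q f W) {i : ℕ} (hi : i ≤ l) :
    IsChain k F 𝓘 q ((UWDG.shiftDiff 𝓘)^[i] f) (diff^[i] W) := by
  rcases hl with rfl | hu
  · obtain rfl : i = 0 := by omega
    exact h
  · clear hi
    induction i with
    | zero => exact h
    | succ i ih =>
      rw [Function.iterate_succ_apply', Function.iterate_succ_apply']
      exact ih.shiftDiff hu (periodic_shiftDiff_iterate 𝓘 hp i) (contDiff_shiftDiff_iterate 𝓘 hf i)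

theorem RefProj.shiftDiff_iterate {k : ℕ} {F : Flux} {𝓘 : Mesh a b N} {l : ℕ}
    (hl : l = 0 ∨ 𝓘.Uniform) {f : ℝ → ℂ} {p : Fin N → ℂ[X]} {n : ℕ}
    (hp : Function.Periodic f (b - a)) (hf : ContDiff ℝ (n + 1 : ℕ) f)
    (h : RefProj k F 𝓘 f p) {i : ℕ} (hi : i ≤ l) :
    RefProj k F 𝓘 ((UWDG.shiftDiff 𝓘)^[i] f) (diff^[i] p) := by
  rcases hl with rfl | hu
  · obtain rfl : i = 0 := by omega
    exact h
  · clear hi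
    induction i with
    | zero => exact h
    | succ i ih =>
      rw [Function.iterate_succ_apply', Function.iterate_succ_apply']
      exact ih.shiftDiff hu (periodic_shiftDiff_iterate 𝓘 hp i)
        (differentiable_of_contDiff (contDiff_shiftDiff_iterate 𝓘 hf i))

theorem tay_shiftDiff_iterate {𝓘 : Mesh a b N} {l : ℕ}
    (hl : l = 0 ∨ 𝓘.Uniform) {f : ℝ → ℂ} {n : ℕ} (hp : Function.Periodic f (b - a))
    (hf : ContDiff ℝ n f) {i : ℕ} (hi : i ≤ l) :
    diff^[i] (fun j => tay n (refFun 𝓘 f j)) =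
      fun j => tay n (refFun 𝓘 ((UWDG.shiftDiff 𝓘)^[i] f) j) := by
  rcases hl with rfl | hu
  · obtain rfl : i = 0 := by omega
    rfl
  · clear hi
    induction i with
    | zero => rfl
    | succ i ih =>
      rw [Function.iterate_succ_apply', ih]
      ext1 j
      rw [Function.iterate_succ_apply', refFun_shiftDiff hu (periodic_shiftDiff_iterate 𝓘 hp i)]
      have hc := fun j => contDiff_refFun 𝓘 (contDiff_shiftDiff_iterate 𝓘 hf i) j
      exact (tay_const_mul_sub n (N : ℂ) (hc (j + 1)) (hc j)).symm

/-- The traces of an exact function reproduce the exact values of the fluxes. -/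
theorem fluxComb_refFun (F : Flux) (𝓘 : Mesh a b N) {f : ℝ → ℂ}
    (hp : Function.Periodic f (b - a)) (hf : Differentiable ℝ f) (j : Fin N) :
    (((1 / 2 + F.α : ℝ) : ℂ) * refFun 𝓘 f j 1 - (F.β₂ * ratio 𝓘 j : ℝ) * deriv (refFun 𝓘 f j) 1
      + (1 / 2 - F.α : ℝ) * refFun 𝓘 f (j + 1) 0
      + (F.β₂ * ratio 𝓘 (j + 1) : ℝ) * deriv (refFun 𝓘 f (j + 1)) 0 = f (𝓘.right j)) ∧
    (-(F.β₁ : ℂ) * refFun 𝓘 f j 1 + ((1 / 2 - F.α) * ratio 𝓘 j : ℝ) * deriv (refFun 𝓘 f j) 1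
      + (F.β₁ : ℝ) * refFun 𝓘 f (j + 1) 0
      + ((1 / 2 + F.α) * ratio 𝓘 (j + 1) : ℝ) * deriv (refFun 𝓘 f (j + 1)) 0
      = 𝓘.size * deriv f (𝓘.right j)) := by
  have v1 : refFun 𝓘 f j 1 = f (𝓘.right j) := by rw [refFun, mul_one, ← 𝓘.right_eq]
  have v0 : refFun 𝓘 f (j + 1) 0 = f (𝓘.right j) := by
    have := 𝓘.periodic_left_add_one hp j 0
    rw [refFun, mul_zero, this, add_zero]
  have d1 : deriv (refFun 𝓘 f j) 1 = 𝓘.len j * deriv f (𝓘.right j) := by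
    rw [(hasDerivAt_refFun 𝓘 hf j 1).deriv, refFun, mul_one, ← 𝓘.right_eq]
  have d0 : deriv (refFun 𝓘 f (j + 1)) 0 = 𝓘.len (j + 1) * deriv f (𝓘.right j) := by
    have := 𝓘.periodic_left_add_one (periodic_deriv hp) j 0
    rw [(hasDerivAt_refFun 𝓘 hf (j + 1) 0).deriv, refFun, mul_zero, this, add_zero]
  have hr : ∀ j, (ratio 𝓘 j : ℂ) * 𝓘.len j = 𝓘.size := fun j => by
    have := (𝓘.len_pos j).ne'
    rw [← Complex.ofReal_mul, ratio]; field_simp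
  rw [v1, v0, d1, d0]
  push_cast
  constructor
  · linear_combination (F.β₂ * deriv f (𝓘.right j)) * (hr (j + 1) - hr j)
  · linear_combination ((1 / 2 - F.α) * deriv f (𝓘.right j)) * hr j
      + ((1 / 2 + F.α) * deriv f (𝓘.right j)) * hr (j + 1)

theorem norm_tay_refFun_le (𝓘 : Mesh a b N) {k : ℕ} {f : ℝ → ℂ} (hf : ContDiff ℝ (k + 1 : ℕ) f)
    {M : ℝ} (hM : ∀ x, ‖iteratedDeriv (k + 1) f x‖ ≤ M) (j : Fin N) :
    ∀ ξ ∈ Icc (0:ℝ) 1, ‖refFun 𝓘 f j ξ - (tay k (refFun 𝓘 f j)).eval (ξ : ℂ)‖ ≤ 𝓘.size ^ (k + 1) * M ∧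
      ‖deriv (refFun 𝓘 f j) ξ - (derivative (tay k (refFun 𝓘 f j))).eval (ξ : ℂ)‖
        ≤ 𝓘.size ^ (k + 1) * M := by
  refine tay_remainder k (contDiff_refFun 𝓘 hf j) fun ξ _ => ?_
  rw [iteratedDeriv_refFun 𝓘 hf, norm_mul, norm_pow, Complex.norm_real,
    Real.norm_of_nonneg (𝓘.len_pos j).le]
  have h1 := 𝓘.len_le_size j
  have h2 := (𝓘.len_pos j).le
  exact mul_le_mul (by gcongr) (hM _) (norm_nonneg _) (pow_nonneg 𝓘.size_pos.le _)

/-- Comparing `p` with the cellwise Taylor polynomial of `f` turns approximation into stability.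
Moments and fluxes of `p` are those of `f`, and those of `f` minus its Taylor polynomial are bounded
by the remainder and its derivative, of size `h ^ (k + 1)`. -/
theorem RefProj.sub_tay {k : ℕ} {F : Flux} {𝓘 : Mesh a b N} {σ : ℝ} (hσ : 𝓘.Regular σ) {f : ℝ → ℂ}
    {p : Fin N → ℂ[X]} (h : RefProj k F 𝓘 f p) (hp : Function.Periodic f (b - a))
    (hf : ContDiff ℝ (k + 1 : ℕ) f) {M : ℝ} (hM : ∀ x, ‖iteratedDeriv (k + 1) f x‖ ≤ M) (j : Fin N) :
    (∀ ψ : ℂ[X], ψ.natDegree ≤ k - 2 →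
      ‖moment (polyFun ((p - fun j => tay k (refFun 𝓘 f j)) j)) ψ‖
        ≤ 𝓘.size ^ (k + 1) * M * cnorm (k - 2) ψ) ∧
    ‖fluxHat F 𝓘 (p - fun j => tay k (refFun 𝓘 f j)) j‖
      ≤ fluxWeight F * (2 + 2 * σ) * (𝓘.size ^ (k + 1) * M) ∧
    ‖fluxTilde F 𝓘 (p - fun j => tay k (refFun 𝓘 f j)) j‖
      ≤ fluxWeight F * (2 + 2 * σ) * (𝓘.size ^ (k + 1) * M) := by
  have hr := fun j => norm_tay_refFun_le 𝓘 hf hM j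
  have hd := differentiable_of_contDiff hf
  have i0 : (0 : ℝ) ∈ Icc (0:ℝ) 1 := by simp
  have i1 : (1 : ℝ) ∈ Icc (0:ℝ) 1 := by simp
  have key := norm_fluxComb_le F 𝓘 hσ j (hr j 1 i1).1 (hr j 1 i1).2 (hr (j + 1) 0 i0).1
    (hr (j + 1) 0 i0).2
  obtain ⟨e1, e2⟩ := fluxComb_refFun F 𝓘 hp hd j
  simp only [Complex.ofReal_one, Complex.ofReal_zero] at key
  refine ⟨fun ψ hψ => ?_, ?_, ?_⟩
  · have e : polyFun ((p - fun j => tay k (refFun 𝓘 f j)) j) =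
        fun ξ => polyFun (p j) ξ - polyFun (tay k (refFun 𝓘 f j)) ξ := by
      ext ξ; simp [polyFun]
    rw [e, moment_sub_left (continuous_polyFun _).continuousOn (continuous_polyFun _).continuousOn,
      h.moment_eq j ψ hψ, ← moment_sub_left (continuous_refFun 𝓘 hd.continuous j).continuousOn
      (continuous_polyFun _).continuousOn]
    exact norm_moment_le hψ fun ξ hξ => (hr j ξ hξ).1
  · rw [map_sub, Pi.sub_apply, h.hat_eq, ← e1, fluxHat_apply]
    refine le_of_eq_of_le (congrArg norm ?_) key.1
    ring
  · rw [map_sub, Pi.sub_apply, h.tilde_eq, ← e2, fluxTilde_apply]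
    refine le_of_eq_of_le (congrArg norm ?_) key.2
    ring

/-- The error of the projection and the size of the correction functions. -/
theorem exists_chain_bound (k : ℕ) (hk : 2 ≤ k) (F : Flux) (a b σ : ℝ) (hab : a < b) (l : ℕ) (K : ℝ)
    (hK : 0 ≤ K) (q : ℕ) : ∃ C : ℝ, 0 ≤ C ∧ ∀ (N : ℕ) [NeZero N] (𝓘 : Mesh a b N), 𝓘.Regular σ →
      (l = 0 ∨ 𝓘.Uniform) → FluxStable k F 𝓘 l K → ∀ (f : ℝ → ℂ) (W : Fin N → ℝ → ℂ) (M : ℝ),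
      Function.Periodic f (b - a) → ContDiff ℝ (k + 1 + 2 * q + l * (q + 1) : ℕ) f →
      (∀ i ≤ l * (q + 1), ∀ x, ‖iteratedDeriv (k + 1 + 2 * q + i) f x‖ ≤ M) →
      IsChain k F 𝓘 q f W → ∀ j, ∀ ξ ∈ Icc (0:ℝ) 1, ‖W j ξ‖ ≤ C * 𝓘.size ^ (k + 1 + 2 * q) * M := by
  obtain ⟨S, hS, hstab⟩ := exists_stability k hk F a b σ l K hK
  have hba : 0 < b - a := sub_pos.2 hab
  set L := ∑ i ∈ Finset.range (l + 1), (b - a) ^ i with hL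
  have hL1 : ∀ i ≤ l, (b - a) ^ i ≤ L := fun i hi =>
    Finset.single_le_sum (f := fun i => (b - a) ^ i) (fun _ _ => by positivity)
      (Finset.mem_range.2 (by omega))
  have hL0 : 0 ≤ L := Finset.sum_nonneg fun _ _ => by positivity
  -- derivatives of the iterated differences
  have hder : ∀ (N : ℕ) [NeZero N] (𝓘 : Mesh a b N), (l = 0 ∨ 𝓘.Uniform) → ∀ (f : ℝ → ℂ) (M : ℝ)
      (m n : ℕ), Function.Periodic f (b - a) → ContDiff ℝ (n + l : ℕ) f → m ≤ n →
      (∀ i ≤ l, ∀ x, ‖iteratedDeriv (m + i) f x‖ ≤ M) → ∀ i ≤ l, ∀ x,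
      ‖iteratedDeriv m ((shiftDiff 𝓘)^[i] f) x‖ ≤ L * M := by
    intro N _ 𝓘 hl f M m n hp hf hm hM i hi x
    have hM0 : 0 ≤ M := (norm_nonneg _).trans (hM 0 (Nat.zero_le _) 0)
    rcases hl with rfl | hu
    · obtain rfl : i = 0 := by omega
      refine (hM 0 le_rfl x).trans ?_
      have := mul_le_mul_of_nonneg_right (hL1 0 le_rfl) hM0
      simpa using this
    · refine ((shiftDiff_iterate_spec hu (n := n) (contDiff_of_le (by omega) hf) hp
        (m := m) (by omega) (hM i hi)).2.2 x).trans ?_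
      have := mul_le_mul_of_nonneg_right (hL1 i hi) hM0
      exact this
  -- Each of the levels `0, ..., q` inverts the moment and flux problem once and needs `l`
  -- differences of its data, one derivative apiece. Hence the total of `l * (q + 1)` additional
  -- derivatives.
  induction q with
  | zero =>
    have hW := (fluxWeight_bounds F).1
    refine ⟨L * (1 + S * (1 + fluxWeight F * (2 + 2 * |σ|))), by positivity,
      fun N _ 𝓘 hreg hl hst f W M hp hf hM hch j ξ hξ => ?_⟩
    simp only [mul_zero, add_zero, zero_add, mul_one] at hf hM ⊢
    have hM0 : 0 ≤ M := (norm_nonneg _).trans (hM 0 (Nat.zero_le _) 0)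
    have hreg' : 𝓘.Regular |σ| := fun j => (hreg j).trans_le (le_abs_self _)
    obtain ⟨p, hpr, rfl⟩ := hch
    have hh := 𝓘.size_pos.le
    set B := 𝓘.size ^ (k + 1) * (L * M) with hB
    have hB0 : 0 ≤ B := by positivity
    have hd := hder N 𝓘 hl f M (k + 1) (k + 1) hp hf le_rfl hM
    have hfk : ContDiff ℝ (k + 1 : ℕ) f := contDiff_of_le (by omega) hf
    have hcn := hstab N 𝓘 hreg hl hst (p - fun j => tay k (refFun 𝓘 f j))
      ((1 + fluxWeight F * (2 + 2 * |σ|)) * B)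
      (fun j => (natDegree_sub_le _ _).trans (max_le (hpr.natDegree_le j) (natDegree_tay_le _ _)))
      (fun i hi j => by
        rw [diff_iterate_sub, tay_shiftDiff_iterate hl hp (contDiff_of_le (by omega) hf) hi]
        obtain ⟨h1, h2, h3⟩ := (hpr.shiftDiff_iterate hl hp hfk hi).sub_tay hreg'
          (periodic_shiftDiff_iterate 𝓘 hp i) (contDiff_shiftDiff_iterate 𝓘 hfk i) (hd i hi) j
        have hWB : 0 ≤ fluxWeight F * (2 + 2 * |σ|) * B := by positivity
        refine ⟨fun ψ hψ => (h1 ψ hψ).trans ?_, h2.trans ?_, h3.trans ?_⟩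
        · refine mul_le_mul_of_nonneg_right ?_ (cnorm_nonneg (k - 2) ψ)
          rw [← hB]
          linarith
        · linarith
        · linarith) j
    have hM' := hd 0 (Nat.zero_le _)
    have e1 := (norm_tay_refFun_le 𝓘 hfk hM' j ξ hξ).1
    have e2 := norm_eval_le_cnorm (k := k) (p := (p - fun j => tay k (refFun 𝓘 f j)) j)
      ((natDegree_sub_le _ _).trans (max_le (hpr.natDegree_le j) (natDegree_tay_le _ _))) hξ
    simp only [Pi.sub_apply, eval_sub] at e2 hcn
    have e3 : refFun 𝓘 f j ξ - polyFun (p j) ξ =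
        (refFun 𝓘 f j ξ - (tay k (refFun 𝓘 f j)).eval (ξ : ℂ)) -
        ((p j).eval (ξ : ℂ) - (tay k (refFun 𝓘 f j)).eval (ξ : ℂ)) := by
      rw [polyFun]; ring
    refine le_of_eq_of_le (congrArg norm e3) ?_
    refine (norm_sub_le _ _).trans ((add_le_add e1 (e2.trans hcn)).trans (le_of_eq ?_))
    rw [hB]; ring
  | succ q ih =>
    obtain ⟨C, hC, ih⟩ := ih
    refine ⟨S * (C * L), by positivity, fun N _ 𝓘 hreg hl hst f W M hp hf hM hch j ξ hξ => ?_⟩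
    have hM0 : 0 ≤ M := (norm_nonneg _).trans (hM 0 (Nat.zero_le _) 0)
    obtain ⟨G, w, hG, hw, rfl⟩ := hch
    have hh := 𝓘.size_pos.le
    have hlq : l * (q + 1 + 1) = l * (q + 1) + l := by ring
    have hf2 : ContDiff ℝ (k + 1 + 2 * q + l * (q + 1) + l : ℕ) (deriv (deriv f)) := by
      refine contDiff_deriv (contDiff_deriv (contDiff_of_le ?_ hf))
      omega
    have hp2 := periodic_deriv (periodic_deriv hp)
    have hGc := hG.continuous hf2.continuous
    -- The factor `h²` is the one in `RefCorr.moment_eq`: the double antiderivative in the physical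
    -- variable. It raises the order from `k + 1 + 2 q` to `k + 1 + 2 (q + 1)`.
    set B := 𝓘.size ^ 2 * (C * 𝓘.size ^ (k + 1 + 2 * q) * (L * M)) with hB
    have hB0 : 0 ≤ B := by positivity
    have hGi : ∀ i ≤ l, ∀ j, ∀ ξ ∈ Icc (0:ℝ) 1,
        ‖diff^[i] G j ξ‖ ≤ C * 𝓘.size ^ (k + 1 + 2 * q) * (L * M) := by
      intro i hi j ξ hξ
      refine ih N 𝓘 hreg hl hst _ _ (L * M) (periodic_shiftDiff_iterate 𝓘 hp2 i)
        (contDiff_shiftDiff_iterate 𝓘 (contDiff_of_le (by omega) hf2) i) ?_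
        (hG.shiftDiff_iterate hl hp2 (contDiff_of_le (by omega) hf2) hi) j ξ hξ
      intro m hm x
      refine hder N 𝓘 hl _ M (k + 1 + 2 * q + m) (k + 1 + 2 * q + l * (q + 1)) hp2 hf2 (by omega)
        (fun i' hi' x => ?_) i hi x
      rw [← iteratedDeriv_succ', ← iteratedDeriv_succ']
      have := hM (m + i') (by omega) x
      rwa [show k + 1 + 2 * (q + 1) + (m + i') = k + 1 + 2 * q + m + i' + 1 + 1 by ring] at this
    have hwi : ∀ i ≤ l, RefCorr k F 𝓘 (diff^[i] G) (diff^[i] w) := by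
      intro i hi
      rcases hl with rfl | hu
      · obtain rfl : i = 0 := by omega
        exact hw
      · clear hi
        induction i with
        | zero => exact hw
        | succ i ih' =>
          rw [Function.iterate_succ_apply', Function.iterate_succ_apply']
          refine ih'.diff hu fun j => ?_
          exact (hG.shiftDiff_iterate (l := i) (Or.inr hu) hp2 (contDiff_of_le (by omega) hf2)
            le_rfl).continuous (contDiff_shiftDiff_iterate 𝓘 hf2 i).continuous j
    have hcn := hstab N 𝓘 hreg hl hst w B hw.natDegree_le (fun i hi j => by
      have hc := hwi i hi
      refine ⟨fun ψ hψ => ?_, ?_, ?_⟩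
      · rw [hc.moment_eq j ψ hψ, norm_mul, norm_pow, Complex.norm_real,
          Real.norm_of_nonneg (𝓘.len_pos j).le]
        have h1 := norm_moment_le (k := k - 2 + 2) (natDegree_antider₂_le hψ) (hGi i hi j)
        have h2 := cnorm_antider₂_le (k - 2) ψ
        have h3 := 𝓘.len_le_size j
        have h4 := (𝓘.len_pos j).le
        calc 𝓘.len j ^ 2 * ‖moment (diff^[i] G j) (antider₂ ψ)‖
            ≤ 𝓘.size ^ 2 * (C * 𝓘.size ^ (k + 1 + 2 * q) * (L * M) * cnorm (k - 2) ψ) := by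
              gcongr
              exact h1.trans (by gcongr)
          _ = B * cnorm (k - 2) ψ := by rw [hB]; ring
      · rw [hc.hat_eq]; simpa using hB0
      · rw [hc.tilde_eq]; simpa using hB0) j
    refine ((norm_eval_le_cnorm (hw.natDegree_le j) hξ).trans hcn).trans (le_of_eq ?_)
    rw [hB]; ring

end UWDG
end

/-! ### Unisolvence and the linear solution operator. -/

noncomputable section
namespace UWDG

variable {a b : ℝ} {N : ℕ} [NeZero N]

/-- A piecewise polynomial with vanishing moments of degree at most `k - 2` and vanishing fluxes
is zero. -/
def Unisolvent (k : ℕ) (F : Flux) (𝓘 : Mesh a b N) : Prop :=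
  ∀ w : Fin N → ℂ[X], (∀ j, (w j).natDegree ≤ k) →
    (∀ j, ∀ ψ : ℂ[X], ψ.natDegree ≤ k - 2 → moment (polyFun (w j)) ψ = 0) →
    (∀ j, fluxHat F 𝓘 w j = 0) → (∀ j, fluxTilde F 𝓘 w j = 0) → w = 0

/-- Vanishing data have vanishing differences of every order, so the stability estimate applies with
`ε = 0`. -/
theorem FluxStable.unisolvent {k : ℕ} (hk : 2 ≤ k) {F : Flux} {σ : ℝ} {𝓘 : Mesh a b N} {l : ℕ}
    {K : ℝ} (hK : 0 ≤ K) (hreg : 𝓘.Regular σ) (hl : l = 0 ∨ 𝓘.Uniform) (hst : FluxStable k F 𝓘 l K) :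
    Unisolvent k F 𝓘 := by
  intro w hw hm hh ht
  obtain ⟨S, hS, hstab⟩ := exists_stability k hk F a b σ l K hK
  have hm0 : ∀ φ : ℂ[X], moment (0 : ℝ → ℂ) φ = 0 := fun φ => by simp [moment]
  have hc : RefCorr k F 𝓘 0 w := ⟨hw, fun j ψ hψ => by
    rw [hm j ψ hψ, Pi.zero_apply, hm0, mul_zero], hh, ht⟩
  have hci : ∀ i ≤ l, RefCorr k F 𝓘 0 (diff^[i] w) := by
    intro i hi
    rcases hl with rfl | hu
    · obtain rfl : i = 0 := by omega
      exact hc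
    · clear hi
      induction i with
      | zero => exact hc
      | succ i ih =>
        rw [Function.iterate_succ_apply']
        have := ih.diff hu fun j => by
          rw [Pi.zero_apply]; exact continuous_const
        rwa [diff_zero] at this
  have hcn := hstab N 𝓘 hreg hl hst w 0 hw fun i hi j => by
    have h := hci i hi
    refine ⟨fun ψ hψ => ?_, by rw [h.hat_eq, norm_zero], by rw [h.tilde_eq, norm_zero]⟩
    rw [h.moment_eq j ψ hψ, Pi.zero_apply, hm0, mul_zero, norm_zero, zero_mul]
  ext1 j
  ext i
  rw [Pi.zero_apply, coeff_zero, ← norm_le_zero_iff]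
  by_cases hi : i ≤ k
  · exact (norm_coeff_le_cnorm hi (w j)).trans ((hcn j).trans_eq (mul_zero _))
  · rw [coeff_eq_zero_of_natDegree_lt ((hw j).trans_lt (by omega)), norm_zero]

/-- The data that determine a piecewise polynomial of degree at most `k`: in each cell the moments
against `X ^ m`, `m ≤ k - 2`, and the two fluxes. -/
abbrev FluxData (k N : ℕ) := Fin N → (Fin (k - 1) → ℂ) × ℂ × ℂ

/-- The moment against a fixed polynomial as a linear functional on polynomials. -/
def momentPoly (ψ : ℂ[X]) : ℂ[X] →ₗ[ℂ] ℂ where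
  toFun p := moment (polyFun p) ψ
  map_add' p q := by
    rw [← moment_add_left (continuous_polyFun p).continuousOn (continuous_polyFun q).continuousOn]
    congr 1; ext ξ; simp [polyFun]
  map_smul' c p := by
    rw [RingHom.id_apply, smul_eq_mul, ← moment_const_mul_left]
    congr 1; ext ξ; simp [polyFun]

theorem eq_zero_of_moment_X_pow {n : ℕ} {G : ℝ → ℂ} (hG : ContinuousOn G (Icc 0 1))
    (h : ∀ m ≤ n, moment G (X ^ m) = 0) {ψ : ℂ[X]} (hψ : ψ.natDegree ≤ n) : moment G ψ = 0 := by
  let L : ℂ[X] →ₗ[ℂ] ℂ :=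
    { toFun := moment G
      map_add' := moment_add_right hG
      map_smul' := moment_smul_right G }
  change L ψ = 0
  rw [ψ.as_sum_range' (n + 1) (by omega), map_sum]
  refine Finset.sum_eq_zero fun i hi => ?_
  rw [← mul_one (ψ.coeff i), ← smul_eq_mul, ← smul_monomial, map_smul, ← X_pow_eq_monomial]
  have : L (X ^ i) = 0 := h i (by simpa [Nat.lt_succ_iff] using hi)
  rw [this, smul_zero]

/-- The data of the piecewise polynomial with given coefficients. -/
def dataMap (k : ℕ) (F : Flux) (𝓘 : Mesh a b N) : (Fin N → ℂ[X]) →ₗ[ℂ] FluxData k N where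
  toFun w j := (fun m => moment (polyFun (w j)) (X ^ (m : ℕ)), fluxHat F 𝓘 w j, fluxTilde F 𝓘 w j)
  map_add' v w := by
    ext j m
    · exact (momentPoly (X ^ (m : ℕ))).map_add (v j) (w j)
    · simp
    · simp
  map_smul' c w := by
    ext j m
    · exact (momentPoly (X ^ (m : ℕ))).map_smul c (w j)
    · simp
    · simp

/-- The piecewise polynomial with given coefficients. -/
def ofCoeff (k N : ℕ) : (Fin N → Fin (k + 1) → ℂ) →ₗ[ℂ] (Fin N → ℂ[X]) where
  toFun v j := ∑ i : Fin (k + 1), monomial (i : ℕ) (v j i)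
  map_add' v w := by ext1 j; simp [Finset.sum_add_distrib]
  map_smul' c v := by ext1 j; simp [Finset.smul_sum, smul_monomial]

theorem coeff_ofCoeff (k : ℕ) (v : Fin N → Fin (k + 1) → ℂ) (j : Fin N) (i : Fin (k + 1)) :
    (ofCoeff k N v j).coeff i = v j i := by
  simp only [ofCoeff, LinearMap.coe_mk, AddHom.coe_mk, finsetSum_coeff, coeff_monomial]
  rw [Finset.sum_eq_single i]
  · simp
  · intro m _ hm; rw [if_neg]; intro h; exact hm (Fin.ext h)
  · simp

theorem natDegree_ofCoeff (k : ℕ) (v : Fin N → Fin (k + 1) → ℂ) (j : Fin N) :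
    (ofCoeff k N v j).natDegree ≤ k := by
  change (∑ i : Fin (k + 1), monomial (i : ℕ) (v j i)).natDegree ≤ k
  refine natDegree_sum_le_of_forall_le _ _ fun i _ => ?_
  exact (natDegree_monomial_le _).trans (by omega)

/-- The solution operator of the moment and flux problem. -/
theorem exists_solution_operator {k : ℕ} (hk : 2 ≤ k) {F : Flux} {𝓘 : Mesh a b N}
    (h : Unisolvent k F 𝓘) : ∃ R : FluxData k N →ₗ[ℂ] (Fin N → ℂ[X]),
      (∀ d j, (R d j).natDegree ≤ k) ∧ ∀ d, dataMap k F 𝓘 (R d) = d := by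
  set L := (dataMap k F 𝓘).comp (ofCoeff k N) with hL
  have hinj : Function.Injective L := by
    rw [← LinearMap.ker_eq_bot, LinearMap.ker_eq_bot']
    intro v hv
    have h0 : ofCoeff k N v = 0 := by
      refine h _ (natDegree_ofCoeff k v) (fun j ψ hψ => ?_) (fun j => ?_) (fun j => ?_)
      · refine eq_zero_of_moment_X_pow (continuous_polyFun _).continuousOn (fun m hm => ?_) hψ
        exact congrFun (congrArg Prod.fst (congrFun hv j)) ⟨m, by omega⟩
      · exact congrArg (fun x => x.2.1) (congrFun hv j)
      · exact congrArg (fun x => x.2.2) (congrFun hv j)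
    ext j i
    rw [← coeff_ofCoeff k v j i, h0]; simp
  -- A square system: `k - 1` moments and two fluxes for the `k + 1` coefficients in each cell.
  -- Injectivity thus yields a linear inverse.
  have hdim : Module.finrank ℂ (Fin N → Fin (k + 1) → ℂ) = Module.finrank ℂ (FluxData k N) := by
    simp [FluxData, Module.finrank_pi_fintype, Module.finrank_prod]
    left; omega
  let e := L.linearEquivOfInjective hinj hdim
  refine ⟨(ofCoeff k N).comp e.symm.toLinearMap, fun d j => natDegree_ofCoeff k _ j, fun d => ?_⟩
  exact e.apply_symm_apply d

/-- The solution operator of the moment and flux problem. -/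
def solveOp {k : ℕ} (hk : 2 ≤ k) {F : Flux} {𝓘 : Mesh a b N} (h : Unisolvent k F 𝓘) :
    FluxData k N →ₗ[ℂ] (Fin N → ℂ[X]) := (exists_solution_operator hk h).choose

section Operators

variable {k : ℕ} (hk : 2 ≤ k) {F : Flux} {𝓘 : Mesh a b N} (h : Unisolvent k F 𝓘)

theorem natDegree_solveOp (d : FluxData k N) (j : Fin N) : (solveOp hk h d j).natDegree ≤ k :=
  (exists_solution_operator hk h).choose_spec.1 d j

theorem moment_solveOp (d : FluxData k N) (j : Fin N) (m : Fin (k - 1)) :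
    moment (polyFun (solveOp hk h d j)) (X ^ (m : ℕ)) = (d j).1 m :=
  congrFun (congrArg Prod.fst (congrFun ((exists_solution_operator hk h).choose_spec.2 d) j)) m

theorem fluxHat_solveOp (d : FluxData k N) (j : Fin N) : fluxHat F 𝓘 (solveOp hk h d) j = (d j).2.1 :=
  congrArg (fun x => x.2.1) (congrFun ((exists_solution_operator hk h).choose_spec.2 d) j)

theorem fluxTilde_solveOp (d : FluxData k N) (j : Fin N) :
    fluxTilde F 𝓘 (solveOp hk h d) j = (d j).2.2 :=
  congrArg (fun x => x.2.2) (congrFun ((exists_solution_operator hk h).choose_spec.2 d) j)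

/-- The moments of a solution agree with a linear functional if they do so on monomials. -/
theorem moment_solveOp_eq (d : FluxData k N) (j : Fin N) (Φ : ℂ[X] →ₗ[ℂ] ℂ)
    (hΦ : ∀ m : Fin (k - 1), (d j).1 m = Φ (X ^ (m : ℕ))) {ψ : ℂ[X]} (hψ : ψ.natDegree ≤ k - 2) :
    moment (polyFun (solveOp hk h d j)) ψ = Φ ψ := by
  let L : ℂ[X] →ₗ[ℂ] ℂ :=
    { toFun := moment (polyFun (solveOp hk h d j))
      map_add' := moment_add_right (continuous_polyFun _).continuousOn
      map_smul' := moment_smul_right _ }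
  change L ψ = Φ ψ
  rw [ψ.as_sum_range' (k - 1) (by omega), map_sum, map_sum]
  refine Finset.sum_congr rfl fun i hi => ?_
  rw [← mul_one (ψ.coeff i), ← smul_eq_mul, ← smul_monomial, map_smul, map_smul,
    ← X_pow_eq_monomial]
  have hi' : i < k - 1 := Finset.mem_range.1 hi
  have : L (X ^ i) = (d j).1 ⟨i, hi'⟩ := moment_solveOp hk h d j ⟨i, hi'⟩
  rw [this, hΦ]

/-- The moment of a function as a linear functional of the polynomial. -/
def momentFun (G : ℝ → ℂ) (hG : ContinuousOn G (Icc 0 1)) : ℂ[X] →ₗ[ℂ] ℂ where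
  toFun := moment G
  map_add' := moment_add_right hG
  map_smul' := moment_smul_right G

variable (𝓘) in
/-- The data of the projection of a function. -/
def projData (k : ℕ) (f : ℝ → ℂ) : FluxData k N := fun j =>
  (fun m => moment (refFun 𝓘 f j) (X ^ (m : ℕ)), f (𝓘.right j), 𝓘.size * deriv f (𝓘.right j))

variable (𝓘) in
/-- The data of the correction for a right-hand side. -/
def corrData (k : ℕ) (G : Fin N → ℝ → ℂ) : FluxData k N := fun j =>
  (fun m => (𝓘.len j : ℂ) ^ 2 * moment (G j) (antider₂ (X ^ (m : ℕ))), 0, 0)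

theorem refProj_solveOp {f : ℝ → ℂ} (hf : Continuous f) :
    RefProj k F 𝓘 f (solveOp hk h (projData 𝓘 k f)) where
  natDegree_le := natDegree_solveOp hk h _
  moment_eq j _ hψ := moment_solveOp_eq hk h _ j
    (momentFun (refFun 𝓘 f j) (continuous_refFun 𝓘 hf j).continuousOn) (fun _ => rfl) hψ
  hat_eq := fluxHat_solveOp hk h _
  tilde_eq := fluxTilde_solveOp hk h _

theorem refCorr_solveOp {G : Fin N → ℝ → ℂ} (hG : ∀ j, Continuous (G j)) :
    RefCorr k F 𝓘 G (solveOp hk h (corrData 𝓘 k G)) where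
  natDegree_le := natDegree_solveOp hk h _
  moment_eq j _ hψ := moment_solveOp_eq hk h _ j
    ((𝓘.len j : ℂ) ^ 2 • (momentFun (G j) (hG j).continuousOn).comp antider₂) (fun _ => rfl) hψ
  hat_eq := fluxHat_solveOp hk h _
  tilde_eq := fluxTilde_solveOp hk h _

theorem RefProj.unique (h : Unisolvent k F 𝓘) {f : ℝ → ℂ} {p p' : Fin N → ℂ[X]}
    (h1 : RefProj k F 𝓘 f p) (h2 : RefProj k F 𝓘 f p') : p = p' := by
  rw [← sub_eq_zero]
  refine h _ (fun j => (natDegree_sub_le _ _).trans (max_le (h1.natDegree_le j) (h2.natDegree_le j)))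
    (fun j ψ hψ => ?_) (fun j => ?_) (fun j => ?_)
  · have := (momentPoly ψ).map_sub (p j) (p' j)
    exact this.trans (sub_eq_zero.2 ((h1.moment_eq j ψ hψ).trans (h2.moment_eq j ψ hψ).symm))
  · rw [map_sub, Pi.sub_apply, h1.hat_eq, h2.hat_eq, sub_self]
  · rw [map_sub, Pi.sub_apply, h1.tilde_eq, h2.tilde_eq, sub_self]

theorem RefCorr.unique (h : Unisolvent k F 𝓘) {G : Fin N → ℝ → ℂ} {w w' : Fin N → ℂ[X]}
    (h1 : RefCorr k F 𝓘 G w) (h2 : RefCorr k F 𝓘 G w') : w = w' := by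
  rw [← sub_eq_zero]
  refine h _ (fun j => (natDegree_sub_le _ _).trans (max_le (h1.natDegree_le j) (h2.natDegree_le j)))
    (fun j ψ hψ => ?_) (fun j => ?_) (fun j => ?_)
  · have := (momentPoly ψ).map_sub (w j) (w' j)
    exact this.trans (sub_eq_zero.2 ((h1.moment_eq j ψ hψ).trans (h2.moment_eq j ψ hψ).symm))
  · rw [map_sub, Pi.sub_apply, h1.hat_eq, h2.hat_eq, sub_self]
  · rw [map_sub, Pi.sub_apply, h1.tilde_eq, h2.tilde_eq, sub_self]

/-- The `q`-th correction function of `f` on the reference cell. -/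
def corrFun : ℕ → (ℝ → ℂ) → Fin N → ℝ → ℂ
  | 0, f => fun j ξ => refFun 𝓘 f j ξ - polyFun (solveOp hk h (projData 𝓘 k f) j) ξ
  | q + 1, f => fun j =>
      polyFun (solveOp hk h (corrData 𝓘 k (corrFun q (deriv (deriv f)))) j)

theorem continuous_corrFun (q : ℕ) {f : ℝ → ℂ} (hf : Continuous f) (j : Fin N) :
    Continuous (corrFun hk h q f j) := by
  cases q with
  | zero => exact (continuous_refFun 𝓘 hf j).sub (continuous_polyFun _)
  | succ q => exact continuous_polyFun _

theorem isChain_corrFun (q : ℕ) {f : ℝ → ℂ} (hf : ContDiff ℝ (2 * q : ℕ) f) :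
    IsChain k F 𝓘 q f (corrFun hk h q f) := by
  induction q generalizing f with
  | zero => exact ⟨_, refProj_solveOp hk h hf.continuous, rfl⟩
  | succ q ih =>
    have hf2 := contDiff_deriv (contDiff_deriv (n := 2 * q + 1) (contDiff_of_le (by omega) hf))
    exact ⟨_, _, ih hf2, refCorr_solveOp hk h fun j => continuous_corrFun hk h q hf2.continuous j, rfl⟩

end Operators

end UWDG
end

/-! ### Regularity in time of the exact solution. -/

noncomputable section
namespace UWDG

/-- A smooth periodic family of functions `v t`, `t ∈ [0, T]`, with `v' = i v_xx` for the derivatives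
up to order `s`. -/
structure SmoothFam (a b T : ℝ) (s : ℕ) (v : ℝ → ℝ → ℂ) : Prop where
  contDiff : ∀ t ∈ Icc 0 T, ContDiff ℝ s (v t)
  periodic : ∀ t ∈ Icc 0 T, Function.Periodic (v t) (b - a)
  cont : ∀ n ≤ s, ContinuousOn (fun p : ℝ × ℝ => iteratedDeriv n (v p.2) p.1) (univ ×ˢ Icc 0 T)
  hasDeriv : ∀ n, n + 2 ≤ s → ∀ t ∈ Icc 0 T, ∀ x, HasDerivWithinAt
    (fun t => iteratedDeriv n (v t) x) (Complex.I * iteratedDeriv (n + 2) (v t) x) (Icc 0 T) t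

/-- Each space derivative is the Fréchet derivative within the slab, applied to the direction `(1,
0)`; the slab has unique derivatives up to its boundary. -/
theorem contDiffOn_iteratedDeriv_slice {T : ℝ} (hT : 0 < T) {s : ℕ} {v : ℝ → ℝ → ℂ}
    (h : ContDiffOn ℝ s (fun p : ℝ × ℝ => v p.2 p.1) (univ ×ˢ Icc 0 T)) (n : ℕ) (hn : n ≤ s) :
    ContDiffOn ℝ (s - n : ℕ) (fun p : ℝ × ℝ => iteratedDeriv n (v p.2) p.1) (univ ×ˢ Icc 0 T) := by
  have hS : UniqueDiffOn ℝ ((univ : Set ℝ) ×ˢ Icc 0 T) := uniqueDiffOn_univ.prod (uniqueDiffOn_Icc hT)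
  induction n with
  | zero => simpa using h
  | succ n ih =>
    have ih' := ih (by omega)
    set D := fun p : ℝ × ℝ => iteratedDeriv n (v p.2) p.1 with hD
    have hle : ((s - (n + 1) : ℕ) : WithTop ℕ∞) + 1 ≤ (s - n : ℕ) := by
      exact_mod_cast (by omega : s - (n + 1) + 1 ≤ s - n)
    have h1 := ih'.fderivWithin hS hle
    refine (h1.clm_apply (contDiffOn_const (c := ((1 : ℝ), (0 : ℝ))))).congr ?_
    intro p hp
    have hd : DifferentiableWithinAt ℝ D (univ ×ˢ Icc 0 T) p :=
      ih'.differentiableOn (by exact_mod_cast (by omega : s - n ≠ 0)) p hp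
    have hline : HasDerivWithinAt (fun y : ℝ => (y, p.2)) ((1 : ℝ), (0 : ℝ)) univ p.1 :=
      ((hasDerivAt_id p.1).prodMk (hasDerivAt_const p.1 p.2)).hasDerivWithinAt
    have hc := hd.hasFDerivWithinAt.comp_hasDerivWithinAt p.1 hline
      (fun y _ => (⟨mem_univ _, hp.2⟩ : (y, p.2) ∈ univ ×ˢ Icc 0 T))
    rw [hasDerivWithinAt_univ] at hc
    simp only [iteratedDeriv_succ]
    exact hc.deriv

theorem hasDerivAt_integral_slice {T : ℝ} {v : ℝ → ℝ → ℂ} {v' : ℝ → ℝ → ℂ}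
    (hc : ContinuousOn (fun p : ℝ × ℝ => v p.2 p.1) (univ ×ˢ Icc 0 T))
    (hc' : ContinuousOn (fun p : ℝ × ℝ => v' p.2 p.1) (univ ×ˢ Icc 0 T))
    (hd : ∀ t ∈ Icc 0 T, ∀ x, HasDerivAt (v t) (v' t x) x) {t : ℝ} (ht : t ∈ Icc 0 T) (x : ℝ) :
    HasDerivAt (fun x => ∫ r in (0:ℝ)..t, v r x) (∫ r in (0:ℝ)..t, v' r x) x := by
  have hsub : Icc 0 t ⊆ Icc 0 T := Icc_subset_Icc le_rfl ht.2
  have hsl : ∀ (v : ℝ → ℝ → ℂ), ContinuousOn (fun p : ℝ × ℝ => v p.2 p.1) (univ ×ˢ Icc 0 T) →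
      ∀ x, ContinuousOn (fun r => v r x) (Icc 0 t) := fun v hc x =>
    hc.comp (f := fun r => (x, r)) (by fun_prop) (fun r hr => ⟨mem_univ _, hsub hr⟩)
  obtain ⟨B, hB⟩ := ((isCompact_closedBall x 1).prod (isCompact_Icc (a := (0:ℝ)) (b := T))).exists_bound_of_continuousOn
    (hc'.mono (prod_mono (subset_univ _) le_rfl))
  have hmeas : ∀ (v : ℝ → ℝ → ℂ), ContinuousOn (fun p : ℝ × ℝ => v p.2 p.1) (univ ×ˢ Icc 0 T) →
      ∀ x, MeasureTheory.AEStronglyMeasurable (fun r => v r x)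
        (MeasureTheory.volume.restrict (Set.uIoc 0 t)) := fun v hc x => by
    rw [uIoc_of_le ht.1]
    exact ((hsl v hc x).mono Ioc_subset_Icc_self).aestronglyMeasurable measurableSet_Ioc
  refine (intervalIntegral.hasDerivAt_integral_of_dominated_loc_of_deriv_le
    (F := fun x r => v r x) (F' := fun x r => v' r x)
    (s := Metric.ball x 1) (bound := fun _ => B) (Metric.ball_mem_nhds x one_pos)
    (Filter.Eventually.of_forall fun x => hmeas v hc x) ?_ (hmeas v' hc' x) ?_ ?_ ?_).2
  · apply ContinuousOn.intervalIntegrable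
    rw [uIcc_of_le ht.1]
    exact hsl v hc x
  · refine Filter.Eventually.of_forall fun r hr y hy => ?_
    rw [uIoc_of_le ht.1] at hr
    exact hB (y, r) ⟨Metric.ball_subset_closedBall hy, hsub ⟨hr.1.le, hr.2⟩⟩
  · exact intervalIntegrable_const
  · refine Filter.Eventually.of_forall fun r hr y hy => ?_
    rw [uIoc_of_le ht.1] at hr
    exact hd r (hsub ⟨hr.1.le, hr.2⟩) y

/-- The equation for the space derivatives is obtained in integrated form. Integrating `u_t = i
u_xx` over `[0, t]` includes the initial time, where the equation is not assumed. Differentiating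
this identity in `x` under the integral handles all orders without commuting mixed derivatives, and
the fundamental theorem of calculus recovers the time derivative. -/
theorem IsExactSolution.smoothFam {a b T : ℝ} (hT : 0 < T) {s : ℕ} {u : ℝ → ℝ → ℂ}
    (h : IsExactSolution a b T s u) : SmoothFam a b T s (fun t x => u x t) := by
  set v : ℝ → ℝ → ℂ := fun t x => u x t with hv
  have hcd := contDiffOn_iteratedDeriv_slice hT (v := v) h.smooth
  have hcont : ∀ n ≤ s, ContinuousOn (fun p : ℝ × ℝ => iteratedDeriv n (v p.2) p.1)
      (univ ×ˢ Icc 0 T) := fun n hn => (hcd n hn).continuousOn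
  have hsl : ∀ t ∈ Icc 0 T, ContDiff ℝ s (v t) := by
    intro t ht
    rw [← contDiffOn_univ]
    exact h.smooth.comp (f := fun x : ℝ => (x, t)) (by fun_prop) (fun x _ => ⟨mem_univ _, ht⟩)
  have htime : ∀ n ≤ s, ∀ x, ContinuousOn (fun r => iteratedDeriv n (v r) x) (Icc 0 T) :=
    fun n hn x => (hcont n hn).comp (f := fun r => (x, r)) (by fun_prop)
      (fun r hr => ⟨mem_univ _, hr⟩)
  have hint : ∀ n, n + 2 ≤ s → ∀ t ∈ Icc 0 T, ∀ x, iteratedDeriv n (v t) x =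
      iteratedDeriv n (v 0) x + Complex.I * ∫ r in (0:ℝ)..t, iteratedDeriv (n + 2) (v r) x := by
    intro n
    induction n with
    | zero =>
      intro hs t ht x
      have hsub : Icc 0 t ⊆ Icc 0 T := Icc_subset_Icc le_rfl ht.2
      have hI := intervalIntegral.integral_eq_sub_of_hasDerivAt_of_le ht.1
        (f := fun r => v r x) (f' := fun r => Complex.I * iteratedDeriv 2 (v r) x)
        (by simpa using (htime 0 (by omega) x).mono hsub) (fun r hr => ?_) ?_
      · rw [intervalIntegral.integral_const_mul] at hI
        simp only [iteratedDeriv_zero, zero_add]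
        rw [hI]; ring
      · have hr' : r ∈ Ioo 0 T := ⟨hr.1, hr.2.trans_le ht.2⟩
        have hd : DifferentiableWithinAt ℝ (fun r => v r x) (Icc 0 T) r := by
          have h1 : DifferentiableWithinAt ℝ (fun p : ℝ × ℝ => u p.1 p.2) (univ ×ˢ Icc 0 T) (x, r) :=
            h.smooth.differentiableOn (by exact_mod_cast (by omega : s ≠ 0)) _
              ⟨mem_univ _, hr'.1.le, hr'.2.le⟩
          exact h1.comp (f := fun r => (x, r)) r (by fun_prop) (fun r hr => ⟨mem_univ _, hr⟩)
        have h2 := h.equation r ⟨hr'.1, hr'.2.le⟩ x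
        have h3 := hd.hasDerivWithinAt.hasDerivAt (Icc_mem_nhds hr'.1 hr'.2)
        convert h3 using 1
        have : derivWithin (fun r => v r x) (Icc 0 T) r = derivWithin (fun r => u x r) (Icc 0 T) r := rfl
        rw [this]
        linear_combination Complex.I * h2 - derivWithin (fun r => u x r) (Icc 0 T) r * Complex.I_sq
      · apply ContinuousOn.intervalIntegrable
        rw [uIcc_of_le ht.1]
        exact continuousOn_const.mul ((htime 2 (by omega) x).mono hsub)
    | succ n ih =>
      intro hs t ht x
      have h0 : (0:ℝ) ∈ Icc 0 T := ⟨le_rfl, hT.le⟩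
      have hdx : ∀ m, m + 1 ≤ s → ∀ t ∈ Icc 0 T, ∀ x, HasDerivAt (iteratedDeriv m (v t))
          (iteratedDeriv (m + 1) (v t) x) x := by
        intro m hm t ht x
        rw [iteratedDeriv_succ]
        exact ((hsl t ht).differentiable_iteratedDeriv m (by exact_mod_cast hm) x).hasDerivAt
      have e1 := hdx n (by omega) t ht x
      have e2 := hdx n (by omega) 0 h0 x
      have e3 := hasDerivAt_integral_slice (v := fun r => iteratedDeriv (n + 2) (v r))
        (v' := fun r => iteratedDeriv (n + 2 + 1) (v r)) (hcont _ (by omega)) (hcont _ (by omega))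
        (hdx (n + 2) (by omega)) ht x
      have e4 := e2.add (e3.const_mul Complex.I)
      have e5 : iteratedDeriv n (v t) = fun x => iteratedDeriv n (v 0) x +
          Complex.I * ∫ r in (0:ℝ)..t, iteratedDeriv (n + 2) (v r) x :=
        funext (ih (by omega) t ht)
      rw [e5] at e1
      exact e1.unique e4
  refine ⟨hsl, h.periodic, hcont, fun n hn t ht x => ?_⟩
  have hc := htime (n + 2) hn x
  have : Fact (t ∈ Icc 0 T) := ⟨ht⟩
  have hftc := intervalIntegral.integral_hasDerivWithinAt_right (a := 0) (b := t)
    (f := fun r => iteratedDeriv (n + 2) (v r) x) (s := Icc 0 T) (t := Icc 0 T)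
    (by
      apply ContinuousOn.intervalIntegrable
      rw [uIcc_of_le ht.1]
      exact hc.mono (Icc_subset_Icc le_rfl ht.2))
    (hc.stronglyMeasurableAtFilter_nhdsWithin measurableSet_Icc t) (hc t ht)
  refine ((hftc.const_mul Complex.I).const_add (iteratedDeriv n (v 0) x)).congr_of_mem
    (fun r hr => hint n hn r hr x) ht

/-- On a periodic smooth function a derivative is bounded by the derivative of the next order. -/
theorem norm_iteratedDeriv_le_of_periodic {a b : ℝ} (hab : a < b) {f : ℝ → ℂ} {n : ℕ}
    (hf : ContDiff ℝ (n + 2 : ℕ) f) (hp : Function.Periodic f (b - a)) {M : ℝ}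
    (hM : ∀ x, ‖iteratedDeriv (n + 2) f x‖ ≤ M) (x : ℝ) :
    ‖iteratedDeriv (n + 1) f x‖ ≤ (b - a) * M := by
  set g := iteratedDeriv (n + 1) f with hg
  have hba : 0 < b - a := sub_pos.2 hab
  have hgd : Differentiable ℝ g := hf.differentiable_iteratedDeriv _ (by exact_mod_cast Nat.lt_succ_self _)
  have hfd : Differentiable ℝ (iteratedDeriv n f) :=
    hf.differentiable_iteratedDeriv _ (by exact_mod_cast (by omega : n < n + 2))
  -- As a derivative of a periodic function, `g` has mean zero over a period. Hence `(b - a) g x` is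
  -- the integral of `g x - g y`, which is bounded through the derivative of `g`.
  have hmean : ∫ y in x..x + (b - a), g y = 0 := by
    rw [intervalIntegral.integral_eq_sub_of_hasDerivAt (f := iteratedDeriv n f) (fun y _ => ?_)
      (hgd.continuous.intervalIntegrable _ _), periodic_iteratedDeriv hp n, sub_self]
    rw [hg, iteratedDeriv_succ]
    exact (hfd y).hasDerivAt
  have hlip : ∀ y ∈ Set.uIoc x (x + (b - a)), ‖g x - g y‖ ≤ M * (b - a) := by
    intro y hy
    rw [uIoc_of_le (by linarith)] at hy
    have := convex_univ.norm_image_sub_le_of_norm_deriv_le (f := g) (s := univ) (x := y)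
      (y := x) (fun x _ => hgd x) (C := M) (fun x _ => by
        rw [hg, ← iteratedDeriv_succ]; exact hM x) (mem_univ _) (mem_univ _)
    refine this.trans ?_
    have hM0 : 0 ≤ M := (norm_nonneg _).trans (hM x)
    gcongr
    rw [Real.norm_eq_abs, abs_le]
    constructor <;> linarith [hy.1, hy.2]
  have h1 := intervalIntegral.norm_integral_le_of_norm_le_const hlip
  rw [intervalIntegral.integral_sub intervalIntegrable_const (hgd.continuous.intervalIntegrable _ _),
    hmean, sub_zero, intervalIntegral.integral_const, add_sub_cancel_left, norm_smul,
    Real.norm_of_nonneg hba.le, abs_of_pos hba] at h1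
  refine le_of_mul_le_mul_left ?_ hba
  linarith

end UWDG
end

/-! ### Time derivatives of projections and corrections. -/

noncomputable section
namespace UWDG

/-- A family of continuous functions on `[0, 1]` that is continuously differentiable in time. -/
structure TimeFam (T : ℝ) (G G' : ℝ → ℝ → ℂ) : Prop where
  cont : ContinuousOn (fun p : ℝ × ℝ => G p.1 p.2) (Icc 0 T ×ˢ Icc 0 1)
  cont' : ContinuousOn (fun p : ℝ × ℝ => G' p.1 p.2) (Icc 0 T ×ˢ Icc 0 1)
  hasDeriv : ∀ ξ ∈ Icc (0:ℝ) 1, ∀ t ∈ Icc 0 T,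
    HasDerivWithinAt (fun t => G t ξ) (G' t ξ) (Icc 0 T) t

theorem continuousOn_slice {T : ℝ} {G : ℝ → ℝ → ℂ}
    (hG : ContinuousOn (fun p : ℝ × ℝ => G p.1 p.2) (Icc 0 T ×ˢ Icc 0 1)) {t : ℝ}
    (ht : t ∈ Icc 0 T) : ContinuousOn (G t) (Icc 0 1) :=
  hG.comp (f := fun ξ => (t, ξ)) (by fun_prop) (fun _ hξ => ⟨ht, hξ⟩)

theorem aestronglyMeasurable_mul_poly {G : ℝ → ℂ} (hG : ContinuousOn G (Icc 0 1)) (φ : ℂ[X]) :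
    MeasureTheory.AEStronglyMeasurable (fun ξ : ℝ => G ξ * φ.eval (ξ : ℂ))
      (MeasureTheory.volume.restrict (Set.uIoc 0 1)) := by
  rw [uIoc_of_le zero_le_one]
  exact ((hG.mul (continuous_polyFun φ).continuousOn).mono Ioc_subset_Icc_self).aestronglyMeasurable
    measurableSet_Ioc

theorem continuousOn_moment {T : ℝ} {G : ℝ → ℝ → ℂ}
    (hG : ContinuousOn (fun p : ℝ × ℝ => G p.1 p.2) (Icc 0 T ×ˢ Icc 0 1)) (φ : ℂ[X]) :
    ContinuousOn (fun t => moment (G t) φ) (Icc 0 T) := by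
  obtain ⟨B, hB⟩ := (isCompact_Icc.prod isCompact_Icc).exists_bound_of_continuousOn hG
  intro t ht
  refine intervalIntegral.continuousWithinAt_of_dominated_interval
    (bound := fun _ => B * cnorm φ.natDegree φ) ?_ ?_ intervalIntegrable_const ?_
  · filter_upwards [self_mem_nhdsWithin] with s hs
    exact aestronglyMeasurable_mul_poly (continuousOn_slice hG hs) φ
  · filter_upwards [self_mem_nhdsWithin] with s hs
    refine Filter.Eventually.of_forall fun ξ hξ => ?_
    rw [uIoc_of_le zero_le_one] at hξ
    have hξ' : ξ ∈ Icc (0:ℝ) 1 := ⟨hξ.1.le, hξ.2⟩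
    rw [norm_mul]
    exact mul_le_mul (hB (s, ξ) ⟨hs, hξ'⟩) (norm_eval_le_cnorm le_rfl hξ') (norm_nonneg _)
      ((norm_nonneg _).trans (hB (s, ξ) ⟨hs, hξ'⟩))
  · refine Filter.Eventually.of_forall fun ξ hξ => ?_
    rw [uIoc_of_le zero_le_one] at hξ
    have hξ' : ξ ∈ Icc (0:ℝ) 1 := ⟨hξ.1.le, hξ.2⟩
    have : ContinuousOn (fun t => G t ξ) (Icc 0 T) :=
      hG.comp (f := fun t => (t, ξ)) (by fun_prop) (fun _ hs => ⟨hs, hξ'⟩)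
    exact (this t ht).mul continuousWithinAt_const

/-- Dominated convergence for the difference quotients, which the mean value inequality bounds
uniformly. Working with slopes within `[0, T]` covers the one-sided derivatives at the end points.
-/
theorem TimeFam.hasDerivWithinAt_moment {T : ℝ} {G G' : ℝ → ℝ → ℂ} (h : TimeFam T G G') (φ : ℂ[X])
    {t : ℝ} (ht : t ∈ Icc 0 T) :
    HasDerivWithinAt (fun t => moment (G t) φ) (moment (G' t) φ) (Icc 0 T) t := by
  obtain ⟨B, hB⟩ := (isCompact_Icc.prod isCompact_Icc).exists_bound_of_continuousOn h.cont'
  rw [hasDerivWithinAt_iff_tendsto_slope]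
  have key : Filter.Tendsto
      (fun s => ∫ ξ in (0:ℝ)..1, slope (fun t => G t ξ) t s * φ.eval (ξ : ℂ))
      (nhdsWithin t (Icc 0 T \ {t})) (nhds (moment (G' t) φ)) := by
    refine intervalIntegral.tendsto_integral_filter_of_dominated_convergence
      (fun _ => B * cnorm φ.natDegree φ) ?_ ?_ intervalIntegrable_const ?_
    · filter_upwards [self_mem_nhdsWithin] with s hs
      refine aestronglyMeasurable_mul_poly ?_ φ
      simp only [slope, vsub_eq_sub]
      exact ((continuousOn_slice h.cont hs.1).sub (continuousOn_slice h.cont ht)).const_smul _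
    · filter_upwards [self_mem_nhdsWithin] with s hs
      refine Filter.Eventually.of_forall fun ξ hξ => ?_
      rw [uIoc_of_le zero_le_one] at hξ
      have hξ' : ξ ∈ Icc (0:ℝ) 1 := ⟨hξ.1.le, hξ.2⟩
      have hmv := (convex_Icc (0:ℝ) T).norm_image_sub_le_of_norm_hasDerivWithin_le
        (f := fun t => G t ξ) (fun r hr => h.hasDeriv ξ hξ' r hr)
        (fun r hr => hB (r, ξ) ⟨hr, hξ'⟩) ht hs.1
      have hst : 0 < ‖s - t‖ := norm_pos_iff.2 (sub_ne_zero.2 hs.2)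
      have hsl : ‖slope (fun t => G t ξ) t s‖ ≤ B := by
        rw [slope, vsub_eq_sub, norm_smul, norm_inv, inv_mul_le_iff₀ hst, mul_comm]
        exact hmv
      rw [norm_mul]
      exact mul_le_mul hsl (norm_eval_le_cnorm le_rfl hξ') (norm_nonneg _)
        ((norm_nonneg _).trans hsl)
    · refine Filter.Eventually.of_forall fun ξ hξ => ?_
      rw [uIoc_of_le zero_le_one] at hξ
      have hξ' : ξ ∈ Icc (0:ℝ) 1 := ⟨hξ.1.le, hξ.2⟩
      exact (hasDerivWithinAt_iff_tendsto_slope.1 (h.hasDeriv ξ hξ' t ht)).mul_const _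
  refine key.congr' ?_
  filter_upwards [self_mem_nhdsWithin] with s hs
  rw [slope, vsub_eq_sub, ← moment_sub_left (continuousOn_slice h.cont hs.1)
    (continuousOn_slice h.cont ht), Complex.real_smul, ← moment_const_mul_left, moment]
  refine intervalIntegral.integral_congr fun ξ _ => ?_
  simp [slope]

theorem hasDerivWithinAt_linearMap {V : Type*} [NormedAddCommGroup V] [NormedSpace ℂ V]
    [FiniteDimensional ℂ V] [NormedSpace ℝ V] [IsScalarTower ℝ ℂ V] (L : V →ₗ[ℂ] ℂ) {d : ℝ → V} {d' : V}
    {s : Set ℝ} {t : ℝ} (h : HasDerivWithinAt d d' s t) :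
    HasDerivWithinAt (fun t => L (d t)) (L d') s t := by
  have := ((L.toContinuousLinearMap.restrictScalars ℝ).hasFDerivAt
    (x := d t)).comp_hasDerivWithinAt t h
  exact this

section Families

variable {a b : ℝ} {N : ℕ} [NeZero N] {k : ℕ} (hk : 2 ≤ k) {F : Flux} {𝓘 : Mesh a b N}
  (h : Unisolvent k F 𝓘)

theorem continuousOn_polyFun_family {T : ℝ} {p : ℝ → ℂ[X]} (hp : ∀ t, (p t).natDegree ≤ k)
    (hc : ∀ i, ContinuousOn (fun t => (p t).coeff i) (Icc 0 T)) :
    ContinuousOn (fun q : ℝ × ℝ => polyFun (p q.1) q.2) (Icc 0 T ×ˢ Icc 0 1) := by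
  have e : (fun q : ℝ × ℝ => polyFun (p q.1) q.2) =
      fun q => ∑ i ∈ Finset.range (k + 1), (p q.1).coeff i * (q.2 : ℂ) ^ i := by
    ext q
    rw [polyFun, eval_eq_sum_range' (Nat.lt_succ_of_le (hp _))]
  rw [e]
  refine continuousOn_finsetSum _ fun i _ => ContinuousOn.mul ?_ (by fun_prop)
  exact (hc i).comp continuousOn_fst fun q hq => hq.1

/-- The time derivative of solutions of the moment and flux problem. -/
theorem hasDerivWithinAt_solveOp {T : ℝ} {d d' : ℝ → FluxData k N}
    (hd : ∀ t ∈ Icc 0 T, HasDerivWithinAt d (d' t) (Icc 0 T) t) (Φ : (Fin N → ℂ[X]) →ₗ[ℂ] ℂ) {t : ℝ}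
    (ht : t ∈ Icc 0 T) :
    HasDerivWithinAt (fun t => Φ (solveOp hk h (d t))) (Φ (solveOp hk h (d' t))) (Icc 0 T) t :=
  hasDerivWithinAt_linearMap (Φ.comp (solveOp hk h)) (hd t ht)

/-- The coefficient functional. -/
def coeffAt (j : Fin N) (i : ℕ) : (Fin N → ℂ[X]) →ₗ[ℂ] ℂ := (lcoeff ℂ i).comp (LinearMap.proj j)

/-- The evaluation functional. -/
def evalAt (j : Fin N) (z : ℂ) : (Fin N → ℂ[X]) →ₗ[ℂ] ℂ := (leval z).comp (LinearMap.proj j)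

theorem TimeFam.solveOp {T : ℝ} {d d' : ℝ → FluxData k N}
    (hd : ∀ t ∈ Icc 0 T, HasDerivWithinAt d (d' t) (Icc 0 T) t)
    (hc : ContinuousOn d' (Icc 0 T)) (j : Fin N) :
    TimeFam T (fun t => polyFun (solveOp hk h (d t) j)) (fun t => polyFun (solveOp hk h (d' t) j)) where
  cont := continuousOn_polyFun_family (fun t => natDegree_solveOp hk h _ j) fun i t ht =>
    (hasDerivWithinAt_solveOp hk h hd (coeffAt j i) ht).continuousWithinAt
  cont' := continuousOn_polyFun_family (fun t => natDegree_solveOp hk h _ j) fun i => by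
    have : Continuous ((coeffAt j i).comp (UWDG.solveOp hk h)) :=
      LinearMap.continuous_of_finiteDimensional _
    exact this.comp_continuousOn hc
  hasDeriv ξ _ t ht := hasDerivWithinAt_solveOp hk h hd (evalAt j ξ) ht

theorem SmoothFam.timeFam_refFun {T : ℝ} {s : ℕ} {v : ℝ → ℝ → ℂ} (hv : SmoothFam a b T s v) {n : ℕ}
    (hn : n + 2 ≤ s) (j : Fin N) : TimeFam T (fun t => refFun 𝓘 (iteratedDeriv n (v t)) j)
      (fun t ξ => Complex.I * refFun 𝓘 (iteratedDeriv (n + 2) (v t)) j ξ) where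
  cont := (hv.cont n (by omega)).comp
    (f := fun p : ℝ × ℝ => (𝓘.left j + 𝓘.len j * p.2, p.1)) (by fun_prop)
    fun p hp => ⟨mem_univ _, hp.1⟩
  cont' := continuousOn_const.mul ((hv.cont (n + 2) hn).comp
    (f := fun p : ℝ × ℝ => (𝓘.left j + 𝓘.len j * p.2, p.1)) (by fun_prop)
    fun p hp => ⟨mem_univ _, hp.1⟩)
  hasDeriv ξ _ t ht := hv.hasDeriv n hn t ht _

theorem SmoothFam.continuousOn_time {T : ℝ} {s : ℕ} {v : ℝ → ℝ → ℂ} (hv : SmoothFam a b T s v) {n : ℕ}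
    (hn : n ≤ s) (x : ℝ) : ContinuousOn (fun t => iteratedDeriv n (v t) x) (Icc 0 T) :=
  (hv.cont n hn).comp (f := fun t => (x, t)) (by fun_prop) fun _ ht => ⟨mem_univ _, ht⟩

/-- Three derivatives beyond `n`: two for the time derivative, one more because the data contain the
derivative flux. -/
theorem SmoothFam.hasDerivWithinAt_projData {T : ℝ} {s : ℕ} {v : ℝ → ℝ → ℂ}
    (hv : SmoothFam a b T s v) {n : ℕ} (hn : n + 3 ≤ s) {t : ℝ} (ht : t ∈ Icc 0 T) :
    HasDerivWithinAt (fun t => projData 𝓘 k (iteratedDeriv n (v t)))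
      (Complex.I • projData 𝓘 k (iteratedDeriv (n + 2) (v t))) (Icc 0 T) t := by
  rw [hasDerivWithinAt_pi]
  intro j
  refine HasDerivWithinAt.prodMk ?_ (HasDerivWithinAt.prodMk ?_ ?_)
  · rw [hasDerivWithinAt_pi]
    intro m
    have := (hv.timeFam_refFun (𝓘 := 𝓘) (n := n) (by omega) j).hasDerivWithinAt_moment
      (X ^ (m : ℕ)) ht
    rwa [moment_const_mul_left] at this
  · exact hv.hasDeriv n (by omega) t ht _
  · have := (hv.hasDeriv (n + 1) (by omega) t ht (𝓘.right j)).const_mul (𝓘.size : ℂ)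
    rw [mul_left_comm] at this
    simp only [iteratedDeriv_succ] at this ⊢
    exact this

theorem SmoothFam.continuousOn_projData {T : ℝ} {s : ℕ} {v : ℝ → ℝ → ℂ}
    (hv : SmoothFam a b T s v) {n : ℕ} (hn : n + 1 ≤ s) :
    ContinuousOn (fun t => projData 𝓘 k (iteratedDeriv n (v t))) (Icc 0 T) := by
  refine continuousOn_pi.2 fun j => ContinuousOn.prodMk (continuousOn_pi.2 fun m => ?_)
    (ContinuousOn.prodMk (hv.continuousOn_time (by omega) _) ?_)
  · exact continuousOn_moment (G := fun t => refFun 𝓘 (iteratedDeriv n (v t)) j)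
      ((hv.cont n (by omega)).comp
        (f := fun p : ℝ × ℝ => (𝓘.left j + 𝓘.len j * p.2, p.1)) (by fun_prop)
        fun p hp => ⟨mem_univ _, hp.1⟩) _
  · simp only [← iteratedDeriv_succ]
    exact continuousOn_const.mul (hv.continuousOn_time hn _)

theorem deriv_deriv_iteratedDeriv (n : ℕ) (f : ℝ → ℂ) :
    deriv (deriv (iteratedDeriv n f)) = iteratedDeriv (n + 2) f := by
  rw [← iteratedDeriv_succ, ← iteratedDeriv_succ]

theorem hasDerivWithinAt_corrData {T : ℝ} {G G' : ℝ → Fin N → ℝ → ℂ}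
    (hG : ∀ j, TimeFam T (fun t => G t j) (fun t ξ => Complex.I * G' t j ξ)) {t : ℝ}
    (ht : t ∈ Icc 0 T) : HasDerivWithinAt (fun t => corrData 𝓘 k (G t))
      (Complex.I • corrData 𝓘 k (G' t)) (Icc 0 T) t := by
  rw [hasDerivWithinAt_pi]
  intro j
  refine HasDerivWithinAt.prodMk ?_ (HasDerivWithinAt.prodMk ?_ ?_)
  · rw [hasDerivWithinAt_pi]
    intro m
    have := ((hG j).hasDerivWithinAt_moment (antider₂ (X ^ (m : ℕ))) ht).const_mul
      ((𝓘.len j : ℂ) ^ 2)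
    rw [moment_const_mul_left, mul_left_comm] at this
    exact this
  · simpa [corrData] using hasDerivWithinAt_const t (Icc 0 T) (0 : ℂ)
  · simpa [corrData] using hasDerivWithinAt_const t (Icc 0 T) (0 : ℂ)

theorem continuousOn_corrData {T : ℝ} {G : ℝ → Fin N → ℝ → ℂ}
    (hG : ∀ j, ContinuousOn (fun p : ℝ × ℝ => G p.1 j p.2) (Icc 0 T ×ˢ Icc 0 1)) :
    ContinuousOn (fun t => corrData 𝓘 k (G t)) (Icc 0 T) := by
  refine continuousOn_pi.2 fun j => ContinuousOn.prodMk (continuousOn_pi.2 fun m => ?_)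
    (ContinuousOn.prodMk continuousOn_const continuousOn_const)
  exact continuousOn_const.mul (continuousOn_moment (G := fun t => G t j) (hG j) _)

/-- The polynomial part of the `q`-th correction function. -/
def corrPoly : ℕ → (ℝ → ℂ) → Fin N → ℂ[X]
  | 0, f => solveOp hk h (projData 𝓘 k f)
  | q + 1, f => solveOp hk h (corrData 𝓘 k (corrFun hk h q (deriv (deriv f))))

theorem corrFun_succ (q : ℕ) (f : ℝ → ℂ) (j : Fin N) :
    corrFun hk h (q + 1) f j = polyFun (corrPoly hk h (q + 1) f j) := rfl

/-- The operators involved are linear and independent of time, so `∂_t = i ∂_xx` passes from the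
exact solution through every correction. Each level takes two more space derivatives. -/
theorem SmoothFam.corr {T : ℝ} {s : ℕ} {v : ℝ → ℝ → ℂ} (hv : SmoothFam a b T s v) (q : ℕ) :
    ∀ n, n + 2 * q + 3 ≤ s →
      (∀ Φ : (Fin N → ℂ[X]) →ₗ[ℂ] ℂ, ∀ t ∈ Icc 0 T, HasDerivWithinAt
        (fun t => Φ (corrPoly hk h q (iteratedDeriv n (v t))))
        (Complex.I * Φ (corrPoly hk h q (iteratedDeriv (n + 2) (v t)))) (Icc 0 T) t) ∧
      ∀ j, TimeFam T (fun t => corrFun hk h q (iteratedDeriv n (v t)) j)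
        (fun t ξ => Complex.I * corrFun hk h q (iteratedDeriv (n + 2) (v t)) j ξ) := by
  induction q with
  | zero =>
    intro n hn
    have hd := fun t (ht : t ∈ Icc 0 T) => hv.hasDerivWithinAt_projData (𝓘 := 𝓘) (k := k) (n := n)
      (by omega) ht
    constructor
    · intro Φ t ht
      have := hasDerivWithinAt_solveOp hk h hd Φ ht
      rwa [map_smul, map_smul, smul_eq_mul] at this
    · intro j
      have h1 := TimeFam.solveOp hk h hd
        ((hv.continuousOn_projData (𝓘 := 𝓘) (k := k) (n := n + 2) (by omega)).const_smul Complex.I) j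
      have h2 := hv.timeFam_refFun (𝓘 := 𝓘) (n := n) (by omega) j
      have e : (fun (t ξ : ℝ) => Complex.I * corrFun hk h 0 (iteratedDeriv (n + 2) (v t)) j ξ) =
          fun t ξ => Complex.I * refFun 𝓘 (iteratedDeriv (n + 2) (v t)) j ξ -
            polyFun (UWDG.solveOp hk h (Complex.I • projData 𝓘 k (iteratedDeriv (n + 2) (v t))) j) ξ := by
        ext t ξ
        rw [map_smul, corrFun, mul_sub]
        simp [polyFun]
      rw [e]
      exact ⟨h2.cont.sub h1.cont, h2.cont'.sub h1.cont', fun ξ hξ t ht =>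
        (h2.hasDeriv ξ hξ t ht).sub (h1.hasDeriv ξ hξ t ht)⟩
  | succ q ih =>
    intro n hn
    have hF := (ih (n + 2) (by omega)).2
    have hd := fun t (ht : t ∈ Icc 0 T) => hasDerivWithinAt_corrData (𝓘 := 𝓘) (k := k) hF ht
    have hc : ContinuousOn (fun t => Complex.I • corrData 𝓘 k
        (corrFun hk h q (iteratedDeriv (n + 2 + 2) (v t)))) (Icc 0 T) := by
      refine (continuousOn_corrData fun j => ?_).const_smul Complex.I
      have := (continuousOn_const (c := -Complex.I)).mul (hF j).cont'
      refine this.congr fun p _ => ?_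
      change _ = -Complex.I * (Complex.I * _)
      rw [← mul_assoc, neg_mul, Complex.I_mul_I, neg_neg, one_mul]
    constructor
    · intro Φ t ht
      have := hasDerivWithinAt_solveOp hk h hd Φ ht
      rw [map_smul, map_smul, smul_eq_mul] at this
      simpa only [corrPoly, deriv_deriv_iteratedDeriv] using this
    · intro j
      have h1 := TimeFam.solveOp hk h hd hc j
      simp only [corrFun, deriv_deriv_iteratedDeriv]
      convert h1 using 3 with t ξ
      rw [map_smul]
      simp [polyFun]

end Families

end UWDG
end

/-! ### Transfer of the scheme and its corrections to the reference cell. -/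

noncomputable section
namespace UWDG

section Reference

variable {a b : ℝ} {N : ℕ} [NeZero N]

/-- The map from the reference cell onto the cell `j`. -/
def affine (𝓘 : Mesh a b N) (j : Fin N) : ℂ[X] := C (𝓘.len j : ℂ) * X + C (𝓘.left j : ℂ)

/-- The map from the cell `j` onto the reference cell. -/
def affineInv (𝓘 : Mesh a b N) (j : Fin N) : ℂ[X] :=
  C ((𝓘.len j : ℂ)⁻¹) * X + C (-((𝓘.len j : ℂ)⁻¹ * 𝓘.left j))

theorem Mesh.len_ne_zero (𝓘 : Mesh a b N) (j : Fin N) : (𝓘.len j : ℂ) ≠ 0 :=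
  Complex.ofReal_ne_zero.2 (𝓘.len_pos j).ne'

theorem Mesh.size_ne_zero (𝓘 : Mesh a b N) : (𝓘.size : ℂ) ≠ 0 :=
  Complex.ofReal_ne_zero.2 𝓘.size_pos.ne'

/-- A piecewise polynomial in the reference variable. -/
def refPoly (𝓘 : Mesh a b N) (p : Fin N → ℂ[X]) : Fin N → ℂ[X] := fun j => (p j).comp (affine 𝓘 j)

theorem affineInv_comp_affine (𝓘 : Mesh a b N) (j : Fin N) :
    (affineInv 𝓘 j).comp (affine 𝓘 j) = X := by
  have := 𝓘.len_ne_zero j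
  simp only [affineInv, affine, add_comp, mul_comp, C_comp, X_comp, mul_add, ← mul_assoc, ← C_mul]
  rw [inv_mul_cancel₀ this, add_assoc, ← C_add]
  simp

theorem comp_affineInv_comp_affine (𝓘 : Mesh a b N) (j : Fin N) (φ : ℂ[X]) :
    (φ.comp (affineInv 𝓘 j)).comp (affine 𝓘 j) = φ := by
  rw [comp_assoc, affineInv_comp_affine, comp_X]

theorem natDegree_affine (𝓘 : Mesh a b N) (j : Fin N) : (affine 𝓘 j).natDegree = 1 :=
  natDegree_linear (𝓘.len_ne_zero j)

theorem natDegree_affineInv (𝓘 : Mesh a b N) (j : Fin N) : (affineInv 𝓘 j).natDegree = 1 :=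
  natDegree_linear (inv_ne_zero (𝓘.len_ne_zero j))

theorem natDegree_comp_affine (𝓘 : Mesh a b N) (j : Fin N) (φ : ℂ[X]) :
    (φ.comp (affine 𝓘 j)).natDegree = φ.natDegree := by
  rw [natDegree_comp, natDegree_affine, mul_one]

theorem natDegree_comp_affineInv (𝓘 : Mesh a b N) (j : Fin N) (φ : ℂ[X]) :
    (φ.comp (affineInv 𝓘 j)).natDegree = φ.natDegree := by
  rw [natDegree_comp, natDegree_affineInv, mul_one]

theorem derivative_comp_affine (𝓘 : Mesh a b N) (j : Fin N) (φ : ℂ[X]) :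
    derivative (φ.comp (affine 𝓘 j)) = (𝓘.len j : ℂ) • (derivative φ).comp (affine 𝓘 j) := by
  rw [derivative_comp, smul_eq_C_mul]
  simp [affine]

theorem eval_comp_affine (𝓘 : Mesh a b N) (j : Fin N) (φ : ℂ[X]) (ξ : ℝ) :
    (φ.comp (affine 𝓘 j)).eval (ξ : ℂ) = φ.eval ((𝓘.left j + 𝓘.len j * ξ : ℝ) : ℂ) := by
  rw [eval_comp]; congr 1; simp [affine]; ring

theorem eval_comp_affine_one (𝓘 : Mesh a b N) (j : Fin N) (φ : ℂ[X]) :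
    (φ.comp (affine 𝓘 j)).eval 1 = φ.eval (𝓘.right j : ℂ) := by
  have := eval_comp_affine 𝓘 j φ 1
  rwa [mul_one, ← 𝓘.right_eq, Complex.ofReal_one] at this

theorem eval_comp_affine_zero (𝓘 : Mesh a b N) (j : Fin N) (φ : ℂ[X]) :
    (φ.comp (affine 𝓘 j)).eval 0 = φ.eval (𝓘.left j : ℂ) := by
  have := eval_comp_affine 𝓘 j φ 0
  rwa [mul_zero, add_zero, Complex.ofReal_zero] at this

theorem integral_cell (𝓘 : Mesh a b N) (j : Fin N) (G : ℝ → ℂ) :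
    ∫ x in (𝓘.left j)..(𝓘.right j), G x =
      𝓘.len j * ∫ ξ in (0:ℝ)..1, G (𝓘.left j + 𝓘.len j * ξ) := by
  have := intervalIntegral.smul_integral_comp_add_mul (a := 0) (b := 1) G (𝓘.len j) (𝓘.left j)
  rw [mul_zero, add_zero, mul_one, ← 𝓘.right_eq] at this
  rw [← this, Complex.real_smul]

theorem integral_cell_mul (𝓘 : Mesh a b N) (j : Fin N) (G : ℝ → ℂ) (φ : ℂ[X]) :
    ∫ x in (𝓘.left j)..(𝓘.right j), G x * φ.eval (x : ℂ) =
      𝓘.len j * moment (refFun 𝓘 G j) (φ.comp (affine 𝓘 j)) := by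
  rw [integral_cell, moment]
  simp only [eval_comp_affine, refFun]

theorem refFun_polyFun (𝓘 : Mesh a b N) (j : Fin N) (p : ℂ[X]) :
    refFun 𝓘 (polyFun p) j = polyFun (p.comp (affine 𝓘 j)) := by
  ext ξ; simp only [refFun, polyFun, eval_comp_affine]

theorem integral_cell_poly (𝓘 : Mesh a b N) (j : Fin N) (p φ : ℂ[X]) :
    ∫ x in (𝓘.left j)..(𝓘.right j), p.eval (x : ℂ) * φ.eval (x : ℂ) =
      𝓘.len j * moment (polyFun (p.comp (affine 𝓘 j))) (φ.comp (affine 𝓘 j)) := by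
  rw [← refFun_polyFun, ← integral_cell_mul]; rfl

theorem ratio_mul_len (𝓘 : Mesh a b N) (j : Fin N) : (ratio 𝓘 j : ℂ) * 𝓘.len j = 𝓘.size := by
  have := (𝓘.len_pos j).ne'
  rw [← Complex.ofReal_mul, ratio]; field_simp

theorem fluxHat_refPoly (F : Flux) (𝓘 : Mesh a b N) (p : Fin N → ℂ[X]) (j : Fin N) :
    fluxHat F 𝓘 (refPoly 𝓘 p) j = hatFlux F 𝓘 p j := by
  simp only [fluxHat_apply, refPoly, derivative_comp_affine, eval_smul, eval_comp_affine_one,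
    eval_comp_affine_zero, smul_eq_mul, hatFlux, average, jump, tracePlus, traceMinus, dx]
  push_cast
  linear_combination (F.β₂ * (derivative (p (j + 1))).eval (𝓘.left (j + 1) : ℂ)) *
    ratio_mul_len 𝓘 (j + 1) - (F.β₂ * (derivative (p j)).eval (𝓘.right j : ℂ)) * ratio_mul_len 𝓘 j

theorem fluxTilde_refPoly (F : Flux) (𝓘 : Mesh a b N) (p : Fin N → ℂ[X]) (j : Fin N) :
    fluxTilde F 𝓘 (refPoly 𝓘 p) j = 𝓘.size * tildeFlux F 𝓘 p j := by
  have hs := 𝓘.size_ne_zero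
  have e : (𝓘.size : ℂ) * ((F.β₁ / 𝓘.size : ℝ) : ℂ) = F.β₁ := by push_cast; field_simp
  simp only [fluxTilde_apply, refPoly, derivative_comp_affine, eval_smul, eval_comp_affine_one,
    eval_comp_affine_zero, smul_eq_mul, tildeFlux, average, jump, tracePlus, traceMinus, dx]
  push_cast at e ⊢
  linear_combination ((1 / 2 + F.α) * (derivative (p (j + 1))).eval (𝓘.left (j + 1) : ℂ)) *
    ratio_mul_len 𝓘 (j + 1) + ((1 / 2 - F.α) * (derivative (p j)).eval (𝓘.right j : ℂ)) *
    ratio_mul_len 𝓘 j - ((p (j + 1)).eval (𝓘.left (j + 1) : ℂ) - (p j).eval (𝓘.right j : ℂ)) * e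

/-- The discretization of the second derivative in the reference variable. -/
def refForm (F : Flux) (𝓘 : Mesh a b N) (j : Fin N) (φ : ℂ[X]) : (Fin N → ℂ[X]) →ₗ[ℂ] ℂ :=
  (𝓘.len j : ℂ)⁻¹ • ((momentPoly (derivative (derivative φ))).comp (LinearMap.proj j)
    - (derivative φ).eval 1 • (LinearMap.proj j).comp (fluxHat F 𝓘)
    + (derivative φ).eval 0 • (LinearMap.proj (j - 1)).comp (fluxHat F 𝓘))
  + (𝓘.size : ℂ)⁻¹ • (φ.eval 1 • (LinearMap.proj j).comp (fluxTilde F 𝓘)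
    - φ.eval 0 • (LinearMap.proj (j - 1)).comp (fluxTilde F 𝓘))

theorem refForm_apply (F : Flux) (𝓘 : Mesh a b N) (j : Fin N) (φ : ℂ[X]) (w : Fin N → ℂ[X]) :
    refForm F 𝓘 j φ w = (𝓘.len j : ℂ)⁻¹ * (moment (polyFun (w j)) (derivative (derivative φ))
      - (derivative φ).eval 1 * fluxHat F 𝓘 w j + (derivative φ).eval 0 * fluxHat F 𝓘 w (j - 1))
      + (𝓘.size : ℂ)⁻¹ * (φ.eval 1 * fluxTilde F 𝓘 w j - φ.eval 0 * fluxTilde F 𝓘 w (j - 1)) := rfl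

/-- The function fluxes multiply a first derivative of the test function, which scales like `1 /
h_j`; the reference derivative flux already contains a factor `h`. This is the origin of the two
prefactors in `refForm`. -/
theorem spatialForm_eq_refForm (F : Flux) (𝓘 : Mesh a b N) (v : Fin N → ℂ[X]) (j : Fin N) (φ : ℂ[X]) :
    spatialForm F 𝓘 v j φ = refForm F 𝓘 j (φ.comp (affine 𝓘 j)) (refPoly 𝓘 v) := by
  have hs := 𝓘.size_ne_zero
  have hl := 𝓘.len_ne_zero j
  rw [spatialForm, refForm_apply, fluxHat_refPoly, fluxHat_refPoly, fluxTilde_refPoly,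
    fluxTilde_refPoly, derivative_comp_affine, derivative_smul, derivative_comp_affine,
    integral_cell_poly, moment_smul_right, moment_smul_right]
  simp only [eval_smul, smul_eq_mul, eval_comp_affine_one, eval_comp_affine_zero]
  rw [show moment (polyFun (refPoly 𝓘 v j)) = moment (polyFun ((v j).comp (affine 𝓘 j))) from rfl]
  field_simp
  ring

theorem IsProjection.refProj {k : ℕ} {F : Flux} {𝓘 : Mesh a b N} {f : ℝ → ℂ} {p : Fin N → ℂ[X]}
    (h : IsProjection k F 𝓘 f p) : RefProj k F 𝓘 f (refPoly 𝓘 p) where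
  natDegree_le j := (natDegree_comp_affine 𝓘 j _).le.trans (h.mem j)
  moment_eq j ψ hψ := by
    have := h.moment j (ψ.comp (affineInv 𝓘 j)) ((natDegree_comp_affineInv 𝓘 j _).le.trans hψ)
    rw [integral_cell_poly, integral_cell_mul, comp_affineInv_comp_affine] at this
    exact mul_left_cancel₀ (𝓘.len_ne_zero j) this
  hat_eq j := by rw [fluxHat_refPoly, h.hat_eq]
  tilde_eq j := by rw [fluxTilde_refPoly, h.tilde_eq]

theorem coeff_comp_eq_sum {k : ℕ} {p : ℂ[X]} (hp : p.natDegree ≤ k) (q : ℂ[X]) (i : ℕ) :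
    (p.comp q).coeff i = ∑ m ∈ Finset.range (k + 1), p.coeff m * (q ^ m).coeff i := by
  rw [comp, eval₂_eq_sum_range' _ (Nat.lt_succ_of_le hp), finsetSum_coeff]
  simp only [coeff_C_mul]

end Reference

section Correction

variable {a b : ℝ} {N : ℕ} [NeZero N] {k : ℕ} (hk : 2 ≤ k) {F : Flux} {𝓘 : Mesh a b N}
  (h : Unisolvent k F 𝓘)

theorem two_le_natDegree_antider₂ {ψ : ℂ[X]} (hψ : ψ ≠ 0) : ¬ (antider₂ ψ).natDegree ≤ 1 := by
  intro hd
  apply hψ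
  rw [← derivative_antider₂ ψ]
  have h1 : (derivative (antider₂ ψ)).natDegree ≤ 0 := (natDegree_derivative_le _).trans (by omega)
  rw [eq_C_of_natDegree_le_zero h1, derivative_C]

/-- The correction functions of the scheme are the correction functions on the reference cell. -/
theorem refPoly_correction {T : ℝ} (hT : 0 < T) {s : ℕ} {u : ℝ → ℝ → ℂ}
    (hv : SmoothFam a b T s (fun t x => u x t)) (hs : 2 * ((k - 1) / 2) + 1 ≤ s)
    {P : ℝ → PiecewisePoly N} {w : ℕ → ℝ → PiecewisePoly N}
    (hP : ∀ t ∈ Icc 0 T, IsProjection k F 𝓘 (fun x => u x t) (P t))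
    (hw : IsCorrection k T F 𝓘 u P w) (q : ℕ) (hq : q ≤ (k - 1) / 2) :
    ∀ t ∈ Icc 0 T, refPoly 𝓘 (if q = 0 then P t else w q t) = corrPoly hk h q (fun x => u x t) := by
  set v : ℝ → ℝ → ℂ := fun t x => u x t with hvdef
  induction q with
  | zero =>
    intro t ht
    exact (hP t ht).refProj.unique h (refProj_solveOp hk h (hv.contDiff t ht).continuous)
  | succ q ih =>
    intro t ht
    have ih' := ih (by omega)
    have hmem : q + 1 ∈ Finset.Icc 1 ((k - 1) / 2) := Finset.mem_Icc.2 ⟨by omega, hq⟩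
    have hval : ∀ r ∈ Icc 0 T, ∀ j ξ, correctionValue u P w q r j (𝓘.left j + 𝓘.len j * ξ) =
        corrFun hk h q (v r) j ξ := by
      intro r hr j ξ
      have e := congrFun (ih' r hr) j
      cases q with
      | zero =>
        change refFun 𝓘 (v r) j ξ - _ = refFun 𝓘 (v r) j ξ - polyFun (corrPoly hk h 0 (v r) j) ξ
        rw [← e]
        congr 1
        exact (eval_comp_affine 𝓘 j _ ξ).symm
      | succ q =>
        rw [corrFun_succ, ← e]
        exact (eval_comp_affine 𝓘 j _ ξ).symm
    -- By induction the preceding correction is `corrFun` of `u(·, t)`, so its time derivative is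
    -- `i` times `corrFun` of `u_xx`. The factor `-i` in the definition of `w_q` cancels this `i`.
    have hder : ∀ j ξ, ξ ∈ Icc (0:ℝ) 1 →
        derivWithin (fun r => correctionValue u P w q r j (𝓘.left j + 𝓘.len j * ξ)) (Icc 0 T) t =
        Complex.I * corrFun hk h q (deriv (deriv (v t))) j ξ := by
      intro j ξ hξ
      have h1 := ((hv.corr hk h q 0 (by omega)).2 j).hasDeriv ξ hξ t ht
      simp only [iteratedDeriv_zero, zero_add] at h1
      rw [derivWithin_congr (fun r hr => hval r hr j ξ) (hval t ht j ξ),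
        h1.derivWithin (uniqueDiffOn_Icc hT t ht), ← deriv_deriv_iteratedDeriv 0, iteratedDeriv_zero]
    refine RefCorr.unique (F := F) h (G := corrFun hk h q (deriv (deriv (v t)))) ⟨?_, ?_, ?_, ?_⟩
      (refCorr_solveOp hk h fun j => continuous_corrFun hk h q ?_ j)
    · intro j
      exact (natDegree_comp_affine 𝓘 j _).le.trans (hw.mem _ hmem t ht j)
    · intro j ψ hψ
      by_cases h0 : ψ = 0
      · simp [h0, moment]
      have hl := 𝓘.len_ne_zero j
      -- The admissible test functions have degree at least 2. The pulled-back double antiderivative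
      -- of `ψ` is one of them unless `ψ = 0`, and these test functions suffice to identify the
      -- correction by uniqueness.
      have hm := hw.moment _ hmem t ht j ((antider₂ ψ).comp (affineInv 𝓘 j))
        (by rw [natDegree_comp_affineInv]; exact (natDegree_antider₂_le hψ).trans (by omega))
        (by rw [natDegree_comp_affineInv]; exact two_le_natDegree_antider₂ h0)
      rw [integral_cell_poly, integral_cell_mul, comp_affineInv_comp_affine] at hm
      have e1 : ψ = (𝓘.len j : ℂ) ^ 2 • (derivative (derivative
          ((antider₂ ψ).comp (affineInv 𝓘 j)))).comp (affine 𝓘 j) := by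
        have := derivative_comp_affine 𝓘 j (derivative ((antider₂ ψ).comp (affineInv 𝓘 j)))
        rw [pow_two, mul_smul, ← this, ← derivative_smul, ← derivative_comp_affine,
          comp_affineInv_comp_affine, derivative_antider₂]
      have e2 : moment (refFun 𝓘 (fun x => derivWithin
          (fun r => correctionValue u P w (q + 1 - 1) r j x) (Icc 0 T) t) j) (antider₂ ψ) =
          Complex.I * moment (corrFun hk h q (deriv (deriv (v t))) j) (antider₂ ψ) := by
        rw [← moment_const_mul_left]
        exact moment_congr (fun ξ hξ => hder j ξ hξ) _
      rw [e2] at hm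
      have hI := Complex.I_mul_I
      have hm' : moment (polyFun ((w (q + 1) t j).comp (affine 𝓘 j))) ((derivative (derivative
          ((antider₂ ψ).comp (affineInv 𝓘 j)))).comp (affine 𝓘 j)) =
          moment (corrFun hk h q (deriv (deriv (v t))) j) (antider₂ ψ) := by
        apply mul_left_cancel₀ hl
        rw [hm]
        linear_combination (-(𝓘.len j : ℂ) *
          moment (corrFun hk h q (deriv (deriv (v t))) j) (antider₂ ψ)) * hI
      rw [← hm', ← moment_smul_right, ← e1]
      simp only [Nat.succ_ne_zero, if_false, refPoly]
    · intro j
      simp only [Nat.succ_ne_zero, if_false]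
      rw [fluxHat_refPoly, hw.hat_eq _ hmem t ht]
    · intro j
      simp only [Nat.succ_ne_zero, if_false]
      rw [fluxTilde_refPoly, hw.tilde_eq _ hmem t ht, mul_zero]
    · rw [show deriv (deriv (v t)) = iteratedDeriv 2 (v t) from (deriv_deriv_iteratedDeriv 0 (v t))]
      exact (hv.contDiff t ht).continuous_iteratedDeriv 2 (by exact_mod_cast (by omega : 2 ≤ s))

end Correction

end UWDG
end

/-! ### The Hermitian form and the energy estimate. -/

noncomputable section
namespace UWDG

section Energy

variable {a b : ℝ} {N : ℕ} [NeZero N]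

theorem moment_eq_sum {k : ℕ} {p ψ : ℂ[X]} (hp : p.natDegree ≤ k) (hψ : ψ.natDegree ≤ k) :
    moment (polyFun p) ψ = ∑ i ∈ Finset.range (k + 1), ∑ m ∈ Finset.range (k + 1),
      p.coeff i * ψ.coeff m * moment (polyFun (X ^ i)) (X ^ m) := by
  have h1 : moment (polyFun p) ψ = ∑ i ∈ Finset.range (k + 1),
      p.coeff i * moment (polyFun (X ^ i)) ψ := by
    change momentPoly ψ p = _
    conv_lhs => rw [p.as_sum_range' (k + 1) (by omega), map_sum]
    refine Finset.sum_congr rfl fun i _ => ?_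
    rw [← C_mul_X_pow_eq_monomial, ← smul_eq_C_mul, map_smul]
    rfl
  rw [h1]
  refine Finset.sum_congr rfl fun i _ => ?_
  have h2 : momentFun (polyFun (X ^ i)) (continuous_polyFun _).continuousOn ψ =
      ∑ m ∈ Finset.range (k + 1), ψ.coeff m * moment (polyFun (X ^ i)) (X ^ m) := by
    conv_lhs => rw [ψ.as_sum_range' (k + 1) (by omega), map_sum]
    refine Finset.sum_congr rfl fun m _ => ?_
    rw [← C_mul_X_pow_eq_monomial, ← smul_eq_C_mul, map_smul]
    rfl
  rw [show moment (polyFun (X ^ i)) ψ = _ from h2, Finset.mul_sum]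
  exact Finset.sum_congr rfl fun m _ => by ring

theorem hasDerivWithinAt_moment_poly {k : ℕ} {s : Set ℝ} {t : ℝ} (ht : t ∈ s) {p ψ : ℝ → ℂ[X]}
    {p' ψ' : ℂ[X]} (hp : ∀ r ∈ s, (p r).natDegree ≤ k) (hψ : ∀ r ∈ s, (ψ r).natDegree ≤ k)
    (hp' : p'.natDegree ≤ k) (hψ' : ψ'.natDegree ≤ k)
    (hdp : ∀ i, HasDerivWithinAt (fun r => (p r).coeff i) (p'.coeff i) s t)
    (hdψ : ∀ i, HasDerivWithinAt (fun r => (ψ r).coeff i) (ψ'.coeff i) s t) :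
    HasDerivWithinAt (fun r => moment (polyFun (p r)) (ψ r))
      (moment (polyFun p') (ψ t) + moment (polyFun (p t)) ψ') s t := by
  rw [moment_eq_sum hp' (hψ t ht), moment_eq_sum (hp t ht) hψ', ← Finset.sum_add_distrib]
  simp only [← Finset.sum_add_distrib, ← add_mul]
  have : HasDerivWithinAt (fun r => ∑ i ∈ Finset.range (k + 1), ∑ m ∈ Finset.range (k + 1),
      (p r).coeff i * (ψ r).coeff m * moment (polyFun (X ^ i)) (X ^ m))
      (∑ i ∈ Finset.range (k + 1), ∑ m ∈ Finset.range (k + 1),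
        (p'.coeff i * (ψ t).coeff m + (p t).coeff i * ψ'.coeff m) *
          moment (polyFun (X ^ i)) (X ^ m)) s t :=
    HasDerivWithinAt.fun_sum fun i _ => HasDerivWithinAt.fun_sum fun m _ =>
      ((hdp i).mul (hdψ m)).mul_const _
  exact this.congr_of_mem (fun r hr => moment_eq_sum (hp r hr) (hψ r hr)) ht

theorem coeff_conjPoly (p : ℂ[X]) (i : ℕ) : (conjPoly p).coeff i = starRingEnd ℂ (p.coeff i) := by
  simp [conjPoly]

theorem moment_conj_symm (p q : ℂ[X]) :
    moment (polyFun p) (conjPoly q) = starRingEnd ℂ (moment (polyFun q) (conjPoly p)) := by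
  simp only [moment, polyFun, conjPoly_eval, intervalIntegral.integral_of_le zero_le_one]
  rw [← integral_conj]
  simp [mul_comm]

/-- The contribution of an interface to the discrete energy is real. -/
theorem im_interface_eq_zero (m m' p p' : ℂ) (α β₁ β₂ : ℝ) :
    (m * starRingEnd ℂ m' - p * starRingEnd ℂ p'
      + ((1 / 2 + α : ℝ) * m - β₂ * m' + (1 / 2 - α : ℝ) * p + β₂ * p')
        * (starRingEnd ℂ p' - starRingEnd ℂ m')
      + (-(β₁ : ℂ) * m + (1 / 2 - α : ℝ) * m' + β₁ * p + (1 / 2 + α : ℝ) * p')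
        * (starRingEnd ℂ m - starRingEnd ℂ p)).im = 0 := by
  simp only [Complex.add_im, Complex.sub_im, Complex.mul_im, Complex.mul_re, Complex.add_re,
    Complex.sub_re, Complex.conj_re, Complex.conj_im, Complex.ofReal_re, Complex.ofReal_im,
    Complex.neg_re, Complex.neg_im]
  ring

/-- The discretization of the second derivative is real on the diagonal. -/
theorem im_sum_refForm (F : Flux) (𝓘 : Mesh a b N) (z : Fin N → ℂ[X]) :
    (∑ j, refForm F 𝓘 j (conjPoly (z j)) z).im = 0 := by
  have hibp : ∀ j, moment (polyFun (z j)) (derivative (derivative (conjPoly (z j)))) =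
      (z j).eval 1 * (conjPoly (derivative (z j))).eval 1
        - (z j).eval 0 * (conjPoly (derivative (z j))).eval 0
        - moment (polyFun (derivative (z j))) (conjPoly (derivative (z j))) := by
    intro j
    rw [derivative_conjPoly, moment_derivative (fun ξ _ => hasDerivAt_polyFun (z j) ξ)
      (continuous_polyFun (derivative (z j))).continuousOn]
    simp only [polyFun, Complex.ofReal_one, Complex.ofReal_zero]
    rfl
  have c1 : ∀ p : ℂ[X], (conjPoly p).eval 1 = starRingEnd ℂ (p.eval 1) := fun p => by
    simpa using conjPoly_eval p 1
  have c0 : ∀ p : ℂ[X], (conjPoly p).eval 0 = starRingEnd ℂ (p.eval 0) := fun p => by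
    simpa using conjPoly_eval p 0
  set L := fun j => (𝓘.len j : ℂ)⁻¹ with hL
  set S := (𝓘.size : ℂ)⁻¹ with hS
  set H := fluxHat F 𝓘 z
  set Q := fluxTilde F 𝓘 z
  let A : Fin N → ℂ := fun j => L j * ((z j).eval 1 * starRingEnd ℂ ((derivative (z j)).eval 1)
    - starRingEnd ℂ ((derivative (z j)).eval 1) * H j) + S * (starRingEnd ℂ ((z j).eval 1) * Q j)
  let B : Fin N → ℂ := fun j => L (j + 1) * (- ((z (j + 1)).eval 0 *
    starRingEnd ℂ ((derivative (z (j + 1))).eval 0))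
    + starRingEnd ℂ ((derivative (z (j + 1))).eval 0) * H j)
    - S * (starRingEnd ℂ ((z (j + 1)).eval 0) * Q j)
  let R : Fin N → ℂ := fun j => L j *
    moment (polyFun (derivative (z j))) (conjPoly (derivative (z j)))
  have e1 : ∀ j, refForm F 𝓘 j (conjPoly (z j)) z = A j + B (j - 1) - R j := by
    intro j
    simp only [A, B, R, sub_add_cancel]
    rw [refForm_apply, hibp, derivative_conjPoly, c1, c0, c1, c0]
    ring
  -- Reindexing the left end contributions by the cyclic shift collects the terms by interface: `A
  -- j` comes from the left cell and `B j` from the right cell of the interface `j`.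
  have e2 : ∑ j, refForm F 𝓘 j (conjPoly (z j)) z = ∑ j, ((A j + B j) - R j) := by
    simp only [e1, Finset.sum_sub_distrib, Finset.sum_add_distrib]
    congr 2
    exact Fintype.sum_equiv (Equiv.subRight 1) _ _ fun j => rfl
  rw [e2, Complex.im_sum]
  refine Finset.sum_eq_zero fun j _ => ?_
  have hR : (R j).im = 0 := by
    simp only [R, hL, moment_conjPoly, ← Complex.ofReal_inv, ← Complex.ofReal_mul, Complex.ofReal_im]
  rw [Complex.sub_im, hR, sub_zero]
  have hs := 𝓘.size_ne_zero
  have hl := fun j => 𝓘.len_ne_zero j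
  -- The reference derivatives divided by the cell lengths are the physical ones, so the interface
  -- identity is applied with the physical parameters `β₁ / h` and `β₂ h`.
  have hi := im_interface_eq_zero ((z j).eval 1) (L j * (derivative (z j)).eval 1)
    ((z (j + 1)).eval 0) (L (j + 1) * (derivative (z (j + 1))).eval 0) F.α (F.β₁ / 𝓘.size)
    (F.β₂ * 𝓘.size)
  rw [← hi]
  congr 1
  have hr : ∀ j, (ratio 𝓘 j : ℂ) = 𝓘.size * L j := fun j => by
    have := ratio_mul_len 𝓘 j
    rw [← this, hL]
    field_simp [hl j]
  have hLc : ∀ j, starRingEnd ℂ (L j) = L j := fun j => by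
    simp only [hL, map_inv₀, Complex.conj_ofReal]
  have hHj : H j = _ := fluxHat_apply F 𝓘 z j
  have hQj : Q j = _ := fluxTilde_apply F 𝓘 z j
  have hβ : (F.β₁ : ℂ) / 𝓘.size = F.β₁ * S := div_eq_mul_inv _ _
  have hSs : S * 𝓘.size = 1 := inv_mul_cancel₀ hs
  simp only [A, B, hHj, hQj, map_mul, hLc]
  push_cast
  rw [hr j, hr (j + 1), hβ]
  linear_combination ((starRingEnd ℂ (eval 1 (z j)) - starRingEnd ℂ (eval 0 (z (j + 1)))) *
    ((1 / 2 - F.α) * L j * eval 1 (derivative (z j)) +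
      (1 / 2 + F.α) * L (j + 1) * eval 0 (derivative (z (j + 1))))) * hSs

theorem continuousOn_moment_poly {k : ℕ} {s : Set ℝ} {p ψ : ℝ → ℂ[X]}
    (hp : ∀ r ∈ s, (p r).natDegree ≤ k) (hψ : ∀ r ∈ s, (ψ r).natDegree ≤ k)
    (hcp : ∀ i, ContinuousOn (fun r => (p r).coeff i) s)
    (hcψ : ∀ i, ContinuousOn (fun r => (ψ r).coeff i) s) :
    ContinuousOn (fun r => moment (polyFun (p r)) (ψ r)) s := by
  have : ContinuousOn (fun r => ∑ i ∈ Finset.range (k + 1), ∑ m ∈ Finset.range (k + 1),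
      (p r).coeff i * (ψ r).coeff m * moment (polyFun (X ^ i)) (X ^ m)) s :=
    continuousOn_finsetSum _ fun i _ => continuousOn_finsetSum _ fun m _ =>
      ((hcp i).mul (hcψ m)).mul continuousOn_const
  exact this.congr fun r hr => moment_eq_sum (hp r hr) (hψ r hr)

/-- The square of the `L²` norm of a piecewise polynomial. -/
def energy (𝓘 : Mesh a b N) (z : Fin N → ℂ[X]) : ℝ :=
  ∑ j, 𝓘.len j * ∫ ξ in (0:ℝ)..1, ‖(z j).eval (ξ : ℂ)‖ ^ 2

theorem energy_eq (𝓘 : Mesh a b N) (z : Fin N → ℂ[X]) :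
    energy 𝓘 z = ∑ j, 𝓘.len j * (moment (polyFun (z j)) (conjPoly (z j))).re := by
  simp only [energy, moment_conjPoly, Complex.ofReal_re]

/-- Young's inequality with a free weight `τ`. The energy estimate takes `τ = T`, which makes the
growth factor over `[0, T]` equal to `e`. -/
theorem two_re_moment_conjPoly_le {g : ℝ → ℂ} {ε τ : ℝ} (hτ : 0 < τ)
    (hε : ∀ ξ ∈ Icc (0:ℝ) 1, ‖g ξ‖ ≤ ε) (p : ℂ[X]) :
    2 * (moment g (conjPoly p)).re ≤ τ * ε ^ 2 + τ⁻¹ * ∫ ξ in (0:ℝ)..1, ‖p.eval (ξ : ℂ)‖ ^ 2 := by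
  have hpc : Continuous fun ξ : ℝ => ‖p.eval (ξ : ℂ)‖ := (continuous_polyFun p).norm
  have h1 : ‖moment g (conjPoly p)‖ ≤
      ∫ ξ in (0:ℝ)..1, (τ * ε ^ 2 + τ⁻¹ * ‖p.eval (ξ : ℂ)‖ ^ 2) / 2 := by
    refine intervalIntegral.norm_integral_le_of_norm_le zero_le_one ?_
      (by apply Continuous.intervalIntegrable; fun_prop)
    refine Filter.Eventually.of_forall fun ξ hξ => ?_
    rw [norm_mul, conjPoly_eval, RCLike.norm_conj]
    have hgξ := hε ξ ⟨hξ.1.le, hξ.2⟩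
    have hp0 := norm_nonneg (p.eval (ξ : ℂ))
    set x := ‖p.eval (ξ : ℂ)‖
    have h2 : ‖g ξ‖ * x ≤ ε * x := by gcongr
    have h3 : 0 ≤ τ⁻¹ * (τ * ε - x) ^ 2 := by positivity
    have h4 : τ⁻¹ * (τ * ε - x) ^ 2 = τ * ε ^ 2 + τ⁻¹ * x ^ 2 - 2 * (ε * x) := by
      field_simp
      ring
    linarith
  have h2 : ∫ ξ in (0:ℝ)..1, (τ * ε ^ 2 + τ⁻¹ * ‖p.eval (ξ : ℂ)‖ ^ 2) / 2 =
      (τ * ε ^ 2 + τ⁻¹ * ∫ ξ in (0:ℝ)..1, ‖p.eval (ξ : ℂ)‖ ^ 2) / 2 := by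
    rw [intervalIntegral.integral_div, intervalIntegral.integral_add (by simp)
      (by apply Continuous.intervalIntegrable; fun_prop), intervalIntegral.integral_const_mul]
    simp
  have h3 := Complex.re_le_norm (moment g (conjPoly p))
  linarith

/-- The energy estimate for the scheme with a right-hand side. -/
theorem energy_le (F : Flux) (𝓘 : Mesh a b N) {k : ℕ} {T ε : ℝ} (hT : 0 < T)
    {z z' : ℝ → Fin N → ℂ[X]} {g : ℝ → Fin N → ℝ → ℂ}
    (hz : ∀ t ∈ Icc 0 T, ∀ j, (z t j).natDegree ≤ k)
    (hz' : ∀ t ∈ Ioc 0 T, ∀ j, (z' t j).natDegree ≤ k)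
    (hc : ∀ j i, ContinuousOn (fun t => (z t j).coeff i) (Icc 0 T))
    (hd : ∀ t ∈ Ioc 0 T, ∀ j i,
      HasDerivWithinAt (fun t => (z t j).coeff i) ((z' t j).coeff i) (Icc 0 T) t)
    (hε : ∀ t ∈ Ioc 0 T, ∀ j, ∀ ξ ∈ Icc (0:ℝ) 1, ‖g t j ξ‖ ≤ ε)
    (heq : ∀ t ∈ Ioc 0 T, ∀ j, ∀ φ : ℂ[X], φ.natDegree ≤ k →
      𝓘.len j * moment (polyFun (z' t j)) φ =
        Complex.I * refForm F 𝓘 j φ (z t) + 𝓘.len j * moment (g t j) φ)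
    {t : ℝ} (ht : t ∈ Icc 0 T) :
    energy 𝓘 (z t) ≤ Real.exp 1 * (energy 𝓘 (z 0) + T ^ 2 * ε ^ 2 * (b - a)) := by
  set A := T ^ 2 * ε ^ 2 * (b - a) with hA
  have hba : 0 ≤ b - a := by
    rw [← 𝓘.sum_len]; exact Finset.sum_nonneg fun j _ => (𝓘.len_pos j).le
  have hA0 : 0 ≤ A := by positivity
  have hcc : ∀ j i, ContinuousOn (fun t => (conjPoly (z t j)).coeff i) (Icc 0 T) := fun j i => by
    simp only [coeff_conjPoly]
    exact Complex.continuous_conj.comp_continuousOn (hc j i)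
  have hEc : ContinuousOn (fun t => energy 𝓘 (z t)) (Icc 0 T) := by
    simp only [energy_eq]
    refine continuousOn_finsetSum _ fun j _ => continuousOn_const.mul
      (Complex.continuous_re.comp_continuousOn (continuousOn_moment_poly (k := k)
        (fun t ht => hz t ht j) (fun t ht => ?_) (hc j) (hcc j)))
    rw [natDegree_conjPoly]; exact hz t ht j
  have hEd : ∀ t ∈ Ioc 0 T, HasDerivWithinAt (fun t => energy 𝓘 (z t))
      (∑ j, 𝓘.len j * (2 * (moment (polyFun (z' t j)) (conjPoly (z t j))).re)) (Icc 0 T) t := by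
    intro t ht
    simp only [energy_eq]
    refine HasDerivWithinAt.fun_sum fun j _ => HasDerivWithinAt.const_mul _ ?_
    have h1 := hasDerivWithinAt_moment_poly (k := k) (s := Icc 0 T) (t := t) ⟨ht.1.le, ht.2⟩
      (p := fun t => z t j) (ψ := fun t => conjPoly (z t j)) (p' := z' t j)
      (ψ' := conjPoly (z' t j)) (fun r hr => hz r hr j)
      (fun r hr => by rw [natDegree_conjPoly]; exact hz r hr j) (hz' t ht j)
      (by rw [natDegree_conjPoly]; exact hz' t ht j) (hd t ht j)
      (fun i => by
        simp only [coeff_conjPoly]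
        exact (Complex.conjCLE.toContinuousLinearMap.hasFDerivAt.comp_hasDerivWithinAt t
          (hd t ht j i)))
    have h2 := Complex.reCLM.hasFDerivAt.comp_hasDerivWithinAt t h1
    refine h2.congr_deriv ?_
    rw [moment_conj_symm (z t j) (z' t j)]
    simp only [Complex.reCLM_apply, Complex.add_re, Complex.conj_re]
    ring
  -- The form contributes only the imaginary part of its sum, which vanishes; the growth of the
  -- energy comes from `g` alone.
  have hE' : ∀ t ∈ Ioc 0 T, ∑ j, 𝓘.len j * (2 * (moment (polyFun (z' t j)) (conjPoly (z t j))).re) ≤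
      T⁻¹ * (energy 𝓘 (z t) + A) := by
    intro t ht
    have htI : t ∈ Icc 0 T := ⟨ht.1.le, ht.2⟩
    have h1 : ∀ j, 𝓘.len j * (2 * (moment (polyFun (z' t j)) (conjPoly (z t j))).re) =
        -2 * (refForm F 𝓘 j (conjPoly (z t j)) (z t)).im +
        𝓘.len j * (2 * (moment (g t j) (conjPoly (z t j))).re) := by
      intro j
      have := congrArg Complex.re (heq t ht j (conjPoly (z t j))
        (by rw [natDegree_conjPoly]; exact hz t htI j))
      rw [Complex.add_re, Complex.re_ofReal_mul, Complex.re_ofReal_mul, Complex.I_mul_re] at this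
      linarith
    have h2 := im_sum_refForm F 𝓘 (z t)
    rw [Complex.im_sum] at h2
    rw [Finset.sum_congr rfl fun j _ => h1 j, Finset.sum_add_distrib, ← Finset.mul_sum, h2, mul_zero,
      zero_add]
    calc ∑ j, 𝓘.len j * (2 * (moment (g t j) (conjPoly (z t j))).re)
        ≤ ∑ j, 𝓘.len j * (T * ε ^ 2 + T⁻¹ * ∫ ξ in (0:ℝ)..1, ‖(z t j).eval (ξ : ℂ)‖ ^ 2) :=
          Finset.sum_le_sum fun j _ => mul_le_mul_of_nonneg_left
            (two_re_moment_conjPoly_le hT (hε t ht j) _) (𝓘.len_pos j).le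
      _ = T⁻¹ * (energy 𝓘 (z t) + A) := by
          rw [energy, hA, ← 𝓘.sum_len, Finset.mul_sum, ← Finset.sum_add_distrib, Finset.mul_sum]
          refine Finset.sum_congr rfl fun j _ => ?_
          field_simp
          ring
  -- Gronwall with rate `1 / T`: the damped energy does not increase. Its derivative is needed only
  -- in the open interval, continuity covers `t = 0`.
  have hanti : AntitoneOn (fun t => Real.exp (-(T⁻¹ * t)) * (energy 𝓘 (z t) + A)) (Icc 0 T) := by
    refine antitoneOn_of_hasDerivWithinAt_nonpos (convex_Icc 0 T)
      (f' := fun t => Real.exp (-(T⁻¹ * t)) * (-(T⁻¹ * 1)) * (energy 𝓘 (z t) + A) +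
        Real.exp (-(T⁻¹ * t)) *
          ∑ j, 𝓘.len j * (2 * (moment (polyFun (z' t j)) (conjPoly (z t j))).re)) ?_ ?_ ?_
    · exact (by fun_prop : Continuous fun t : ℝ => Real.exp (-(T⁻¹ * t))).continuousOn.mul
        (hEc.add continuousOn_const)
    · intro t ht
      rw [interior_Icc] at ht ⊢
      have e1 := (((hasDerivAt_id t).const_mul T⁻¹).neg.exp).hasDerivWithinAt (s := Ioo 0 T)
      have e2 := ((hEd t ⟨ht.1, ht.2.le⟩).mono Ioo_subset_Icc_self).add_const A
      exact e1.mul e2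
    · intro t ht
      rw [interior_Icc] at ht
      have e1 := hE' t ⟨ht.1, ht.2.le⟩
      have e2 := Real.exp_pos (-(T⁻¹ * t))
      nlinarith [mul_le_mul_of_nonneg_left e1 e2.le]
  have h0 : (0:ℝ) ∈ Icc 0 T := ⟨le_rfl, hT.le⟩
  have h1 := hanti h0 ht ht.1
  simp only [mul_zero, neg_zero, Real.exp_zero, one_mul] at h1
  have hE0 : 0 ≤ energy 𝓘 (z t) + A := by
    refine add_nonneg (Finset.sum_nonneg fun j _ => mul_nonneg (𝓘.len_pos j).le ?_) hA0
    exact intervalIntegral.integral_nonneg zero_le_one fun _ _ => by positivity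
  have h2 : Real.exp (-1) ≤ Real.exp (-(T⁻¹ * t)) := by
    apply Real.exp_le_exp.2
    have : T⁻¹ * t ≤ 1 := by rw [inv_mul_le_iff₀ hT]; linarith [ht.2]
    linarith
  have h3 : Real.exp (-1) * (energy 𝓘 (z t) + A) ≤ energy 𝓘 (z 0) + A :=
    (mul_le_mul_of_nonneg_right h2 hE0).trans h1
  have h4 : Real.exp 1 * Real.exp (-1) = 1 := by rw [← Real.exp_add]; simp
  calc energy 𝓘 (z t) ≤ energy 𝓘 (z t) + A := by linarith
    _ = Real.exp 1 * (Real.exp (-1) * (energy 𝓘 (z t) + A)) := by rw [← mul_assoc, h4, one_mul]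
    _ ≤ _ := mul_le_mul_of_nonneg_left h3 (Real.exp_pos 1).le

end Energy

end UWDG
end

/-! ### The semi-discrete scheme in reference variables. -/

noncomputable section
namespace UWDG

section Scheme

variable {a b : ℝ} {N : ℕ} [NeZero N]

/-- The scheme in the reference variable. -/
theorem IsSemiDiscreteSolution.exists_refPoly_deriv {k : ℕ} {T : ℝ} (hT : 0 < T) {F : Flux}
    {𝓘 : Mesh a b N} {uh : ℝ → PiecewisePoly N} (h : IsSemiDiscreteSolution k T F 𝓘 uh) :
    ∃ y' : ℝ → Fin N → ℂ[X], (∀ t ∈ Ioc 0 T, ∀ j, (y' t j).natDegree ≤ k) ∧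
      (∀ t ∈ Ioc 0 T, ∀ j i, HasDerivWithinAt (fun t => (refPoly 𝓘 (uh t) j).coeff i)
        ((y' t j).coeff i) (Icc 0 T) t) ∧
      ∀ t ∈ Ioc 0 T, ∀ j, ∀ φ : ℂ[X], φ.natDegree ≤ k →
        𝓘.len j * moment (polyFun (y' t j)) φ = Complex.I * refForm F 𝓘 j φ (refPoly 𝓘 (uh t)) := by
  let U : ℝ → Fin N → ℂ[X] := fun t j => ∑ m ∈ Finset.range (k + 1),
    monomial m (derivWithin (fun s => (uh s j).coeff m) (Icc 0 T) t)
  have hUd : ∀ t j, (U t j).natDegree ≤ k := fun t j => by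
    refine natDegree_sum_le_of_forall_le _ _ fun m hm => (natDegree_monomial_le _).trans ?_
    have := Finset.mem_range.1 hm
    omega
  have hUc : ∀ t j m, m ∈ Finset.range (k + 1) → (U t j).coeff m =
      derivWithin (fun s => (uh s j).coeff m) (Icc 0 T) t := fun t j m hm => by
    simp only [U, finsetSum_coeff, coeff_monomial]
    rw [Finset.sum_ite_eq' _ m, if_pos hm]
  refine ⟨fun t => refPoly 𝓘 (U t), fun t ht j => (natDegree_comp_affine 𝓘 j _).le.trans (hUd t j),
    fun t ht j i => ?_, fun t ht j φ hφ => ?_⟩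
  · have ht' : t ∈ Icc 0 T := ⟨ht.1.le, ht.2⟩
    simp only [refPoly]
    rw [coeff_comp_eq_sum (hUd t j)]
    have : HasDerivWithinAt (fun t => ∑ m ∈ Finset.range (k + 1),
        (uh t j).coeff m * ((affine 𝓘 j) ^ m).coeff i) (∑ m ∈ Finset.range (k + 1),
        (U t j).coeff m * ((affine 𝓘 j) ^ m).coeff i) (Icc 0 T) t :=
      HasDerivWithinAt.fun_sum fun m hm => by
        rw [hUc t j m hm]
        exact (h.differentiable t ht j m).hasDerivWithinAt.mul_const _
    exact this.congr_of_mem (fun r hr => coeff_comp_eq_sum (h.mem r hr j) _ _) ht'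
  · have ht' : t ∈ Icc 0 T := ⟨ht.1.le, ht.2⟩
    have hder : ∀ x : ℝ, derivWithin (fun s => (uh s j).eval (x : ℂ)) (Icc 0 T) t =
        (U t j).eval (x : ℂ) := by
      intro x
      rw [eval_eq_sum_range' (Nat.lt_succ_of_le (hUd t j))]
      have : HasDerivWithinAt (fun t => ∑ m ∈ Finset.range (k + 1),
          (uh t j).coeff m * (x : ℂ) ^ m) (∑ m ∈ Finset.range (k + 1),
          (U t j).coeff m * (x : ℂ) ^ m) (Icc 0 T) t :=
        HasDerivWithinAt.fun_sum fun m hm => by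
          rw [hUc t j m hm]
          exact (h.differentiable t ht j m).hasDerivWithinAt.mul_const _
      exact (this.congr_of_mem (fun r hr => eval_eq_sum_range' (Nat.lt_succ_of_le (h.mem r hr j)) _)
        ht').derivWithin (uniqueDiffOn_Icc hT t ht')
    have hs := h.scheme t ht j (φ.comp (affineInv 𝓘 j))
      ((natDegree_comp_affineInv 𝓘 j φ).le.trans hφ)
    simp only [hder] at hs
    rw [integral_cell_poly, spatialForm_eq_refForm, comp_affineInv_comp_affine, sub_eq_zero] at hs
    exact hs

theorem IsSemiDiscreteSolution.continuousOn_refPoly {k : ℕ} {T : ℝ} {F : Flux}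
    {𝓘 : Mesh a b N} {uh : ℝ → PiecewisePoly N} (h : IsSemiDiscreteSolution k T F 𝓘 uh) (j : Fin N)
    (i : ℕ) : ContinuousOn (fun t => (refPoly 𝓘 (uh t) j).coeff i) (Icc 0 T) := by
  have : ContinuousOn (fun t => ∑ m ∈ Finset.range (k + 1),
      (uh t j).coeff m * ((affine 𝓘 j) ^ m).coeff i) (Icc 0 T) :=
    continuousOn_finsetSum _ fun m _ => (h.continuousOn j m).mul continuousOn_const
  exact this.congr fun r hr => coeff_comp_eq_sum (h.mem r hr j) _ _

end Scheme

/-! ### Consistency and the defect of the interpolant. -/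

section Interpolant

variable {a b : ℝ} {N : ℕ} [NeZero N] {k : ℕ} (hk : 2 ≤ k) {F : Flux} {𝓘 : Mesh a b N}
  (h : Unisolvent k F 𝓘)

theorem natDegree_corrPoly (q : ℕ) (f : ℝ → ℂ) (j : Fin N) :
    (corrPoly hk h q f j).natDegree ≤ k := by
  cases q <;> exact natDegree_solveOp hk h _ j

/-- The correction functions are orthogonal to polynomials of low degree. -/
theorem moment_corrFun_eq_zero (q : ℕ) {f : ℝ → ℂ} (hf : ContDiff ℝ (2 * q : ℕ) f) (j : Fin N)
    {φ : ℂ[X]} (hφ : φ.natDegree + 2 * q + 2 ≤ k) : moment (corrFun hk h q f j) φ = 0 := by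
  induction q generalizing f φ with
  | zero =>
    have hp := refProj_solveOp hk h (𝓘 := 𝓘) (F := F) hf.continuous
    change moment (fun ξ => refFun 𝓘 f j ξ - polyFun _ ξ) φ = 0
    rw [moment_sub_left (continuous_refFun 𝓘 hf.continuous j).continuousOn
      (continuous_polyFun _).continuousOn, hp.moment_eq j φ (by omega), sub_self]
  | succ q ih =>
    have hf2 := contDiff_deriv (contDiff_deriv (n := 2 * q + 1) (contDiff_of_le (by omega) hf))
    have hc := refCorr_solveOp hk h (𝓘 := 𝓘) (F := F)
      (fun j => continuous_corrFun hk h q hf2.continuous j)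
    have := hc.moment_eq j φ (by omega)
    rw [ih hf2 (by have := natDegree_antider₂_le (le_refl φ.natDegree); omega), mul_zero] at this
    exact this

theorem natDegree_le_one_of_derivative_derivative {r : ℂ[X]} (hr : derivative (derivative r) = 0) :
    r.natDegree ≤ 1 := by
  rw [natDegree_le_iff_coeff_eq_zero]
  intro n hn
  obtain ⟨n, rfl⟩ : ∃ m, n = m + 2 := ⟨n - 2, by omega⟩
  have := congrArg (fun p => p.coeff n) hr
  simp only [coeff_derivative, coeff_zero] at this
  have h1 : ((n : ℂ) + 1) ≠ 0 := by exact_mod_cast Nat.succ_ne_zero n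
  have h2 : (((n + 1 : ℕ) : ℂ) + 1) ≠ 0 := by exact_mod_cast Nat.succ_ne_zero (n + 1)
  exact (mul_eq_zero.1 ((mul_eq_zero.1 this).resolve_right h1)).resolve_right h2

/-- Consistency of the projection. As `φ''` has degree at most `k - 2`, the volume term sees `f`
itself; integrating by parts twice produces boundary terms that the exact fluxes cancel. -/
theorem refForm_corrPoly_zero {f : ℝ → ℂ} (hf : ContDiff ℝ 2 f) (hp : Function.Periodic f (b - a))
    (j : Fin N) {φ : ℂ[X]} (hφ : φ.natDegree ≤ k) :
    refForm F 𝓘 j φ (corrPoly hk h 0 f) = 𝓘.len j * moment (refFun 𝓘 (deriv (deriv f)) j) φ := by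
  have hf1 : ContDiff ℝ 1 (deriv f) := contDiff_deriv (n := 1) (by exact_mod_cast hf)
  have hf2 : ContDiff ℝ 0 (deriv (deriv f)) := contDiff_deriv (n := 0) (by exact_mod_cast hf1)
  have hd := differentiable_of_contDiff (n := 1) (by exact_mod_cast hf)
  have hd1 := differentiable_of_contDiff (n := 0) (by exact_mod_cast hf1)
  have hP := refProj_solveOp hk h (𝓘 := 𝓘) (F := F) hf.continuous
  have hl := 𝓘.len_ne_zero j
  have hs := 𝓘.size_ne_zero
  have hleft : ∀ g : ℝ → ℂ, Function.Periodic g (b - a) → g (𝓘.right (j - 1)) = g (𝓘.left j) := by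
    intro g hg
    have := 𝓘.periodic_left_add_one hg (j - 1) 0
    rw [sub_add_cancel, add_zero, add_zero] at this
    exact this.symm
  have r1 : ∀ g : ℝ → ℂ, refFun 𝓘 g j 1 = g (𝓘.right j) := fun g => by
    rw [refFun, mul_one, ← 𝓘.right_eq]
  have r0 : ∀ g : ℝ → ℂ, refFun 𝓘 g j 0 = g (𝓘.left j) := fun g => by
    rw [refFun, mul_zero, add_zero]
  have i1 := moment_derivative (fun ξ _ => hasDerivAt_refFun 𝓘 hd j ξ)
    (continuousOn_const.mul (continuous_refFun 𝓘 hf1.continuous j).continuousOn) (derivative φ)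
  have i2 := moment_derivative (fun ξ _ => hasDerivAt_refFun 𝓘 hd1 j ξ)
    (continuousOn_const.mul (continuous_refFun 𝓘 hf2.continuous j).continuousOn) φ
  rw [moment_const_mul_left, r1, r0] at i1 i2
  have hm := hP.moment_eq j (derivative (derivative φ))
    ((natDegree_derivative_le _).trans (by have := natDegree_derivative_le φ; omega))
  have e1 : moment (polyFun (corrPoly hk h 0 f j)) (derivative (derivative φ)) = _ := hm.trans i1
  have e2 : fluxHat F 𝓘 (corrPoly hk h 0 f) = fun j => f (𝓘.right j) := funext hP.hat_eq
  have e3 : fluxTilde F 𝓘 (corrPoly hk h 0 f) = fun j => 𝓘.size * deriv f (𝓘.right j) :=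
    funext hP.tilde_eq
  rw [refForm_apply, e1, e2, e3, i2]
  simp only []
  rw [hleft f hp, hleft _ (periodic_deriv hp)]
  field_simp
  ring

/-- The correction is defined through test functions of the form `antider₂ ψ`. A general `φ` differs
from `antider₂ φ''` by a linear polynomial, to which the preceding correction is orthogonal as long
as `2 * q + 3 ≤ k`. -/
theorem refForm_corrPoly_succ (q : ℕ) (hq : 2 * q + 3 ≤ k) {f : ℝ → ℂ}
    (hf : ContDiff ℝ (2 * (q + 1) : ℕ) f) (j : Fin N) {φ : ℂ[X]} (hφ : φ.natDegree ≤ k) :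
    refForm F 𝓘 j φ (corrPoly hk h (q + 1) f) =
      𝓘.len j * moment (corrFun hk h q (deriv (deriv f)) j) φ := by
  have hf2 := contDiff_deriv (contDiff_deriv (n := 2 * q + 1) (contDiff_of_le (by omega) hf))
  have hc := refCorr_solveOp hk h (𝓘 := 𝓘) (F := F)
    (fun j => continuous_corrFun hk h q hf2.continuous j)
  have hl := 𝓘.len_ne_zero j
  have e1 : moment (polyFun (corrPoly hk h (q + 1) f j)) (derivative (derivative φ)) = _ :=
    hc.moment_eq j (derivative (derivative φ))
      ((natDegree_derivative_le _).trans (by have := natDegree_derivative_le φ; omega))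
  have e2 : fluxHat F 𝓘 (corrPoly hk h (q + 1) f) = fun j => 0 := funext hc.hat_eq
  have e3 : fluxTilde F 𝓘 (corrPoly hk h (q + 1) f) = fun j => 0 := funext hc.tilde_eq
  have horth : moment (corrFun hk h q (deriv (deriv f)) j)
      (φ - antider₂ (derivative (derivative φ))) = 0 := by
    refine moment_corrFun_eq_zero hk h q hf2 j ?_
    have := natDegree_le_one_of_derivative_derivative
      (r := φ - antider₂ (derivative (derivative φ)))
      (by rw [derivative_sub, derivative_sub, derivative_antider₂, sub_self])
    omega
  have e4 := moment_add_right (continuous_corrFun hk h q hf2.continuous j).continuousOn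
    (φ - antider₂ (derivative (derivative φ))) (antider₂ (derivative (derivative φ)))
  rw [sub_add_cancel, horth, zero_add] at e4
  rw [refForm_apply, e1, e2, e3, e4]
  field_simp
  ring

/-- The interpolant on the reference cell with `Q` correction terms. -/
def interpPoly (Q : ℕ) (f : ℝ → ℂ) : Fin N → ℂ[X] :=
  corrPoly hk h 0 f - ∑ q ∈ Finset.Icc 1 Q, corrPoly hk h q f

theorem interpPoly_zero (f : ℝ → ℂ) : interpPoly hk h 0 f = corrPoly hk h 0 f := by
  simp [interpPoly]

theorem interpPoly_succ (Q : ℕ) (f : ℝ → ℂ) :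
    interpPoly hk h (Q + 1) f = interpPoly hk h Q f - corrPoly hk h (Q + 1) f := by
  rw [interpPoly, interpPoly, Finset.sum_Icc_succ_top (by omega), sub_sub]

theorem natDegree_interpPoly (Q : ℕ) (f : ℝ → ℂ) (j : Fin N) :
    (interpPoly hk h Q f j).natDegree ≤ k := by
  induction Q with
  | zero => rw [interpPoly_zero]; exact natDegree_corrPoly hk h 0 f j
  | succ Q ih =>
    rw [interpPoly_succ]
    exact (natDegree_sub_le _ _).trans (max_le ih (natDegree_corrPoly hk h _ f j))

theorem flux_interpPoly (Q : ℕ) {f : ℝ → ℂ} (hf : ContDiff ℝ (2 * Q : ℕ) f) (j : Fin N) :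
    fluxHat F 𝓘 (interpPoly hk h Q f) j = f (𝓘.right j) ∧
    fluxTilde F 𝓘 (interpPoly hk h Q f) j = 𝓘.size * deriv f (𝓘.right j) := by
  induction Q with
  | zero =>
    rw [interpPoly_zero]
    have hP := refProj_solveOp hk h (𝓘 := 𝓘) (F := F) hf.continuous
    exact ⟨hP.hat_eq j, hP.tilde_eq j⟩
  | succ Q ih =>
    have hf2 := contDiff_deriv (contDiff_deriv (n := 2 * Q + 1) (contDiff_of_le (by omega) hf))
    have hc := refCorr_solveOp hk h (𝓘 := 𝓘) (F := F)
      (fun j => continuous_corrFun hk h Q hf2.continuous j)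
    obtain ⟨h1, h2⟩ := ih (contDiff_of_le (by omega) hf)
    rw [interpPoly_succ, map_sub, map_sub, Pi.sub_apply, Pi.sub_apply, h1, h2]
    have e1 : fluxHat F 𝓘 (corrPoly hk h (Q + 1) f) j = 0 := hc.hat_eq j
    have e2 : fluxTilde F 𝓘 (corrPoly hk h (Q + 1) f) j = 0 := hc.tilde_eq j
    rw [e1, e2]
    simp

theorem moment_polyFun_sub (p q φ : ℂ[X]) :
    moment (polyFun (p - q)) φ = moment (polyFun p) φ - moment (polyFun q) φ :=
  (momentPoly φ).map_sub p q

/-- The defect of the interpolant in the scheme. -/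
theorem refForm_interpPoly (Q : ℕ) (hQ : 2 * Q + 1 ≤ k) {f : ℝ → ℂ}
    (hf : ContDiff ℝ (2 * Q + 2 : ℕ) f) (hp : Function.Periodic f (b - a))
    (j : Fin N) {φ : ℂ[X]} (hφ : φ.natDegree ≤ k) :
    refForm F 𝓘 j φ (interpPoly hk h Q f) =
      𝓘.len j * (moment (polyFun (interpPoly hk h Q (deriv (deriv f)) j)) φ +
        moment (corrFun hk h Q (deriv (deriv f)) j) φ) := by
  have hf2 : ContDiff ℝ (2 * Q : ℕ) (deriv (deriv f)) :=
    contDiff_deriv (contDiff_deriv (n := 2 * Q + 1) (contDiff_of_le (by omega) hf))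
  induction Q with
  | zero =>
    rw [interpPoly_zero, interpPoly_zero, refForm_corrPoly_zero hk h (by exact_mod_cast hf) hp j hφ]
    congr 1
    have : corrFun hk h 0 (deriv (deriv f)) j = fun ξ => refFun 𝓘 (deriv (deriv f)) j ξ -
        polyFun (corrPoly hk h 0 (deriv (deriv f)) j) ξ := rfl
    rw [this, moment_sub_left (continuous_refFun 𝓘 hf2.continuous j).continuousOn
      (continuous_polyFun _).continuousOn]
    ring
  -- The new correction cancels the defect of level `Q`. Replacing the interpolant of `f''` by the
  -- one with the new correction leaves that correction of `f''` as the defect of level `Q + 1`.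
  | succ Q ih =>
    rw [interpPoly_succ, map_sub, ih (by omega) (contDiff_of_le (by omega) hf)
      (contDiff_of_le (by omega) hf2), refForm_corrPoly_succ hk h Q (by omega)
      (contDiff_of_le (by omega) hf) j hφ, interpPoly_succ, Pi.sub_apply, moment_polyFun_sub,
      corrFun_succ]
    ring

/-- All corrections before the last have mean zero in each cell, so the cell average of the error
sees only the last one. -/
theorem moment_one_sub_interpPoly (Q : ℕ) (hQ : 2 * Q ≤ k) {f : ℝ → ℂ}
    (hf : ContDiff ℝ (2 * Q : ℕ) f) (j : Fin N) :
    moment (fun ξ => refFun 𝓘 f j ξ - polyFun (interpPoly hk h Q f j) ξ) 1 =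
      moment (corrFun hk h Q f j) 1 := by
  induction Q with
  | zero => rw [interpPoly_zero]; rfl
  | succ Q ih =>
    have hr := (continuous_refFun 𝓘 hf.continuous j).continuousOn (s := Icc 0 1)
    have h1 := ih (by omega) (contDiff_of_le (by omega) hf)
    rw [moment_corrFun_eq_zero hk h Q (contDiff_of_le (by omega) hf) j (by simp; omega),
      moment_sub_left hr (continuous_polyFun _).continuousOn] at h1
    rw [moment_sub_left hr (continuous_polyFun _).continuousOn, interpPoly_succ, Pi.sub_apply,
      moment_polyFun_sub, corrFun_succ]
    linear_combination h1

theorem SmoothFam.interp {T : ℝ} {s : ℕ} {v : ℝ → ℝ → ℂ} (hv : SmoothFam a b T s v) (Q n : ℕ)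
    (hs : n + 2 * Q + 3 ≤ s) (Φ : (Fin N → ℂ[X]) →ₗ[ℂ] ℂ) {t : ℝ} (ht : t ∈ Icc 0 T) :
    HasDerivWithinAt (fun t => Φ (interpPoly hk h Q (iteratedDeriv n (v t))))
      (Complex.I * Φ (interpPoly hk h Q (iteratedDeriv (n + 2) (v t)))) (Icc 0 T) t := by
  induction Q with
  | zero =>
    simp only [interpPoly_zero]
    exact (hv.corr hk h 0 n (by omega)).1 Φ t ht
  | succ Q ih =>
    simp only [interpPoly_succ, map_sub, mul_sub]
    exact (ih (by omega)).sub ((hv.corr hk h (Q + 1) n (by omega)).1 Φ t ht)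

theorem IsInterpolant.refPoly_eq {T : ℝ} (hT : 0 < T) {s : ℕ} {u : ℝ → ℝ → ℂ}
    (hv : SmoothFam a b T s (fun t x => u x t)) (hs : 2 * ((k - 1) / 2) + 1 ≤ s)
    {uI : ℝ → PiecewisePoly N} (hI : IsInterpolant k T F 𝓘 u uI) {t : ℝ} (ht : t ∈ Icc 0 T) :
    refPoly 𝓘 (uI t) = interpPoly hk h ((k - 1) / 2) (fun x => u x t) := by
  obtain ⟨P, w, hP, hw, hu⟩ := hI
  ext1 j
  have key := fun q hq => congrFun (refPoly_correction hk h hT hv hs hP hw q hq t ht) j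
  have h0 := key 0 (by omega)
  simp only [if_true, refPoly] at h0
  rw [refPoly, hu t ht j, sub_comp, h0, interpPoly, Pi.sub_apply, Finset.sum_apply,
    ← coe_compRingHom_apply, map_sum]
  congr 1
  refine Finset.sum_congr rfl fun q hq => ?_
  have hq' := Finset.mem_Icc.1 hq
  have := key q hq'.2
  rwa [if_neg (by omega)] at this

end Interpolant

end UWDG
end

/-! ### From a small defect to flux and cell average errors. -/

noncomputable section
namespace UWDG

section Errors

variable {a b : ℝ} {N : ℕ} [NeZero N]

/-- The quadratic mean of quantities bounded by neighbouring ones. -/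
theorem sqrt_mean_sq_le {W S ε : ℝ} (hS : 0 ≤ S) (hε : 0 ≤ ε) {x n : Fin N → ℝ}
    (hx0 : ∀ j, 0 ≤ x j) (hx : ∀ j, x j ≤ ε + W * (n j + n (j + 1)))
    (hmean : (1 / (N : ℝ)) * ∑ j, n j ^ 2 ≤ S * ε ^ 2) :
    √((1 / (N : ℝ)) * ∑ j, x j ^ 2) ≤ √(2 + 8 * W ^ 2 * S) * ε := by
  have hN : (0:ℝ) < N := by exact_mod_cast Nat.pos_of_ne_zero (NeZero.ne N)
  have h1 : ∀ j, x j ^ 2 ≤ 2 * ε ^ 2 + 4 * W ^ 2 * (n j ^ 2 + n (j + 1) ^ 2) := by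
    intro j
    have h2 : x j ^ 2 ≤ (ε + W * (n j + n (j + 1))) ^ 2 := pow_le_pow_left₀ (hx0 j) (hx j) 2
    -- `(x + y)² ≤ 2x² + 2y²` used twice. Every cell is then counted at two interfaces, which turns
    -- the factor 4 into 8.
    nlinarith [sq_nonneg (ε - W * (n j + n (j + 1))), sq_nonneg (W * (n j - n (j + 1)))]
  have hshift : ∑ j, n (j + 1) ^ 2 = ∑ j, n j ^ 2 :=
    Fintype.sum_equiv (Equiv.addRight 1) _ _ fun j => rfl
  have h2 : (1 / (N : ℝ)) * ∑ j, x j ^ 2 ≤ (2 + 8 * W ^ 2 * S) * ε ^ 2 := by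
    calc (1 / (N : ℝ)) * ∑ j, x j ^ 2
        ≤ (1 / (N : ℝ)) * ∑ j, (2 * ε ^ 2 + 4 * W ^ 2 * (n j ^ 2 + n (j + 1) ^ 2)) := by
          gcongr with j _
          exact h1 j
      _ = 2 * ε ^ 2 + 8 * W ^ 2 * ((1 / (N : ℝ)) * ∑ j, n j ^ 2) := by
          rw [Finset.sum_add_distrib, ← Finset.mul_sum _ _ (4 * W ^ 2), Finset.sum_add_distrib, hshift]
          simp only [Finset.sum_const, Finset.card_univ, Fintype.card_fin, nsmul_eq_mul]
          field_simp
          ring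
      _ ≤ 2 * ε ^ 2 + 8 * W ^ 2 * (S * ε ^ 2) := by gcongr
      _ = (2 + 8 * W ^ 2 * S) * ε ^ 2 := by ring
  calc √((1 / (N : ℝ)) * ∑ j, x j ^ 2) ≤ √((2 + 8 * W ^ 2 * S) * ε ^ 2) := Real.sqrt_le_sqrt h2
    _ = √(2 + 8 * W ^ 2 * S) * ε := by rw [Real.sqrt_mul (by positivity), Real.sqrt_sq hε]

theorem integral_sq_nonneg (p : ℂ[X]) : 0 ≤ ∫ ξ in (0:ℝ)..1, ‖p.eval (ξ : ℂ)‖ ^ 2 :=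
  intervalIntegral.integral_nonneg zero_le_one fun _ _ => by positivity

/-- Mesh regularity makes the unweighted mean over the cells comparable with the weighted one: `b -
a ≤ N h` and `h ≤ σ h_j` give `1 / N ≤ σ h_j / (b - a)`. -/
theorem mean_le_energy {𝓘 : Mesh a b N} {σ : ℝ} (hσ : 𝓘.Regular σ) (hab : a < b) (z : Fin N → ℂ[X]) :
    (1 / (N : ℝ)) * ∑ j, ∫ ξ in (0:ℝ)..1, ‖(z j).eval (ξ : ℂ)‖ ^ 2 ≤ σ / (b - a) * energy 𝓘 z := by
  have hN : (0:ℝ) < N := by exact_mod_cast Nat.pos_of_ne_zero (NeZero.ne N)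
  have hba : 0 < b - a := sub_pos.2 hab
  rw [energy, Finset.mul_sum, Finset.mul_sum]
  refine Finset.sum_le_sum fun j _ => ?_
  rw [← mul_assoc]
  refine mul_le_mul_of_nonneg_right ?_ (integral_sq_nonneg _)
  have h1 : 𝓘.size ≤ σ * 𝓘.len j := ((div_lt_iff₀ (𝓘.len_pos j)).1 (hσ j)).le
  have h2 := 𝓘.sub_le_card_mul_size
  rw [div_mul_eq_mul_div, div_le_div_iff₀ hN hba, one_mul]
  nlinarith [mul_le_mul_of_nonneg_left h1 hN.le]

theorem Mesh.one_lt_of_regular {𝓘 : Mesh a b N} {σ : ℝ} (hσ : 𝓘.Regular σ) : 1 < σ :=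
  ((one_le_div (𝓘.len_pos 0)).2 (𝓘.len_le_size 0)).trans_lt (hσ 0)

/-- The errors of the scheme in terms of a comparison function with a small defect. -/
theorem exists_error_bound (k : ℕ) (F : Flux) (a b T σ : ℝ) (hab : a < b) (hT : 0 < T) :
    ∃ C : ℝ, 0 ≤ C ∧ ∀ (N : ℕ) [NeZero N] (𝓘 : Mesh a b N), 𝓘.Regular σ →
      ∀ (u : ℝ → ℝ → ℂ) (uh : ℝ → PiecewisePoly N), IsSemiDiscreteSolution k T F 𝓘 uh →
      ∀ (Y Y' : ℝ → Fin N → ℂ[X]) (g : ℝ → Fin N → ℝ → ℂ) (ε : ℝ), 0 ≤ ε →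
      (∀ t ∈ Icc 0 T, Continuous fun x => u x t) →
      (∀ t j, (Y t j).natDegree ≤ k) → (∀ t j, (Y' t j).natDegree ≤ k) →
      (∀ t ∈ Icc 0 T, ∀ j i,
        HasDerivWithinAt (fun t => (Y t j).coeff i) (Complex.I * (Y' t j).coeff i) (Icc 0 T) t) →
      (∀ t ∈ Icc 0 T, ∀ j, ∀ φ : ℂ[X], φ.natDegree ≤ k →
        refForm F 𝓘 j φ (Y t) =
          𝓘.len j * (moment (polyFun (Y' t j)) φ + moment (g t j) φ)) →
      (∀ t ∈ Icc 0 T, ∀ j, ∀ ξ ∈ Icc (0:ℝ) 1, ‖g t j ξ‖ ≤ ε) →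
      (∀ j, ∀ ξ ∈ Icc (0:ℝ) 1, ‖polyFun (refPoly 𝓘 (uh 0) j - Y 0 j) ξ‖ ≤ ε) →
      (∀ t ∈ Ioc 0 T, ∀ j, ‖u (𝓘.right j) t - fluxHat F 𝓘 (Y t) j‖ ≤ ε ∧
        ‖𝓘.size * deriv (fun x => u x t) (𝓘.right j) - fluxTilde F 𝓘 (Y t) j‖ ≤ ε ∧
        ‖moment (fun ξ => refFun 𝓘 (fun x => u x t) j ξ - polyFun (Y t j) ξ) 1‖ ≤ ε) →
      ∀ t ∈ Ioc 0 T, errFlux F 𝓘 u uh t ≤ C * ε ∧ errFluxDeriv F 𝓘 u uh t * 𝓘.size ≤ C * ε ∧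
        errCellAvg 𝓘 u uh t ≤ C * ε := by
  obtain ⟨c, hc, hcn⟩ := exists_cnorm_sq_le k
  set S := c * |σ| * (Real.exp 1 * (1 + T ^ 2)) with hS
  set W := fluxWeight F * (2 + 2 * |σ|) * (1 + k) with hW
  have hS0 : 0 ≤ S := by positivity
  have hfw := (fluxWeight_bounds F).1
  have hW1 : 1 ≤ W := by
    have h1 : (0:ℝ) ≤ k := Nat.cast_nonneg k
    have h2 := abs_nonneg σ
    have h3 : 1 ≤ fluxWeight F * (2 + 2 * |σ|) := by nlinarith
    rw [hW]; nlinarith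
  have hba : 0 < b - a := sub_pos.2 hab
  refine ⟨√(2 + 8 * W ^ 2 * S), Real.sqrt_nonneg _, ?_⟩
  intro N _ 𝓘 hreg u uh huh Y Y' g ε hε hu hY hYd' hYd hform hg h0 hflux t ht
  have hσ1 := Mesh.one_lt_of_regular hreg
  have hσ : |σ| = σ := abs_of_pos (by linarith)
  have htI : t ∈ Icc 0 T := ⟨ht.1.le, ht.2⟩
  obtain ⟨y', hy'd, hy'c, hy'e⟩ := huh.exists_refPoly_deriv hT
  set z : ℝ → Fin N → ℂ[X] := fun t => refPoly 𝓘 (uh t) - Y t with hz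
  have hzd : ∀ t ∈ Icc 0 T, ∀ j, (z t j).natDegree ≤ k := fun t ht j =>
    (natDegree_sub_le _ _).trans (max_le ((natDegree_comp_affine 𝓘 j _).le.trans (huh.mem t ht j))
      (hY t j))
  -- The difference `z` of `u_h` and `Y` solves the scheme with right-hand side `i g`: the time
  -- derivative of `Y` is `i Y'`, while the form applied to `Y` gives the moments of `Y' + g`.
  have henergy := energy_le F 𝓘 (k := k) (ε := ε) hT (z := z)
    (z' := fun t j => y' t j - Complex.I • Y' t j) (g := fun t j ξ => Complex.I * g t j ξ) hzd
    (fun t ht j => (natDegree_sub_le _ _).trans (max_le (hy'd t ht j)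
      ((natDegree_smul_le _ _).trans (hYd' t j))))
    (fun j i => by
      simp only [hz, Pi.sub_apply, coeff_sub]
      exact (huh.continuousOn_refPoly j i).sub fun t ht => (hYd t ht j i).continuousWithinAt)
    (fun t ht j i => by
      simp only [hz, Pi.sub_apply, coeff_sub, coeff_smul, smul_eq_mul]
      exact (hy'c t ht j i).sub (hYd t ⟨ht.1.le, ht.2⟩ j i))
    (fun t ht j ξ hξ => by
      rw [norm_mul, Complex.norm_I, one_mul]; exact hg t ⟨ht.1.le, ht.2⟩ j ξ hξ)
    (fun t ht j φ hφ => by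
      have e1 := hy'e t ht j φ hφ
      have e2 := hform t ⟨ht.1.le, ht.2⟩ j φ hφ
      have e3 : moment (polyFun (Complex.I • Y' t j)) φ = Complex.I * moment (polyFun (Y' t j)) φ :=
        (momentPoly φ).map_smul _ _
      rw [moment_polyFun_sub, moment_const_mul_left, e3, hz, map_sub, e2]
      linear_combination e1) htI
  have hE0 : energy 𝓘 (z 0) ≤ (b - a) * ε ^ 2 := by
    rw [energy, ← 𝓘.sum_len, Finset.sum_mul]
    refine Finset.sum_le_sum fun j _ => mul_le_mul_of_nonneg_left ?_ (𝓘.len_pos j).le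
    have hcont : Continuous fun ξ : ℝ => ‖(z 0 j).eval (ξ : ℂ)‖ ^ 2 :=
      (continuous_polyFun (z 0 j)).norm.pow 2
    have := intervalIntegral.integral_mono_on (μ := MeasureTheory.volume) (zero_le_one (α := ℝ))
      (hcont.intervalIntegrable 0 1) ((continuous_const (y := ε ^ 2)).intervalIntegrable 0 1)
      (fun ξ hξ => pow_le_pow_left₀ (norm_nonneg _) (h0 j ξ hξ) 2)
    simpa using this
  have hmean : (1 / (N : ℝ)) * ∑ j, cnorm k (z t j) ^ 2 ≤ S * ε ^ 2 := by
    have hN : (0:ℝ) < N := by exact_mod_cast Nat.pos_of_ne_zero (NeZero.ne N)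
    calc (1 / (N : ℝ)) * ∑ j, cnorm k (z t j) ^ 2
        ≤ (1 / (N : ℝ)) * ∑ j, c * ∫ ξ in (0:ℝ)..1, ‖(z t j).eval (ξ : ℂ)‖ ^ 2 := by
          gcongr with j _
          exact hcn _ (hzd t htI j)
      _ = c * ((1 / (N : ℝ)) * ∑ j, ∫ ξ in (0:ℝ)..1, ‖(z t j).eval (ξ : ℂ)‖ ^ 2) := by
          rw [← Finset.mul_sum]; ring
      _ ≤ c * (σ / (b - a) * (Real.exp 1 * ((b - a) * ε ^ 2 + T ^ 2 * ε ^ 2 * (b - a)))) := by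
          refine mul_le_mul_of_nonneg_left ((mean_le_energy hreg hab (z t)).trans ?_) hc.le
          have : 0 ≤ σ / (b - a) := by positivity
          refine mul_le_mul_of_nonneg_left (henergy.trans ?_) this
          have := (Real.exp_pos 1).le
          gcongr
      _ = S * ε ^ 2 := by
          rw [hS, hσ]
          field_simp
  have hn0 : ∀ j, 0 ≤ cnorm k (z t j) := fun j => cnorm_nonneg _ _
  have hfl : ∀ j, ‖fluxHat F 𝓘 (z t) j‖ ≤ W * (cnorm k (z t j) + cnorm k (z t (j + 1))) ∧
      ‖fluxTilde F 𝓘 (z t) j‖ ≤ W * (cnorm k (z t j) + cnorm k (z t (j + 1))) := by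
    intro j
    have := norm_flux_le_of_cnorm F 𝓘 hreg (hzd t htI) j
      (le_add_of_nonneg_right (hn0 (j + 1))) (le_add_of_nonneg_left (hn0 j))
    rw [← hσ, ← mul_assoc] at this
    exact this
  have hdec : refPoly 𝓘 (uh t) = Y t + z t := by simp [hz]
  refine ⟨?_, ?_, ?_⟩
  · refine sqrt_mean_sq_le hS0 hε (fun j => norm_nonneg _) (fun j => ?_) hmean
    rw [← fluxHat_refPoly, hdec, map_add, Pi.add_apply, ← sub_sub]
    exact (norm_sub_le _ _).trans (add_le_add (hflux t ht j).1 (hfl j).1)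
  · have e : errFluxDeriv F 𝓘 u uh t * 𝓘.size = √((1 / (N : ℝ)) * ∑ j,
        ‖𝓘.size * deriv (fun x => u x t) (𝓘.right j) - fluxTilde F 𝓘 (refPoly 𝓘 (uh t)) j‖ ^ 2) := by
      have hs := 𝓘.size_pos.le
      conv_lhs => rw [← Real.sqrt_sq hs]
      rw [errFluxDeriv, ← Real.sqrt_mul (by positivity), mul_assoc, Finset.sum_mul]
      congr 3
      ext j
      rw [fluxTilde_refPoly, ← mul_sub, norm_mul, Complex.norm_real, Real.norm_of_nonneg hs]
      ring
    rw [e]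
    refine sqrt_mean_sq_le hS0 hε (fun j => norm_nonneg _) (fun j => ?_) hmean
    rw [hdec, map_add, Pi.add_apply, ← sub_sub]
    exact (norm_sub_le _ _).trans (add_le_add (hflux t ht j).2.1 (hfl j).2)
  · refine sqrt_mean_sq_le hS0 hε (fun j => norm_nonneg _) (fun j => ?_) hmean
    have hl := 𝓘.len_ne_zero j
    have hrc : ContinuousOn (refFun 𝓘 (fun x => u x t) j) (Icc 0 1) :=
      (continuous_refFun 𝓘 (hu t htI) j).continuousOn
    have e1 : ((1 / 𝓘.len j : ℝ) : ℂ) *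
        ∫ x in (𝓘.left j)..(𝓘.right j), (u x t - (uh t j).eval (x : ℂ)) =
        moment (fun ξ => refFun 𝓘 (fun x => u x t) j ξ - polyFun (Y t j) ξ) 1 -
          moment (polyFun (z t j)) 1 := by
      have e2 := integral_cell_mul 𝓘 j (fun x => u x t - (uh t j).eval (x : ℂ)) 1
      simp only [eval_one, mul_one, one_comp] at e2
      rw [e2]
      have e3 : refFun 𝓘 (fun x => u x t - (uh t j).eval (x : ℂ)) j =
          fun ξ => refFun 𝓘 (fun x => u x t) j ξ - polyFun (refPoly 𝓘 (uh t) j) ξ := by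
        ext ξ
        simp only [refFun, polyFun, refPoly, eval_comp_affine]
      rw [e3, moment_sub_left hrc (continuous_polyFun _).continuousOn,
        moment_sub_left hrc (continuous_polyFun _).continuousOn, hz]
      simp only [Pi.sub_apply]
      rw [moment_polyFun_sub]
      push_cast
      field_simp
      ring
    have e4 : ‖moment (polyFun (z t j)) 1‖ ≤ cnorm k (z t j) := by
      have := norm_moment_le (k := 0) (φ := 1) (G := polyFun (z t j)) (by simp)
        (fun ξ hξ => norm_eval_le_cnorm (hzd t htI j) hξ)
      simpa [cnorm] using this
    rw [e1]
    refine (norm_sub_le _ _).trans (add_le_add (hflux t ht j).2.2 (e4.trans ?_))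
    nlinarith [hn0 j, hn0 (j + 1), mul_nonneg (sub_nonneg.2 hW1) (add_nonneg (hn0 j) (hn0 (j + 1)))]

end Errors

end UWDG
end

/-! ### Error rates from the corrections with vanishing fluxes. -/

noncomputable section
namespace UWDG

section Rates

theorem iteratedDeriv_deriv_deriv (n : ℕ) (f : ℝ → ℂ) :
    iteratedDeriv n (deriv (deriv f)) = iteratedDeriv (n + 2) f := by
  rw [← iteratedDeriv_succ', ← iteratedDeriv_succ']

theorem SmoothFam.interp_coeff {a b : ℝ} {N : ℕ} [NeZero N] {k : ℕ} (hk : 2 ≤ k) {F : Flux}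
    {𝓘 : Mesh a b N} (h : Unisolvent k F 𝓘) {T : ℝ} {s : ℕ} {v : ℝ → ℝ → ℂ}
    (hv : SmoothFam a b T s v) (Q : ℕ) (hs : 2 * Q + 3 ≤ s) {t : ℝ} (ht : t ∈ Icc 0 T) (j : Fin N)
    (i : ℕ) : HasDerivWithinAt (fun t => (interpPoly hk h Q (v t) j).coeff i)
      (Complex.I * (interpPoly hk h Q (deriv (deriv (v t))) j).coeff i) (Icc 0 T) t := by
  have h1 := hv.interp hk h Q 0 (by omega) (coeffAt j i) ht
  simp only [← deriv_deriv_iteratedDeriv 0, iteratedDeriv_zero] at h1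
  exact h1

theorem norm_moment_one_le {G : ℝ → ℂ} {B : ℝ} (hG : ∀ ξ ∈ Icc (0:ℝ) 1, ‖G ξ‖ ≤ B) :
    ‖moment G 1‖ ≤ B := by
  have := norm_moment_le (k := 0) (φ := 1) (G := G) (by simp) hG
  simpa [cnorm] using this

/-- The errors of the scheme for a stable flux with loss of `l` derivatives. -/
theorem exists_error_rates (k : ℕ) (hk : 2 ≤ k) (F : Flux) (a b T σ : ℝ) (hab : a < b) (hT : 0 < T)
    (l : ℕ) (K : ℝ) (hK : 0 ≤ K) : ∃ C : ℝ, 0 ≤ C ∧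
      ∀ (N : ℕ) [NeZero N] (𝓘 : Mesh a b N), 𝓘.Regular σ → (l = 0 ∨ 𝓘.Uniform) →
      FluxStable k F 𝓘 l K → ∀ (s : ℕ) (u : ℝ → ℝ → ℂ) (uh : ℝ → PiecewisePoly N),
      k + 3 + 2 * ((k - 1) / 2) + l * ((k - 1) / 2 + 1) ≤ s → IsSolutionPair k T F 𝓘 s u uh →
      ∀ M : ℝ, (∀ i ≤ l * ((k - 1) / 2 + 1),
        SeminormBound T (k + 1 + 2 * ((k - 1) / 2) + i) u M ∧
        SeminormBound T (k + 3 + 2 * ((k - 1) / 2) + i) u M) → ∀ t ∈ Ioc 0 T,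
      errFlux F 𝓘 u uh t ≤ C * M * 𝓘.size ^ (k + 1 + 2 * ((k - 1) / 2)) ∧
      errFluxDeriv F 𝓘 u uh t * 𝓘.size ≤ C * M * 𝓘.size ^ (k + 1 + 2 * ((k - 1) / 2)) ∧
      errCellAvg 𝓘 u uh t ≤ C * M * 𝓘.size ^ (k + 1 + 2 * ((k - 1) / 2)) := by
  set Q := (k - 1) / 2 with hQ
  have hQk : 2 * Q + 1 ≤ k := by omega
  obtain ⟨C₁, hC₁, herr⟩ := exists_error_bound k F a b T σ hab hT
  obtain ⟨C₂, hC₂, hchain⟩ := exists_chain_bound k hk F a b σ hab l K hK Q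
  refine ⟨C₁ * C₂, mul_nonneg hC₁ hC₂, ?_⟩
  intro N _ 𝓘 hreg hl hst s u uh hs hpair M hM
  obtain ⟨hex, huh, uI, hI, h0⟩ := hpair
  have hv := hex.smoothFam hT
  have hun : Unisolvent k F 𝓘 := hst.unisolvent hk hK hreg hl
  set v : ℝ → ℝ → ℂ := fun t x => u x t with hvdef
  have h0T : (0:ℝ) ∈ Icc 0 T := ⟨le_rfl, hT.le⟩
  have hM0 : 0 ≤ M := (norm_nonneg _).trans ((hM 0 (by omega)).1 0 h0T 0)
  set ε := C₂ * 𝓘.size ^ (k + 1 + 2 * Q) * M with hε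
  have hsz := 𝓘.size_pos.le
  have hε0 : 0 ≤ ε := by positivity
  have hcd : ∀ t ∈ Icc 0 T, ∀ n ≤ s, ContDiff ℝ n (v t) := fun t ht n hn =>
    contDiff_of_le hn (hv.contDiff t ht)
  -- The last correction of `u` bounds the cell average error of the interpolant, that of `u_xx`
  -- bounds the defect. Hence the two seminorms, two orders apart.
  have hb0 : ∀ t ∈ Icc 0 T, ∀ j, ∀ ξ ∈ Icc (0:ℝ) 1, ‖corrFun hk hun Q (v t) j ξ‖ ≤ ε := by
    intro t ht
    exact hchain N 𝓘 hreg hl hst (v t) _ M (hv.periodic t ht) (hcd t ht _ (by omega))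
      (fun i hi x => (hM i hi).1 t ht x) (isChain_corrFun hk hun Q (hcd t ht _ (by omega)))
  have hb2 : ∀ t ∈ Icc 0 T, ∀ j, ∀ ξ ∈ Icc (0:ℝ) 1,
      ‖corrFun hk hun Q (deriv (deriv (v t))) j ξ‖ ≤ ε := by
    intro t ht
    have hc2 : ∀ n, n + 2 ≤ s → ContDiff ℝ n (deriv (deriv (v t))) := fun n hn =>
      contDiff_deriv (contDiff_deriv (n := n + 1) (hcd t ht _ hn))
    refine hchain N 𝓘 hreg hl hst _ _ M (periodic_deriv (periodic_deriv (hv.periodic t ht)))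
      (hc2 _ (by omega)) (fun i hi x => ?_) (isChain_corrFun hk hun Q (hc2 _ (by omega)))
    rw [iteratedDeriv_deriv_deriv]
    have := (hM i hi).2 t ht x
    rwa [show k + 3 + 2 * Q + i = k + 1 + 2 * Q + i + 2 by omega] at this
  have key := herr N 𝓘 hreg u uh huh (fun t => interpPoly hk hun Q (v t))
    (fun t => interpPoly hk hun Q (deriv (deriv (v t))))
    (fun t => corrFun hk hun Q (deriv (deriv (v t)))) ε hε0
    (fun t ht => (hv.contDiff t ht).continuous)
    (fun t => natDegree_interpPoly hk hun Q _) (fun t => natDegree_interpPoly hk hun Q _)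
    (fun t ht j i => hv.interp_coeff hk hun Q (by omega) ht j i)
    (fun t ht j φ hφ => refForm_interpPoly hk hun Q hQk (hcd t ht _ (by omega)) (hv.periodic t ht) j hφ)
    hb2
    -- The scheme starts from `u_I`, which is the comparison function at time 0, so the initial
    -- error vanishes.
    (fun j ξ _ => by
      rw [h0, hI.refPoly_eq hk hun hT hv (by omega) h0T, sub_self]
      simpa [polyFun] using hε0)
    (fun t ht j => by
      have htI : t ∈ Icc 0 T := ⟨ht.1.le, ht.2⟩
      obtain ⟨e1, e2⟩ := flux_interpPoly hk hun Q (hcd t htI _ (by omega)) j (F := F)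
      rw [e1, e2, sub_self, sub_self, norm_zero,
        moment_one_sub_interpPoly hk hun Q (by omega) (hcd t htI _ (by omega)) j]
      exact ⟨hε0, hε0, norm_moment_one_le (hb0 t htI j)⟩)
  intro t ht
  have e : C₁ * C₂ * M * 𝓘.size ^ (k + 1 + 2 * Q) = C₁ * ε := by rw [hε]; ring
  rw [e]
  exact key t ht

end Rates

/-! ### A further correction with nonvanishing fluxes. -/

section Star

variable {a b : ℝ} {N : ℕ} [NeZero N]

/-- The constant flux of the derivative of the correction with nonvanishing fluxes. -/
def starTilde (𝓘 : Mesh a b N) (G : Fin N → ℝ → ℂ) : ℂ :=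
  (∑ j, (𝓘.len j : ℂ) ^ 2 * moment (G j) X) / (b - a : ℝ)

/-- The increment of the flux of the correction with nonvanishing fluxes. -/
def starIncr (𝓘 : Mesh a b N) (G : Fin N → ℝ → ℂ) (j : Fin N) : ℂ :=
  𝓘.len j * starTilde 𝓘 G - (𝓘.len j : ℂ) ^ 2 * moment (G j) X

/-- The flux of the correction with nonvanishing fluxes. -/
def starHat (𝓘 : Mesh a b N) (G : Fin N → ℝ → ℂ) (j : Fin N) : ℂ :=
  ∑ i ∈ Finset.univ.filter (· ≤ j), starIncr 𝓘 G i

/-- The compatibility condition that determines `starTilde`: increments of a periodic flux must sum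
to zero, and the cell lengths sum to `b - a`. -/
theorem sum_starIncr (hab : a < b) (𝓘 : Mesh a b N) (G : Fin N → ℝ → ℂ) :
    ∑ j, starIncr 𝓘 G j = 0 := by
  have hba : ((b - a : ℝ) : ℂ) ≠ 0 := Complex.ofReal_ne_zero.2 (sub_pos.2 hab).ne'
  simp only [starIncr, Finset.sum_sub_distrib, ← Finset.sum_mul]
  rw [← Complex.ofReal_sum, 𝓘.sum_len, starTilde, mul_div_cancel₀ _ hba, sub_self]

/-- Partial sums have the prescribed increments. At the first cell the predecessor is the last one,
whose partial sum is the full sum, equal to zero. -/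
theorem starHat_sub (hab : a < b) (𝓘 : Mesh a b N) (G : Fin N → ℝ → ℂ) (j : Fin N) :
    starHat 𝓘 G j - starHat 𝓘 G (j - 1) = starIncr 𝓘 G j := by
  obtain ⟨n, rfl⟩ : ∃ n, N = n + 1 := ⟨N - 1, by have := NeZero.ne N; omega⟩
  induction j using Fin.cases with
  | zero =>
    have e1 : starHat 𝓘 G 0 = starIncr 𝓘 G 0 := by
      rw [starHat, Finset.sum_filter, Finset.sum_eq_single 0]
      · simp
      · intro i _ hi
        rw [if_neg (by simpa using hi)]
      · simp
    have e2 : starHat 𝓘 G (0 - 1) = 0 := by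
      rw [starHat, ← sum_starIncr hab 𝓘 G]
      congr 1
      ext i
      simp only [Finset.mem_filter, Finset.mem_univ, true_and, iff_true]
      have : (0 - 1 : Fin (n + 1)) = Fin.last n := by
        rw [sub_eq_iff_eq_add, Fin.last_add_one]
      rw [this]; exact Fin.le_last i
    rw [e1, e2, sub_zero]
  | succ i =>
    have e : i.succ - 1 = i.castSucc := by
      rw [sub_eq_iff_eq_add, Fin.coeSucc_eq_succ]
    rw [e, starHat, starHat]
    have : Finset.univ.filter (· ≤ i.succ) =
        insert i.succ (Finset.univ.filter (· ≤ i.castSucc)) := by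
      ext m
      simp only [Finset.mem_filter, Finset.mem_univ, true_and, Finset.mem_insert]
      rw [Fin.le_def, Fin.le_def, Fin.ext_iff]
      simp only [Fin.val_succ, Fin.val_castSucc]
      omega
    rw [this, Finset.sum_insert (by simp), add_sub_cancel_right]

/-- The data of the correction with nonvanishing fluxes. -/
def starData (𝓘 : Mesh a b N) (k : ℕ) (G : Fin N → ℝ → ℂ) : FluxData k N := fun j =>
  (fun m => (𝓘.len j : ℂ) ^ 2 * moment (G j) (antider₂ (X ^ (m : ℕ)))
    + starHat 𝓘 G j * (derivative (antider₂ (X ^ (m : ℕ)))).eval 1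
    - 𝓘.len j * starTilde 𝓘 G * (antider₂ (X ^ (m : ℕ))).eval 1,
    starHat 𝓘 G j, 𝓘.size * starTilde 𝓘 G)

variable {k : ℕ} (hk : 2 ≤ k) {F : Flux} {𝓘 : Mesh a b N} (h : Unisolvent k F 𝓘)

theorem moment_solveOp_starData {G : Fin N → ℝ → ℂ} (hG : ∀ j, Continuous (G j)) (j : Fin N)
    {ψ : ℂ[X]} (hψ : ψ.natDegree ≤ k - 2) :
    moment (polyFun (solveOp hk h (starData 𝓘 k G) j)) ψ =
      (𝓘.len j : ℂ) ^ 2 * moment (G j) (antider₂ ψ)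
        + starHat 𝓘 G j * (derivative (antider₂ ψ)).eval 1
        - 𝓘.len j * starTilde 𝓘 G * (antider₂ ψ).eval 1 :=
  moment_solveOp_eq hk h _ j
    ((𝓘.len j : ℂ) ^ 2 • (momentFun (G j) (hG j).continuousOn).comp antider₂
      + starHat 𝓘 G j • (leval 1).comp (derivative.comp antider₂)
      - (𝓘.len j * starTilde 𝓘 G) • (leval 1).comp antider₂) (fun _ => rfl) hψ

/-- The correction with nonvanishing fluxes solves the discrete equation for all test functions. -/
theorem refForm_star (hab : a < b) {G : Fin N → ℝ → ℂ} (hG : ∀ j, Continuous (G j)) (j : Fin N)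
    (hG1 : moment (G j) 1 = 0) {φ : ℂ[X]} (hφ : φ.natDegree ≤ k) :
    refForm F 𝓘 j φ (solveOp hk h (starData 𝓘 k G)) = 𝓘.len j * moment (G j) φ := by
  set ψ := derivative (derivative φ) with hψ
  have hψd : ψ.natDegree ≤ k - 2 :=
    (natDegree_derivative_le _).trans (by have := natDegree_derivative_le φ; omega)
  set A := antider₂ ψ with hA
  -- Test functions are split into three types. For the double antiderivative the moments in
  -- `starData` match. For constants both sides vanish, since the derivative flux is constant and `G
  -- j` has mean zero. For `X` the increment of the function flux is prescribed accordingly.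
  obtain ⟨r₁, r₀, hr⟩ : ∃ r₁ r₀ : ℂ, φ = A + (r₁ • X + r₀ • 1) := by
    have h1 := natDegree_le_one_of_derivative_derivative (r := φ - A)
      (by rw [derivative_sub, derivative_sub, derivative_antider₂, sub_self])
    obtain ⟨r₁, r₀, h2⟩ := exists_eq_X_add_C_of_natDegree_le_one h1
    refine ⟨r₁, r₀, ?_⟩
    rw [smul_eq_C_mul, smul_eq_C_mul, mul_one, ← h2]; ring
  have hc := (hG j).continuousOn (s := Icc 0 1)
  have hmG : moment (G j) φ = moment (G j) A + r₁ * moment (G j) X := by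
    rw [hr, moment_add_right hc, moment_add_right hc, moment_smul_right, moment_smul_right, hG1]
    ring
  have hA0 : A.eval 0 = 0 := antider₂_eval_zero ψ
  have hA0' : (derivative A).eval 0 = 0 := derivative_antider₂_eval_zero ψ
  have v1 : φ.eval 1 = A.eval 1 + r₁ + r₀ := by rw [hr]; simp; ring
  have v0 : φ.eval 0 = r₀ := by rw [hr]; simp [hA0]
  have d1 : (derivative φ).eval 1 = (derivative A).eval 1 + r₁ := by rw [hr]; simp
  have d0 : (derivative φ).eval 0 = r₁ := by rw [hr]; simp [hA0']
  have hH : ∀ j, fluxHat F 𝓘 (solveOp hk h (starData 𝓘 k G)) j = starHat 𝓘 G j :=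
    fluxHat_solveOp hk h _
  have hQ : ∀ j, fluxTilde F 𝓘 (solveOp hk h (starData 𝓘 k G)) j = 𝓘.size * starTilde 𝓘 G :=
    fluxTilde_solveOp hk h _
  have hinc := starHat_sub hab 𝓘 G j
  rw [starIncr] at hinc
  rw [refForm_apply, ← hψ, moment_solveOp_starData hk h hG j hψd, hH, hH, hQ, hQ, hmG, v1, v0, d1, d0,
    ← hA]
  have hl := 𝓘.len_ne_zero j
  have hs := 𝓘.size_ne_zero
  field_simp
  linear_combination (-r₁) * hinc

theorem hasDerivWithinAt_starData {T : ℝ} {G G' : ℝ → Fin N → ℝ → ℂ}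
    (hG : ∀ j, TimeFam T (fun t => G t j) (fun t ξ => Complex.I * G' t j ξ)) {t : ℝ}
    (ht : t ∈ Icc 0 T) : HasDerivWithinAt (fun t => starData 𝓘 k (G t))
      (Complex.I • starData 𝓘 k (G' t)) (Icc 0 T) t := by
  have hm : ∀ j φ, HasDerivWithinAt (fun t => moment (G t j) φ)
      (Complex.I * moment (G' t j) φ) (Icc 0 T) t := fun j φ => by
    have := (hG j).hasDerivWithinAt_moment φ ht
    rwa [moment_const_mul_left] at this
  have hc : HasDerivWithinAt (fun t => starTilde 𝓘 (G t)) (Complex.I * starTilde 𝓘 (G' t))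
      (Icc 0 T) t := by
    refine ((HasDerivWithinAt.fun_sum fun j (_ : j ∈ Finset.univ) =>
      (hm j X).const_mul ((𝓘.len j : ℂ) ^ 2)).div_const _).congr_deriv ?_
    rw [starTilde, ← mul_div_assoc, Finset.mul_sum]
    congr 1
    exact Finset.sum_congr rfl fun j _ => by ring
  have hh : ∀ j, HasDerivWithinAt (fun t => starHat 𝓘 (G t) j) (Complex.I * starHat 𝓘 (G' t) j)
      (Icc 0 T) t := by
    intro j
    refine (HasDerivWithinAt.fun_sum fun i (_ : i ∈ Finset.univ.filter (· ≤ j)) =>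
      (hc.const_mul (𝓘.len i : ℂ)).sub ((hm i X).const_mul ((𝓘.len i : ℂ) ^ 2))).congr_deriv ?_
    rw [starHat, Finset.mul_sum]
    exact Finset.sum_congr rfl fun i _ => by rw [starIncr]; ring
  rw [hasDerivWithinAt_pi]
  intro j
  refine HasDerivWithinAt.prodMk ?_ (HasDerivWithinAt.prodMk (hh j) ?_)
  · rw [hasDerivWithinAt_pi]
    intro m
    refine (((((hm j (antider₂ (X ^ (m : ℕ)))).const_mul ((𝓘.len j : ℂ) ^ 2)).add
      ((hh j).mul_const ((derivative (antider₂ (X ^ (m : ℕ)))).eval 1))).sub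
      ((hc.const_mul (𝓘.len j : ℂ)).mul_const ((antider₂ (X ^ (m : ℕ))).eval 1)))).congr_deriv ?_
    change _ = Complex.I * (_ + _ - _)
    ring
  · refine (hc.const_mul (𝓘.size : ℂ)).congr_deriv ?_
    change _ = Complex.I * (_ * _)
    ring

theorem Mesh.size_le (𝓘 : Mesh a b N) : 𝓘.size ≤ b - a := by
  refine Finset.sup'_le _ _ fun j _ => ?_
  rw [← 𝓘.sum_len]
  exact Finset.single_le_sum (fun i _ => (𝓘.len_pos i).le) (Finset.mem_univ j)

theorem norm_starTilde_le (hab : a < b) (𝓘 : Mesh a b N) {G : Fin N → ℝ → ℂ} {B : ℝ}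
    (hg : ∀ j, ‖moment (G j) X‖ ≤ B) : ‖starTilde 𝓘 G‖ ≤ 𝓘.size * B := by
  have hba := sub_pos.2 hab
  rw [starTilde, norm_div, Complex.norm_real, Real.norm_of_nonneg hba.le, div_le_iff₀ hba,
    ← 𝓘.sum_len, Finset.mul_sum]
  refine (norm_sum_le _ _).trans (Finset.sum_le_sum fun j _ => ?_)
  have hl := (𝓘.len_pos j).le
  rw [norm_mul, norm_pow, Complex.norm_real, Real.norm_of_nonneg hl]
  have h1 := 𝓘.len_le_size j
  calc 𝓘.len j ^ 2 * ‖moment (G j) X‖ ≤ 𝓘.size * 𝓘.len j * B := by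
        rw [pow_two]
        exact mul_le_mul (mul_le_mul_of_nonneg_right h1 hl) (hg j) (norm_nonneg _)
          (mul_nonneg 𝓘.size_pos.le hl)
    _ = 𝓘.size * B * 𝓘.len j := by ring

/-- Each increment is of size `h_j h B`, and the lengths sum to `b - a`. Accumulation over the mesh
thus costs one power of `h`, so this correction gains `h` where the others gain `h²`. -/
theorem norm_starHat_le (hab : a < b) (𝓘 : Mesh a b N) {G : Fin N → ℝ → ℂ} {B : ℝ} (hB : 0 ≤ B)
    (hg : ∀ j, ‖moment (G j) X‖ ≤ B) (j : Fin N) : ‖starHat 𝓘 G j‖ ≤ (b - a) * (2 * 𝓘.size * B) := by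
  have hs := 𝓘.size_pos.le
  have h1 : ∀ i, ‖starIncr 𝓘 G i‖ ≤ 𝓘.len i * (2 * 𝓘.size * B) := by
    intro i
    have hl := (𝓘.len_pos i).le
    have h2 := norm_starTilde_le hab 𝓘 hg
    refine (norm_sub_le _ _).trans ?_
    rw [norm_mul, norm_mul, norm_pow, Complex.norm_real, Real.norm_of_nonneg hl]
    have h3 := 𝓘.len_le_size i
    calc 𝓘.len i * ‖starTilde 𝓘 G‖ + 𝓘.len i ^ 2 * ‖moment (G i) X‖
        ≤ 𝓘.len i * (𝓘.size * B) + 𝓘.len i * 𝓘.size * B := by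
          rw [pow_two]; gcongr; exact hg i
      _ = 𝓘.len i * (2 * 𝓘.size * B) := by ring
  calc ‖starHat 𝓘 G j‖ ≤ ∑ i ∈ Finset.univ.filter (· ≤ j), 𝓘.len i * (2 * 𝓘.size * B) :=
        (norm_sum_le _ _).trans (Finset.sum_le_sum fun i _ => h1 i)
    _ ≤ ∑ i, 𝓘.len i * (2 * 𝓘.size * B) :=
        Finset.sum_le_sum_of_subset_of_nonneg (Finset.filter_subset _ _)
          fun i _ _ => mul_nonneg (𝓘.len_pos i).le (by positivity)
    _ = (b - a) * (2 * 𝓘.size * B) := by rw [← Finset.sum_mul, 𝓘.sum_len]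

/-- The size of the correction with nonvanishing fluxes. -/
theorem exists_star_bound (k : ℕ) (hk : 2 ≤ k) (F : Flux) (a b σ : ℝ) (hab : a < b) (K : ℝ)
    (hK : 0 ≤ K) : ∃ C : ℝ, 0 ≤ C ∧ ∀ (N : ℕ) [NeZero N] (𝓘 : Mesh a b N), 𝓘.Regular σ →
      FluxStable k F 𝓘 0 K → ∀ (h : Unisolvent k F 𝓘) (G : Fin N → ℝ → ℂ) (B : ℝ), 0 ≤ B →
      (∀ j, Continuous (G j)) → (∀ j, ∀ ξ ∈ Icc (0:ℝ) 1, ‖G j ξ‖ ≤ B) → ∀ j,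
      cnorm k (solveOp hk h (starData 𝓘 k G) j) ≤ C * (𝓘.size * B) ∧
      ‖starHat 𝓘 G j‖ ≤ C * (𝓘.size * B) ∧ ‖𝓘.size * starTilde 𝓘 G‖ ≤ C * (𝓘.size * B) := by
  obtain ⟨S, hS, hstab⟩ := exists_stability k hk F a b σ 0 K hK
  have hba := sub_pos.2 hab
  set E := (b - a) * (2 + 2 * (k : ℝ)) with hE
  have hE0 : 0 ≤ E := by positivity
  refine ⟨(S + 1) * E, by positivity, ?_⟩
  intro N _ 𝓘 hreg hst h G B hB hG hGB
  have hs := 𝓘.size_pos.le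
  have hsle := 𝓘.size_le
  have hg : ∀ j, ‖moment (G j) X‖ ≤ B := fun j => by
    have := norm_moment_le (k := 1) (φ := X) (natDegree_X_le) (hGB j)
    have e : cnorm 1 (X : ℂ[X]) = 1 := by simp [cnorm, Finset.sum_range_succ, coeff_X]
    rwa [e, mul_one] at this
  have hc := norm_starTilde_le hab 𝓘 hg
  have hh := norm_starHat_le hab 𝓘 hB hg
  set p := 𝓘.size * B with hp
  have hp0 : 0 ≤ p := by positivity
  have hk0 : (0:ℝ) ≤ k := Nat.cast_nonneg k
  have hhE : ∀ j, ‖starHat 𝓘 G j‖ ≤ E * p := fun j => (hh j).trans <| by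
    have : 0 ≤ (b - a) * k * p := by positivity
    rw [hE, mul_assoc 2]; nlinarith
  have hcE : ‖𝓘.size * starTilde 𝓘 G‖ ≤ E * p := by
    rw [norm_mul, Complex.norm_real, Real.norm_of_nonneg hs]
    calc 𝓘.size * ‖starTilde 𝓘 G‖ ≤ (b - a) * p := by gcongr
      _ ≤ E * p := by
        gcongr
        rw [hE]; nlinarith
  have hbound := hstab N 𝓘 hreg (Or.inl rfl) hst (solveOp hk h (starData 𝓘 k G)) (E * p)
    (natDegree_solveOp hk h _) (fun i hi j => by
      obtain rfl : i = 0 := by omega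
      simp only [Function.iterate_zero, id]
      refine ⟨fun ψ hψ => ?_, ?_, ?_⟩
      · rw [moment_solveOp_starData hk h hG j hψ]
        have hA : (antider₂ ψ).natDegree ≤ k := (natDegree_antider₂_le hψ).trans (by omega)
        have hAc : cnorm k (antider₂ ψ) ≤ cnorm (k - 2) ψ := by
          have := cnorm_antider₂_le (k - 2) ψ
          rwa [Nat.sub_add_cancel hk] at this
        have hn := cnorm_nonneg (k - 2) ψ
        have i1 : (1:ℝ) ∈ Icc (0:ℝ) 1 := by simp
        have m1 := norm_moment_le hA (hGB j)
        have m2 := norm_derivative_eval_le hA i1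
        have m3 := norm_eval_le_cnorm hA i1
        rw [Complex.ofReal_one] at m2 m3
        have hl := (𝓘.len_pos j).le
        have hls := 𝓘.len_le_size j
        have t1 : ‖(𝓘.len j : ℂ) ^ 2 * moment (G j) (antider₂ ψ)‖ ≤
            (b - a) * p * cnorm (k - 2) ψ := by
          rw [norm_mul, norm_pow, Complex.norm_real, Real.norm_of_nonneg hl, pow_two]
          calc 𝓘.len j * 𝓘.len j * ‖moment (G j) (antider₂ ψ)‖
              ≤ (b - a) * 𝓘.size * (B * cnorm (k - 2) ψ) := by
                gcongr
                · exact hls.trans hsle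
                · exact m1.trans (by gcongr)
            _ = (b - a) * p * cnorm (k - 2) ψ := by rw [hp]; ring
        have t2 : ‖starHat 𝓘 G j * (derivative (antider₂ ψ)).eval 1‖ ≤
            (b - a) * (2 * p) * (k * cnorm (k - 2) ψ) := by
          rw [norm_mul]
          have := hh j
          rw [mul_assoc 2] at this
          gcongr
          exact m2.trans (by gcongr)
        have t3 : ‖𝓘.len j * starTilde 𝓘 G * (antider₂ ψ).eval 1‖ ≤
            (b - a) * p * cnorm (k - 2) ψ := by
          rw [norm_mul, norm_mul, Complex.norm_real, Real.norm_of_nonneg hl]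
          gcongr
          · exact hls.trans hsle
          · exact m3.trans hAc
        calc _ ≤ (b - a) * p * cnorm (k - 2) ψ + (b - a) * (2 * p) * (k * cnorm (k - 2) ψ) +
              (b - a) * p * cnorm (k - 2) ψ :=
              (norm_sub_le _ _).trans (add_le_add ((norm_add_le _ _).trans (add_le_add t1 t2)) t3)
          _ = E * p * cnorm (k - 2) ψ := by rw [hE]; ring
      · rw [fluxHat_solveOp]; exact hhE j
      · rw [fluxTilde_solveOp]; exact hcE)
  intro j
  have hEp : 0 ≤ E * p := by positivity
  have hSEp : 0 ≤ S * (E * p) := by positivity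
  have e : (S + 1) * E * p = S * (E * p) + E * p := by ring
  rw [e]
  exact ⟨(hbound j).trans (by linarith), (hhE j).trans (by linarith), hcE.trans (by linarith)⟩

end Star

end UWDG
end

/-! ### Even degree under A1 or A2. -/

noncomputable section
namespace UWDG

/-- The mean-zero bound for periodic functions, used twice. It allows the constants to depend on the
highest seminorm alone. -/
theorem seminormBound_of_add_two {a b T : ℝ} (hab : a < b) {s : ℕ} {u : ℝ → ℝ → ℂ}
    (hv : SmoothFam a b T s (fun t x => u x t)) {n : ℕ} (hn : n + 3 ≤ s) {M : ℝ}
    (hM : SeminormBound T (n + 3) u M) : SeminormBound T (n + 1) u ((b - a) ^ 2 * M) := by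
  intro t ht x
  have hc := hv.contDiff t ht
  have h1 := fun x => norm_iteratedDeriv_le_of_periodic hab (n := n + 1)
    (contDiff_of_le hn hc) (hv.periodic t ht) (hM t ht) x
  have h2 := norm_iteratedDeriv_le_of_periodic hab (n := n)
    (contDiff_of_le (by omega) hc) (hv.periodic t ht) h1 x
  rwa [← mul_assoc, ← pow_two] at h2

/-- The errors of the scheme for even degree and a stable flux without loss of derivatives. -/
theorem exists_error_rates_even (k : ℕ) (hk : 2 ≤ k) (hev : Even k) (F : Flux) (a b T σ : ℝ)
    (hab : a < b) (hT : 0 < T) (K : ℝ) (hK : 0 ≤ K) : ∃ C : ℝ, 0 ≤ C ∧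
      ∀ (N : ℕ) [NeZero N] (𝓘 : Mesh a b N), 𝓘.Regular σ →
      FluxStable k F 𝓘 0 K → ∀ (u : ℝ → ℝ → ℂ) (uh : ℝ → PiecewisePoly N),
      IsSolutionPair k T F 𝓘 (k + 1 + (k + 2)) u uh →
      ∀ M : ℝ, SeminormBound T (k + 1 + (k + 2)) u M → ∀ t ∈ Ioc 0 T,
      errFlux F 𝓘 u uh t ≤ C * M * 𝓘.size ^ (2 * k) ∧
      errFluxDeriv F 𝓘 u uh t * 𝓘.size ≤ C * M * 𝓘.size ^ (2 * k) ∧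
      errCellAvg 𝓘 u uh t ≤ C * M * 𝓘.size ^ (2 * k) := by
  set Q := (k - 1) / 2 with hQ
  have hQk : 2 * Q + 2 = k := by obtain ⟨m, hm⟩ := hev; omega
  obtain ⟨C₁, hC₁, herr⟩ := exists_error_bound k F a b T σ hab hT
  obtain ⟨C₂, hC₂, hchain⟩ := exists_chain_bound k hk F a b σ hab 0 K hK Q
  obtain ⟨C₃, hC₃, hstar⟩ := exists_star_bound k hk F a b σ hab K hK
  set R := 1 + (b - a) ^ 2 with hR
  have hR0 : 0 ≤ R := by positivity
  refine ⟨C₁ * (C₃ * C₂ * ((1 + k) * R)), by positivity, ?_⟩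
  intro N _ 𝓘 hreg hst u uh hpair M hM
  obtain ⟨hex, huh, uI, hI, h0⟩ := hpair
  have hv := hex.smoothFam hT
  have hun : Unisolvent k F 𝓘 := hst.unisolvent hk hK hreg (Or.inl rfl)
  set v : ℝ → ℝ → ℂ := fun t x => u x t with hvdef
  have h0T : (0:ℝ) ∈ Icc 0 T := ⟨le_rfl, hT.le⟩
  have hM0 : 0 ≤ M := (norm_nonneg _).trans (hM 0 h0T 0)
  have hsz := 𝓘.size_pos.le
  have hMR : M ≤ R * M := by
    have : 0 ≤ (b - a) ^ 2 * M := by positivity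
    rw [hR]; linarith
  have hM2 : SeminormBound T (2 * k + 1) u (R * M) := fun t ht x => by
    refine (seminormBound_of_add_two hab hv (n := 2 * k) (M := M) (by omega) ?_ t ht x).trans ?_
    · rwa [show 2 * k + 3 = k + 1 + (k + 2) by omega]
    · rw [hR]; linarith
  set B := C₂ * 𝓘.size ^ (k + 1 + 2 * Q) * (R * M) with hB
  have hB0 : 0 ≤ B := by positivity
  have hcd : ∀ t ∈ Icc 0 T, ∀ n ≤ k + 1 + (k + 2), ContDiff ℝ n (v t) := fun t ht n hn =>
    contDiff_of_le hn (hv.contDiff t ht)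
  have hcd2 : ∀ t ∈ Icc 0 T, ∀ n, n + 2 ≤ k + 1 + (k + 2) → ContDiff ℝ n (deriv (deriv (v t))) :=
    fun t ht n hn => contDiff_deriv (contDiff_deriv (n := n + 1) (hcd t ht _ hn))
  have hcd4 : ∀ t ∈ Icc 0 T, ∀ n, n + 4 ≤ k + 1 + (k + 2) →
      ContDiff ℝ n (deriv (deriv (deriv (deriv (v t))))) :=
    fun t ht n hn => contDiff_deriv (contDiff_deriv (n := n + 1) (hcd2 t ht _ hn))
  have hp2 : ∀ t ∈ Icc 0 T, Function.Periodic (deriv (deriv (v t))) (b - a) := fun t ht =>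
    periodic_deriv (periodic_deriv (hv.periodic t ht))
  have hb2 : ∀ t ∈ Icc 0 T, ∀ j, ∀ ξ ∈ Icc (0:ℝ) 1,
      ‖corrFun hk hun Q (deriv (deriv (v t))) j ξ‖ ≤ B := by
    intro t ht
    refine hchain N 𝓘 hreg (Or.inl rfl) hst _ _ (R * M) (hp2 t ht)
      (hcd2 t ht _ (by omega)) (fun i hi x => ?_) (isChain_corrFun hk hun Q (hcd2 t ht _ (by omega)))
    rw [iteratedDeriv_deriv_deriv]
    have := hM2 t ht x
    rwa [show 2 * k + 1 = k + 1 + 2 * Q + i + 2 by omega] at this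
  have hb4 : ∀ t ∈ Icc 0 T, ∀ j, ∀ ξ ∈ Icc (0:ℝ) 1,
      ‖corrFun hk hun Q (deriv (deriv (deriv (deriv (v t))))) j ξ‖ ≤ B := by
    intro t ht
    refine hchain N 𝓘 hreg (Or.inl rfl) hst _ _ (R * M) (periodic_deriv (periodic_deriv (hp2 t ht)))
      (hcd4 t ht _ (by omega)) (fun i hi x => ?_) (isChain_corrFun hk hun Q (hcd4 t ht _ (by omega)))
    rw [iteratedDeriv_deriv_deriv, iteratedDeriv_deriv_deriv]
    have := (hM t ht x).trans hMR
    rwa [show k + 1 + (k + 2) = k + 1 + 2 * Q + i + 2 + 2 by omega] at this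
  -- `St (v t)` removes the defect `w_Q[u_xx]` of the interpolant, which has mean zero in each cell.
  -- With comparison function `interpPoly - St`, the new defect is `St` of `u_xx`; it involves four
  -- derivatives of `u` inside `w_Q`, hence the order `2k + 3`.
  let St : (ℝ → ℂ) → Fin N → ℂ[X] := fun f =>
    solveOp hk hun (starData 𝓘 k (corrFun hk hun Q (deriv (deriv f))))
  have hStd : ∀ f j, (St f j).natDegree ≤ k := fun f => natDegree_solveOp hk hun _
  have hB2 := fun t (ht : t ∈ Icc 0 T) => hstar N 𝓘 hreg hst hun _ B hB0
    (fun j => continuous_corrFun hk hun Q (hcd2 t ht 0 (by omega)).continuous j) (hb2 t ht)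
  have hB4 := fun t (ht : t ∈ Icc 0 T) => hstar N 𝓘 hreg hst hun _ B hB0
    (fun j => continuous_corrFun hk hun Q (hcd4 t ht 0 (by omega)).continuous j) (hb4 t ht)
  set ε := (1 + k) * (C₃ * (𝓘.size * B)) with hε
  have hCB : 0 ≤ C₃ * (𝓘.size * B) := by positivity
  have hε0 : 0 ≤ ε := by positivity
  have hCBε : C₃ * (𝓘.size * B) ≤ ε := by
    rw [hε]
    have : (0:ℝ) ≤ k * (C₃ * (𝓘.size * B)) := by positivity
    linarith
  have hStpoint : ∀ {f : ℝ → ℂ} {j : Fin N}, cnorm k (St f j) ≤ C₃ * (𝓘.size * B) →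
      ∀ ξ ∈ Icc (0:ℝ) 1, ‖polyFun (St f j) ξ‖ ≤ ε := fun hle ξ hξ =>
    ((norm_eval_le_cnorm (hStd _ _) hξ).trans hle).trans hCBε
  have hSttime : ∀ t ∈ Icc 0 T, ∀ Φ : (Fin N → ℂ[X]) →ₗ[ℂ] ℂ, HasDerivWithinAt
      (fun t => Φ (St (v t))) (Complex.I * Φ (St (deriv (deriv (v t))))) (Icc 0 T) t := by
    intro t ht Φ
    have hF := (hv.corr hk hun Q 2 (by omega)).2
    have h1 := hasDerivWithinAt_solveOp hk hun
      (fun t ht => hasDerivWithinAt_starData (𝓘 := 𝓘) (k := k) hF ht) Φ ht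
    rw [map_smul, map_smul, smul_eq_mul] at h1
    simp only [← deriv_deriv_iteratedDeriv 2, ← deriv_deriv_iteratedDeriv 0, iteratedDeriv_zero] at h1
    exact h1
  have hone : ∀ {f : ℝ → ℂ}, ContDiff ℝ (2 * Q : ℕ) f → ∀ j, moment (corrFun hk hun Q f j) 1 = 0 :=
    fun hf j => moment_corrFun_eq_zero hk hun Q hf j (by simp; omega)
  have hStform : ∀ t ∈ Icc 0 T, ∀ j, ∀ φ : ℂ[X], φ.natDegree ≤ k →
      refForm F 𝓘 j φ (St (v t)) = 𝓘.len j * moment (corrFun hk hun Q (deriv (deriv (v t))) j) φ :=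
    fun t ht j φ hφ => refForm_star hk hun hab
      (fun j => continuous_corrFun hk hun Q (hcd2 t ht 0 (by omega)).continuous j) j
      (hone (hcd2 t ht _ (by omega)) j) hφ
  have key := herr N 𝓘 hreg u uh huh (fun t => interpPoly hk hun Q (v t) - St (v t))
    (fun t => interpPoly hk hun Q (deriv (deriv (v t))) - St (deriv (deriv (v t))))
    (fun t j => polyFun (St (deriv (deriv (v t))) j)) ε hε0
    (fun t ht => (hv.contDiff t ht).continuous)
    (fun t j => (natDegree_sub_le _ _).trans (max_le (natDegree_interpPoly hk hun Q _ j) (hStd _ j)))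
    (fun t j => (natDegree_sub_le _ _).trans (max_le (natDegree_interpPoly hk hun Q _ j) (hStd _ j)))
    (fun t ht j i => by
      simp only [Pi.sub_apply, coeff_sub, mul_sub]
      exact (hv.interp_coeff hk hun Q (by omega) ht j i).sub (hSttime t ht (coeffAt j i)))
    (fun t ht j φ hφ => by
      rw [map_sub, hStform t ht j φ hφ, refForm_interpPoly hk hun Q (by omega)
        (hcd t ht _ (by omega)) (hv.periodic t ht) j hφ]
      simp only [Pi.sub_apply]
      rw [moment_polyFun_sub]
      ring)
    (fun t ht j ξ hξ => hStpoint (hB4 t ht j).1 ξ hξ)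
    -- Now `u_h` starts from `u_I` rather than from the comparison function. The initial discrepancy
    -- is `St (v 0)`, of the order of the final bound.
    (fun j ξ hξ => by
      rw [h0, hI.refPoly_eq hk hun hT hv (by omega) h0T]
      simp only [Pi.sub_apply]
      rw [show interpPoly hk hun ((k - 1) / 2) (fun x => u x 0) = interpPoly hk hun Q (v 0) from rfl,
        sub_sub_cancel]
      exact hStpoint (hB2 0 h0T j).1 ξ hξ)
    (fun t ht j => by
      have htI : t ∈ Icc 0 T := ⟨ht.1.le, ht.2⟩
      obtain ⟨e1, e2⟩ := flux_interpPoly hk hun Q (hcd t htI _ (by omega)) j (F := F)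
      have e3 : fluxHat F 𝓘 (St (v t)) j = _ := fluxHat_solveOp hk hun _ j
      have e4 : fluxTilde F 𝓘 (St (v t)) j = _ := fluxTilde_solveOp hk hun _ j
      rw [map_sub, map_sub, Pi.sub_apply, Pi.sub_apply, e1, e2, e3, e4, sub_sub_cancel, sub_sub_cancel]
      refine ⟨(hB2 t htI j).2.1.trans hCBε, (hB2 t htI j).2.2.trans hCBε, ?_⟩
      have hrc : ContinuousOn (refFun 𝓘 (fun x => u x t) j) (Icc 0 1) :=
        (continuous_refFun 𝓘 (hv.contDiff t htI).continuous j).continuousOn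
      have e5 := moment_one_sub_interpPoly hk hun Q (by omega) (hcd t htI _ (by omega)) j (F := F)
      rw [hone (hcd t htI _ (by omega)) j, moment_sub_left hrc (continuous_polyFun _).continuousOn]
        at e5
      rw [moment_sub_left hrc (continuous_polyFun _).continuousOn, Pi.sub_apply, moment_polyFun_sub,
        ← sub_add, e5, zero_add]
      exact norm_moment_one_le (hStpoint (hB2 t htI j).1))
  intro t ht
  have e : C₁ * (C₃ * C₂ * ((1 + k) * R)) * M * 𝓘.size ^ (2 * k) = C₁ * ε := by
    rw [hε, hB, show 2 * k = k + 1 + 2 * Q + 1 by omega, pow_succ]; ring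
  rw [e]
  exact key t ht

end UWDG
end

/-! ### Assembly of the error estimates. -/

noncomputable section
namespace UWDG

theorem exists_fluxStable_of_assumptionA1_or_A2 (k : ℕ) (hk : 2 ≤ k) (F : Flux) (a b σ δ : ℝ)
    (hδ : 0 < δ) : ∃ K : ℝ, 0 ≤ K ∧ ∀ (N : ℕ) [NeZero N] (𝓘 : Mesh a b N), 𝓘.Regular σ →
      (AssumptionA1 k F δ 𝓘 ∨ AssumptionA2 k F 𝓘) → FluxStable k F 𝓘 0 K := by
  obtain ⟨K₁, h₁, H₁⟩ := exists_fluxStable_of_assumptionA1 k hk F a b σ δ hδ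
  obtain ⟨K₂, h₂, H₂⟩ := exists_fluxStable_of_assumptionA2 k hk F a b
  refine ⟨max K₁ K₂, h₁.trans (le_max_left _ _), fun N _ 𝓘 hreg h => ?_⟩
  rcases h with h | h
  · exact (H₁ N 𝓘 hreg h).mono (le_max_left _ _)
  · exact (H₂ N 𝓘 h).mono (le_max_right _ _)

theorem le_pow_pred {x C h : ℝ} (hh : 0 < h) {p r : ℕ} (hr : r + 1 = p) (hx : x * h ≤ C * h ^ p) :
    x ≤ C * h ^ r := by
  rw [← hr, pow_succ, ← mul_assoc] at hx
  exact le_of_mul_le_mul_right hx hh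

theorem errorRates_of_fluxStable (k : ℕ) (hk : 2 ≤ k) (F : Flux) (a b T σ : ℝ) (hab : a < b)
    (hT : 0 < T) (l : ℕ) {K : ℝ} (hK : 0 ≤ K)
    (adm : ∀ (N : ℕ) [NeZero N], Mesh a b N → Prop)
    (hadm : ∀ (N : ℕ) [NeZero N] (𝓘 : Mesh a b N), adm N 𝓘 → 𝓘.Uniform ∧ FluxStable k F 𝓘 l K)
    {s p r : ℕ} (hs : k + 3 + 2 * ((k - 1) / 2) + l * ((k - 1) / 2 + 1) ≤ s)
    (hp : p = k + 1 + 2 * ((k - 1) / 2)) (hr : r + 1 = p) :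
    ErrorRates k a b T σ F adm s (NormBound T s) p r := by
  obtain ⟨C, -, H⟩ := exists_error_rates k hk F a b T σ hab hT l K hK
  refine ⟨fun M => C * M, fun N _ 𝓘 hreg ha u uh hpair M hM t ht => ?_⟩
  obtain ⟨hu, hst⟩ := hadm N 𝓘 ha
  obtain ⟨h1, h2, h3⟩ := H N 𝓘 hreg (Or.inr hu) hst s u uh hs hpair M
    (fun i hi => ⟨hM _ (by omega), hM _ (by omega)⟩) t ht
  rw [← hp] at h1 h2 h3
  exact ⟨h1, le_pow_pred 𝓘.size_pos hr h2, h3⟩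

end UWDG
end

theorem theorem4p3 (k : ℕ) (hk : 2 ≤ k) (a b T σ δ : ℝ) (hab : a < b) (hT : 0 < T) (hδ : 0 < δ)
    (F : UWDG.Flux) :
    (Odd k →
      UWDG.ErrorRates k a b T σ F
        (fun _ _ 𝓘 => UWDG.AssumptionA1 k F δ 𝓘 ∨ UWDG.AssumptionA2 k F 𝓘)
        (k + 1 + 2 + 2 * ((k - 1) / 2))
        (UWDG.SeminormBound T (k + 1 + 2 + 2 * ((k - 1) / 2))) (2 * k) (2 * k - 1) ∧
      UWDG.ErrorRates k a b T σ F (fun _ _ 𝓘 => UWDG.AssumptionA3lt k F δ 𝓘)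
        (k + 3 + 2 + 3 * ((k - 1) / 2))
        (UWDG.NormBound T (k + 3 + 2 + 3 * ((k - 1) / 2))) (2 * k) (2 * k - 1) ∧
      UWDG.ErrorRates k a b T σ F (fun _ _ 𝓘 => UWDG.AssumptionA3eq k F 𝓘)
        (k + 4 + 2 + 4 * ((k - 1) / 2))
        (UWDG.NormBound T (k + 4 + 2 + 4 * ((k - 1) / 2))) (2 * k) (2 * k - 1)) ∧
    (Even k →
      (∃ C₁ C₂ : ℝ → ℝ, ∀ (N : ℕ) [NeZero N] (𝓘 : UWDG.Mesh a b N), 𝓘.Regular σ →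
        (UWDG.AssumptionA1 k F δ 𝓘 ∨ UWDG.AssumptionA2 k F 𝓘) →
        ∀ (u : ℝ → ℝ → ℂ) (uh : ℝ → UWDG.PiecewisePoly N),
        UWDG.IsSolutionPair k T F 𝓘 (k + 1 + (k + 2)) u uh →
        ∀ M₁ M₂ : ℝ, UWDG.SeminormBound T (k + 1 + (k + 2)) u M₁ →
        UWDG.SeminormBound T (k + 1 + k) u M₂ →
        ∀ t ∈ Set.Ioc 0 T,
          UWDG.errFlux F 𝓘 u uh t ≤
            √(C₁ M₁ * 𝓘.size ^ (4 * k)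
              + ∑ _j ∈ 𝓘.nonUniformCells, C₂ M₂ * 𝓘.size ^ (4 * k - 1)) ∧
          UWDG.errFluxDeriv F 𝓘 u uh t ≤
            √(C₁ M₁ * 𝓘.size ^ (4 * k)
              + ∑ _j ∈ 𝓘.nonUniformCells, C₂ M₂ * 𝓘.size ^ (4 * k - 1)) * 𝓘.size⁻¹ ∧
          UWDG.errCellAvg 𝓘 u uh t ≤
            √(C₁ M₁ * 𝓘.size ^ (4 * k)
              + ∑ _j ∈ 𝓘.nonUniformCells, C₂ M₂ * 𝓘.size ^ (4 * k - 1))) ∧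
      UWDG.ErrorRates k a b T σ F (fun _ _ 𝓘 => UWDG.AssumptionA3lt k F δ 𝓘)
        (k + 3 + 2 + 3 * ((k - 2) / 2))
        (UWDG.NormBound T (k + 3 + 2 + 3 * ((k - 2) / 2))) (2 * k - 1) (2 * k - 2) ∧
      UWDG.ErrorRates k a b T σ F (fun _ _ 𝓘 => UWDG.AssumptionA3eq k F 𝓘)
        (k + 4 + 2 + 4 * ((k - 2) / 2))
        (UWDG.NormBound T (k + 4 + 2 + 4 * ((k - 2) / 2))) (2 * k - 1) (2 * k - 2)) := by
  open UWDG in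
  have A3lt : ∀ s p r : ℕ, k + 3 + 2 * ((k - 1) / 2) + 1 * ((k - 1) / 2 + 1) ≤ s →
      p = k + 1 + 2 * ((k - 1) / 2) → r + 1 = p →
      ErrorRates k a b T σ F (fun _ _ 𝓘 => AssumptionA3lt k F δ 𝓘) s (NormBound T s) p r := by
    obtain ⟨K, hK, H⟩ := exists_fluxStable_of_assumptionA3lt k hk F a b δ hδ
    exact fun s p r hs hp hr => errorRates_of_fluxStable k hk F a b T σ hab hT 1 hK _
      (fun N _ 𝓘 h => ⟨h.1, H N 𝓘 h⟩) hs hp hr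
  open UWDG in
  have A3eq : ∀ s p r : ℕ, k + 3 + 2 * ((k - 1) / 2) + 2 * ((k - 1) / 2 + 1) ≤ s →
      p = k + 1 + 2 * ((k - 1) / 2) → r + 1 = p →
      ErrorRates k a b T σ F (fun _ _ 𝓘 => AssumptionA3eq k F 𝓘) s (NormBound T s) p r := by
    obtain ⟨K, hK, H⟩ := exists_fluxStable_of_assumptionA3eq k hk F a b
    exact fun s p r hs hp hr => errorRates_of_fluxStable k hk F a b T σ hab hT 2 hK _
      (fun N _ 𝓘 h => ⟨h.1, H N 𝓘 h⟩) hs hp hr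
  obtain ⟨K, hK, hst⟩ := UWDG.exists_fluxStable_of_assumptionA1_or_A2 k hk F a b σ δ hδ
  refine ⟨fun hodd => ⟨?_, ?_, ?_⟩, fun heven => ⟨?_, ?_, ?_⟩⟩
  · obtain ⟨C, -, H⟩ := UWDG.exists_error_rates k hk F a b T σ hab hT 0 K hK
    refine ⟨fun M => C * ((1 + (b - a) ^ 2) * M), fun N _ 𝓘 hreg ha u uh hpair M hM t ht => ?_⟩
    have hv := hpair.1.smoothFam hT
    have hM0 : 0 ≤ M := (norm_nonneg _).trans (hM 0 ⟨le_rfl, hT.le⟩ 0)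
    have hM1 : 0 ≤ (b - a) ^ 2 * M := by positivity
    -- The cell average estimate uses a seminorm of two orders less than the assumed one;
    -- periodicity supplies it and contributes the factor `1 + (b - a) ^ 2` to the argument of the
    -- constant.
    have hlow := UWDG.seminormBound_of_add_two hab hv (n := k + 2 * ((k - 1) / 2)) (M := M)
      (by omega) (by rwa [show k + 2 * ((k - 1) / 2) + 3 = k + 1 + 2 + 2 * ((k - 1) / 2) by omega])
    have hall : ∀ i ≤ 0 * ((k - 1) / 2 + 1),
        UWDG.SeminormBound T (k + 1 + 2 * ((k - 1) / 2) + i) u ((1 + (b - a) ^ 2) * M) ∧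
        UWDG.SeminormBound T (k + 3 + 2 * ((k - 1) / 2) + i) u ((1 + (b - a) ^ 2) * M) := by
      refine fun i hi => ⟨fun t ht x => ?_, fun t ht x => ?_⟩
      · have := hlow t ht x
        rw [show k + 2 * ((k - 1) / 2) + 1 = k + 1 + 2 * ((k - 1) / 2) + i by omega] at this
        linarith
      · have := hM t ht x
        rw [show k + 1 + 2 + 2 * ((k - 1) / 2) = k + 3 + 2 * ((k - 1) / 2) + i by omega] at this
        linarith
    obtain ⟨h1, h2, h3⟩ := H N 𝓘 hreg (Or.inl rfl) (hst N 𝓘 hreg ha) _ u uh (by omega) hpair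
      ((1 + (b - a) ^ 2) * M) hall t ht
    rw [show k + 1 + 2 * ((k - 1) / 2) = 2 * k by obtain ⟨m, hm⟩ := hodd; omega] at h1 h2 h3
    exact ⟨h1, UWDG.le_pow_pred 𝓘.size_pos (by omega) h2, h3⟩
  · obtain ⟨m, hm⟩ := hodd
    exact A3lt _ _ _ (by omega) (by omega) (by omega)
  · obtain ⟨m, hm⟩ := hodd
    exact A3eq _ _ _ (by omega) (by omega) (by omega)
  · obtain ⟨C, hC, H⟩ := UWDG.exists_error_rates_even k hk heven F a b T σ hab hT K hK
    -- The correction with nonvanishing fluxes gives order `2k` on every regular mesh admissible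
    -- under A1 or A2, so the term over the nonuniform cells may carry the constant 0. Squaring `C *
    -- M` makes the square root collapse.
    refine ⟨fun M => (C * M) ^ 2, fun _ => 0,
      fun N _ 𝓘 hreg ha u uh hpair M _ hM _ t ht => ?_⟩
    have hM0 : 0 ≤ M := (norm_nonneg _).trans (hM 0 ⟨le_rfl, hT.le⟩ 0)
    have hs := 𝓘.size_pos
    have e : √((C * M) ^ 2 * 𝓘.size ^ (4 * k)
        + ∑ _j ∈ 𝓘.nonUniformCells, 0 * 𝓘.size ^ (4 * k - 1)) = C * M * 𝓘.size ^ (2 * k) := by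
      rw [Finset.sum_eq_zero fun _ _ => zero_mul _, add_zero, show 4 * k = 2 * k * 2 by omega,
        pow_mul, ← mul_pow, Real.sqrt_sq (by positivity)]
    rw [e]
    obtain ⟨h1, h2, h3⟩ := H N 𝓘 hreg (hst N 𝓘 hreg ha) u uh hpair M hM t ht
    exact ⟨h1, (le_mul_inv_iff₀ hs).2 h2, h3⟩
  · obtain ⟨m, hm⟩ := heven
    exact A3lt _ _ _ (by omega) (by omega) (by omega)
  · obtain ⟨m, hm⟩ := heven
    exact A3eq _ _ _ (by omega) (by omega) (by omega)
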